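/- A partition of $2^W$ into $k$ parts is a vector $P=(p_1,\dots,p_k)$ of non-negative integers with $\sum_i p_i=2^W$. A transaction $[i\to_\ell j]$, with $i\neq j$ in $\{1,\dots,k\}$ and $\ell\ge 0$, subtracts $2^\ell$ from $p_i$ and adds $2^\ell$ to $p_j$ (weights may become negative on the way); the dummy transaction $[j\to_W\bot]$ subtracts $2^W$ from $p_j$. The complexity $\lambda(P)$ is the least length of a sequence of transactions, the dummy one included, that makes all entries of $P$ equal to $0$. For partitions $P,P'$ put $$L_\infty^+(P',P)=\max_i\,(p'_i-p_i),\qquad L_{\infty,r}^+(P',P)=\max_i\frac{p'_i-p_i}{p_i},$$ the latter only if all $p_i>0$. For a distance $D$ consider: * Bounded-error problem: given $W$, $P$ and $e>0$, find a partition $P'$ of $2^W$ with $D(P',P)<e$ that minimizes $\lambda(P')$. * Bounded-length problem: given $W$, $P$ and an integer $n\ge 1$, find a partition $P'$ of $2^W$ with $\lambda(P')\le n$ that minimizes $D(P',P)$. Computation is on a random access machine with unit-cost operations on words (comparison, addition, subtraction, multiplication, integer division and remainder, bitwise operations, shifts, position of the highest set bit, indirect addressing). The error bound is given as a fraction $e=a/b$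 of positive integers. If $w>W$ is such that all the numbers in the input are less than $2^w$, then every number that occurs in the computation must have $O(w)$ bits. Theorem. Let $D$ be $L_\infty^+$ or $L_{\infty,r}^+$. For all $W\ge1$ (and all $k$, $n$, $P$, $e$), the bounded-error problem for $D$ can be solved in $O(k\lg (W+1))$ time, and the bounded-length problem for $D$ can be solved in $O(W(k\lg (W+1)+T))$ time, where $T=\min(Wk,\;k+n\lg k)$. That is, for each of the four problems there are a single program and absolute constants in the $O$-bounds that work for all inputs. (For $W\ge 2$ one may write $\lg W$ instead of $\lg(W+1)$.) -/

import Mathlib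

namespace TCAM

/-! ### Partitions, transactions and complexity -/

/-- `P` is a partition of `2 ^ W` into `k` parts (non-negative integers). -/
def IsPartition {k : ℕ} (W : ℕ) (P : Fin k → ℕ) : Prop :=
  ∑ i, P i = 2 ^ W

/-- Transactions between `k` targets.  `transfer i j l h` is `[i →_l j]` with `i ≠ j`: it moves
`2 ^ l` from the sender `i` to the receiver `j`.  `discharge j` is the dummy transaction
`[j →_W ⊥]`: it moves `2 ^ W` from `j` out of the system. -/
inductive Transaction (k : ℕ) : Type
  | transfer (i j : Fin k) (l : ℕ) (h : i ≠ j)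
  | discharge (j : Fin k)

/-- The effect of one transaction on a vector of weights (weights may become negative). -/
def Transaction.apply {k : ℕ} (W : ℕ) (x : Fin k → ℤ) : Transaction k → Fin k → ℤ
  | .transfer i j l _ => fun m =>
      if m = i then x m - 2 ^ l else if m = j then x m + 2 ^ l else x m
  | .discharge j => fun m => if m = j then x m - 2 ^ W else x m

/-- The sequence `s` induces `P`: applying `s` to `P` makes all the weights zero.  (If `P` is a
partition of `2 ^ W`, such an `s` has exactly one dummy transaction, since transfers keep the sum
of the weights.) -/
def Induces {k : ℕ} (W : ℕ) (s : List (Transaction k)) (P : Fin k → ℕ) : Prop :=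
  s.foldl (Transaction.apply W) (fun i => (P i : ℤ)) = fun _ => 0

/-- The complexity `λ(P)` of a partition `P` of `2 ^ W`: the length of a shortest sequence that
induces `P` (the dummy transaction is counted). -/
noncomputable def complexity {k : ℕ} (W : ℕ) (P : Fin k → ℕ) : ℕ :=
  sInf {m : ℕ | ∃ s : List (Transaction k), s.length = m ∧ Induces W s P}

/-! ### The one-sided distances and the two approximation problems -/

/-- Names of the two one-sided distances: `L∞⁺` and the relative version `L∞,r⁺`. -/
inductive OneSidedDistance : Type
  | absolute
  | relative

/-- `D.dist P' P` is the distance of `P'` from `P`: the maximum over `i` of `p'_i - p_i`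
(absolute), respectively of `(p'_i - p_i) / p_i` (relative).  The supremum is over a finite
index set, which is non-empty when `P` is a partition, hence is a maximum. -/
noncomputable def OneSidedDistance.dist {k : ℕ} :
    OneSidedDistance → (Fin k → ℕ) → (Fin k → ℕ) → ℝ
  | .absolute, P', P => ⨆ i, ((P' i : ℝ) - (P i : ℝ))
  | .relative, P', P => ⨆ i, ((P' i : ℝ) - (P i : ℝ)) / (P i : ℝ)

/-- The distance from `P` makes sense: in the relative case no part of `P` may be zero. -/
def OneSidedDistance.DefinedAt {k : ℕ} : OneSidedDistance → (Fin k → ℕ) → Prop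
  | .absolute, _ => True
  | .relative, P => ∀ i, 0 < P i

/-- `P'` solves the bounded-error problem for `P` and `e`: it has minimum complexity among all
partitions of `2 ^ W` at distance less than `e` from `P`. -/
def IsBoundedErrorSolution {k : ℕ} (D : OneSidedDistance) (W : ℕ) (e : ℝ)
    (P P' : Fin k → ℕ) : Prop :=
  (IsPartition W P' ∧ D.dist P' P < e) ∧
    ∀ Q : Fin k → ℕ, IsPartition W Q → D.dist Q P < e → complexity W P' ≤ complexity W Q

/-- `P'` solves the bounded-length problem for `P` and `n`: it is at minimum distance from `P`
among all partitions of `2 ^ W` of complexity at most `n`. -/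
def IsBoundedLengthSolution {k : ℕ} (D : OneSidedDistance) (W n : ℕ)
    (P P' : Fin k → ℕ) : Prop :=
  (IsPartition W P' ∧ complexity W P' ≤ n) ∧
    ∀ Q : Fin k → ℕ, IsPartition W Q → complexity W Q ≤ n → D.dist P' P ≤ D.dist Q P

/-! ### A random access machine with unit-cost word operations -/

/-- Binary word operations.  Words are natural numbers; subtraction is truncated at zero, and
division and remainder by zero give `0` and the dividend, respectively. -/
inductive WordOp : Type
  | add | sub | mul | div | mod | and | or | xor | shiftLeft | shiftRight

def WordOp.eval : WordOp → ℕ → ℕ → ℕ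
  | .add, x, y => x + y
  | .sub, x, y => x - y
  | .mul, x, y => x * y
  | .div, x, y => x / y
  | .mod, x, y => x % y
  | .and, x, y => x &&& y
  | .or, x, y => x ||| y
  | .xor, x, y => x ^^^ y
  | .shiftLeft, x, y => x <<< y
  | .shiftRight, x, y => x >>> y

/-- Instructions.  Numbers `d`, `a`, `b` in them are names of registers. -/
inductive Instr : Type
  /-- `r_d := v` -/
  | const (d v : ℕ)
  /-- `r_d := r_a o r_b` -/
  | op (o : WordOp) (d a b : ℕ)
  /-- `r_d :=` position of the highest set bit of `r_a` (`0` if `r_a = 0`) -/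
  | msb (d a : ℕ)
  /-- `r_d := mem[r_a]` -/
  | load (d a : ℕ)
  /-- `mem[r_a] := r_b` -/
  | store (a b : ℕ)
  /-- go to line `l` -/
  | jump (l : ℕ)
  /-- if `r_a < r_b` go to line `l` -/
  | jumpLT (a b l : ℕ)

/-- A program is a fixed finite list of instructions, numbered from `0`. -/
abbrev Program : Type := List Instr

/-- A configuration: program counter, registers, memory cells. -/
structure Config : Type where
  pc : ℕ
  reg : ℕ → ℕ
  mem : ℕ → ℕ

def Instr.exec (s : Config) : Instr → Config
  | .const d v => ⟨s.pc + 1, Function.update s.reg d v, s.mem⟩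
  | .op o d a b => ⟨s.pc + 1, Function.update s.reg d (o.eval (s.reg a) (s.reg b)), s.mem⟩
  | .msb d a => ⟨s.pc + 1, Function.update s.reg d (Nat.log2 (s.reg a)), s.mem⟩
  | .load d a => ⟨s.pc + 1, Function.update s.reg d (s.mem (s.reg a)), s.mem⟩
  | .store a b => ⟨s.pc + 1, s.reg, Function.update s.mem (s.reg a) (s.reg b)⟩
  | .jump l => ⟨l, s.reg, s.mem⟩
  | .jumpLT a b l => ⟨if s.reg a < s.reg b then l else s.pc + 1, s.reg, s.mem⟩

/-- One step; the machine has halted when the program counter is outside the program. -/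
def Program.step (prog : Program) (s : Config) : Config :=
  match prog[s.pc]? with
  | none => s
  | some i => i.exec s

/-- The configuration after `t` steps. -/
def Program.run (prog : Program) (t : ℕ) (s : Config) : Config :=
  prog.step^[t] s

/-- The initial configuration: the numbers `args` are in the first registers, the vector `P` is in
the memory cells `0, …, k - 1`, and everything else is `0`. -/
def initial {k : ℕ} (args : List ℕ) (P : Fin k → ℕ) : Config where
  pc := 0
  reg r := args.getD r 0
  mem m := if h : m < k then P ⟨m, h⟩ else 0

/-- Started from `s`, the program halts after at most `τ` steps with the vector `out` in the memory
cells `0, …, k - 1`, and every number that is ever in a register or a memory cell during the run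
has at most `bits` bits. -/
def Program.OutputsWithin {k : ℕ} (prog : Program) (bits : ℕ) (s : Config) (out : Fin k → ℕ)
    (τ : ℝ) : Prop :=
  ∃ t : ℕ, (t : ℝ) ≤ τ ∧
    prog.length ≤ (prog.run t s).pc ∧
    (∀ i : Fin k, (prog.run t s).mem i = out i) ∧
    ∀ u ≤ t, ∀ m : ℕ, (prog.run u s).reg m < 2 ^ bits ∧ (prog.run u s).mem m < 2 ^ bits

/-- The bounded-error problem for `D` is solvable in time `O(τ W k)`, with unit-cost operations on
words whose length is at most a constant times the length `w` of the input words: one program and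
constants `c`, `C` work for all inputs.  The input is `W`, `k`, `P`, and the error bound
`e = a / b > 0`; all the input numbers, and `2 ^ W`, fit into `w` bits. -/
def BoundedErrorSolvableIn (D : OneSidedDistance) (τ : ℕ → ℕ → ℝ) : Prop :=
  ∃ (prog : Program) (c C : ℕ), ∀ (w W k a b : ℕ) (P : Fin k → ℕ),
    1 ≤ W → W < w → k < 2 ^ w → a < 2 ^ w → b < 2 ^ w → 0 < a → 0 < b →
    IsPartition W P → D.DefinedAt P →
    ∃ P' : Fin k → ℕ, IsBoundedErrorSolution D W ((a : ℝ) / (b : ℝ)) P P' ∧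
      prog.OutputsWithin (c * w) (initial [W, k, a, b] P) P' (C * τ W k)

/-- The bounded-length problem for `D` is solvable in time `O(τ W k n)`, in the same sense.  The
input is `W`, `k`, `P`, and the bound `n ≥ 1` on the complexity. -/
def BoundedLengthSolvableIn (D : OneSidedDistance) (τ : ℕ → ℕ → ℕ → ℝ) : Prop :=
  ∃ (prog : Program) (c C : ℕ), ∀ (w W k n : ℕ) (P : Fin k → ℕ),
    1 ≤ W → W < w → k < 2 ^ w → n < 2 ^ w → 1 ≤ n →
    IsPartition W P → D.DefinedAt P →
    ∃ P' : Fin k → ℕ, IsBoundedLengthSolution D W n P P' ∧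
      prog.OutputsWithin (c * w) (initial [W, k, n] P) P' (C * τ W k n)

end TCAM

set_option linter.unusedSimpArgs false
set_option linter.unusedSectionVars false
namespace TCAM

/-! ### A structured language over the machine -/

/-! Add the outside target as one more coordinate, of weight `-2 ^ W`. A partition becomes an
integer vector of sum zero (`ext`), and every transaction, the dummy one included, becomes a
transfer of a power of two between two coordinates. `Zeroes n v` means that `n` transfers suffice.
Transfers of other sizes to or from the outside target give no advantage (`exists_induces`), so
`complexity_le_iff` reduces the complexity to `Zeroes`.

Transfers commute, so the unit transfers can be collected in one vector `d` of sum zero that makes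
`v + d` even; the remaining transfers act on half of it. Changing an entry by two units is no better
than using a transfer of size two (`Zeroes.split_balanced`). Hence exactly the odd entries change,
each by one, half of them upwards and half downwards, and the cost of the level is fixed. The only
choice is which half goes up. Compare integers by their binary digits, the lowest digit being the
most significant (`RLe`): by the exchange argument `Zeroes.swap`, raising the larger of two entries
is never worse. So the greedy round is exact (`zeroes_iff_half`, `zeroes_iff_round`), and repeating
it for all levels determines the complexity.

For bounded error, the condition on the distance is a system of upper bounds `Q i ≤ u i`
(`OneSidedDistance.dist_lt_iff`). An optimal vector below `u` arises as follows: take the largest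
`l` for which the multiples of `2 ^ l` below `u` still reach the sum `2 ^ W`, round `u` down to
these multiples, and take `2 ^ l` away from as many of the smallest odd multiples, in the reversed
order, as is needed to make the sum exact (`Zeroes.round_down`). The level is found by binary search
in `[0, W]` with tests in time `O(k)`, and the smallest multiples by selection in linear time. This
gives `O(k lg (W + 1))`.

For bounded length, all distances from `P` are fractions with denominators at most `2 ^ W`, so
distinct ones differ by at least `1 / 2 ^ (2 * W)` (`OneSidedDistance.dist_gap`), and they lie
between `0` and `2 ^ W`. A binary search over the multiples of `1 / 2 ^ (2 * W)` takes `3 * W + 1`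
steps. Each step solves a bounded-error problem and tests whether the solution has complexity at
most `n`. The test performs greedy rounds on linked lists that hold the entries by their lowest
digit one. A round with `len` entries takes time `O(len)` and adds `len / 2` to the count, and the
test stops when the count exceeds `n`; so the total length of the lists is bounded both by `W * k`
and by a multiple of `n`, up to a last list of at most `k` entries.

On the machine, two words are compared in the reversed order by a constant number of word operations
(`and_rmask_lt_iff`), and selection uses medians of medians (`runIter_select`). The algorithms are
written in a small structured language with a time semantics; `Exec.goes` transfers correctness,
time and word length to machine programs, with words of `20 * w` bits. -/

/-- Expressions over registers and memory. -/
inductive Expr : Type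
  | reg (n : ℕ)
  | lit (n : ℕ)
  | op (o : WordOp) (a b : Expr)
  | msb (a : Expr)
  | load (a : Expr)

/-- Structured statements; `ite a b` and `loop a b` test `a < b`. -/
inductive Stmt : Type
  | skip
  | set (d : ℕ) (e : Expr)
  | store (a e : Expr)
  | seq (c d : Stmt)
  | ite (a b : Expr) (c d : Stmt)
  | loop (a b : Expr) (c : Stmt)

/-- Registers and memory. -/
@[ext] structure St : Type where
  r : ℕ → ℕ
  m : ℕ → ℕ

namespace St

def set (s : St) (d v : ℕ) : St := ⟨Function.update s.r d v, s.m⟩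

def put (s : St) (a v : ℕ) : St := ⟨s.r, Function.update s.m a v⟩

@[simp] theorem set_r (s : St) (d v x : ℕ) : (s.set d v).r x = if x = d then v else s.r x := by
  simp [set, Function.update_apply]

@[simp] theorem set_m (s : St) (d v : ℕ) : (s.set d v).m = s.m := rfl

@[simp] theorem put_r (s : St) (a v : ℕ) : (s.put a v).r = s.r := rfl

theorem put_m (s : St) (a v x : ℕ) : (s.put a v).m x = if x = a then v else s.m x := by
  simp [put, Function.update_apply]

/-- All the words are less than `N`. -/
def Bdd (N : ℕ) (s : St) : Prop := (∀ x, s.r x < N) ∧ ∀ x, s.m x < N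

theorem Bdd.set {N : ℕ} {s : St} (h : s.Bdd N) {d v : ℕ} (hv : v < N) : (s.set d v).Bdd N := by
  refine ⟨fun x => ?_, h.2⟩
  rw [set_r]; split
  · exact hv
  · exact h.1 x

theorem Bdd.put {N : ℕ} {s : St} (h : s.Bdd N) {a v : ℕ} (hv : v < N) : (s.put a v).Bdd N := by
  refine ⟨h.1, fun x => ?_⟩
  rw [put_m]; split
  · exact hv
  · exact h.2 x

end St

namespace Expr

def eval : Expr → St → ℕ
  | reg n, s => s.r n
  | lit n, _ => n
  | op o a b, s => o.eval (a.eval s) (b.eval s)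
  | msb a, s => Nat.log2 (a.eval s)
  | load a, s => s.m (a.eval s)

/-- The results of the operations that can increase the length of words are less than `N`. -/
def Ok (N : ℕ) (s : St) : Expr → Prop
  | reg _ => True
  | lit _ => True
  | op .add a b => a.Ok N s ∧ b.Ok N s ∧ a.eval s + b.eval s < N
  | op .mul a b => a.Ok N s ∧ b.Ok N s ∧ a.eval s * b.eval s < N
  | op .shiftLeft a b => a.Ok N s ∧ b.Ok N s ∧ a.eval s <<< b.eval s < N
  | op _ a b => a.Ok N s ∧ b.Ok N s
  | msb a => a.Ok N s
  | load a => a.Ok N s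

/-- All literals are at most `L` and all registers are below `T`. -/
def wf (T L : ℕ) : Expr → Bool
  | reg n => decide (n < T)
  | lit n => decide (n ≤ L)
  | op _ a b => a.wf T L && b.wf T L
  | msb a => a.wf T L
  | load a => a.wf T L

instance : Add Expr := ⟨op .add⟩
instance : Sub Expr := ⟨op .sub⟩
instance : Mul Expr := ⟨op .mul⟩
instance : Div Expr := ⟨op .div⟩
instance : Mod Expr := ⟨op .mod⟩
instance : HAnd Expr Expr Expr := ⟨op .and⟩
instance : HOr Expr Expr Expr := ⟨op .or⟩
instance : HXor Expr Expr Expr := ⟨op .xor⟩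
instance : HShiftLeft Expr Expr Expr := ⟨op .shiftLeft⟩
instance : HShiftRight Expr Expr Expr := ⟨op .shiftRight⟩

section
variable (a b : Expr) (s : St) (N n : ℕ)

@[simp] theorem eval_reg : (reg n).eval s = s.r n := rfl
@[simp] theorem eval_lit : (lit n).eval s = n := rfl
@[simp] theorem eval_add : (a + b).eval s = a.eval s + b.eval s := rfl
@[simp] theorem eval_sub : (a - b).eval s = a.eval s - b.eval s := rfl
@[simp] theorem eval_mul : (a * b).eval s = a.eval s * b.eval s := rfl
@[simp] theorem eval_div : (a / b).eval s = a.eval s / b.eval s := rfl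
@[simp] theorem eval_mod : (a % b).eval s = a.eval s % b.eval s := rfl
@[simp] theorem eval_and : (a &&& b).eval s = a.eval s &&& b.eval s := rfl
@[simp] theorem eval_or : (a ||| b).eval s = a.eval s ||| b.eval s := rfl
@[simp] theorem eval_xor : (a ^^^ b).eval s = a.eval s ^^^ b.eval s := rfl
@[simp] theorem eval_shl : (a <<< b).eval s = a.eval s <<< b.eval s := rfl
@[simp] theorem eval_shr : (a >>> b).eval s = a.eval s >>> b.eval s := rfl
@[simp] theorem eval_msb : (msb a).eval s = Nat.log2 (a.eval s) := rfl
@[simp] theorem eval_load : (load a).eval s = s.m (a.eval s) := rfl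

@[simp] theorem ok_reg : (reg n).Ok N s ↔ True := Iff.rfl
@[simp] theorem ok_lit : (lit n).Ok N s ↔ True := Iff.rfl
@[simp] theorem ok_add : (a + b).Ok N s ↔ a.Ok N s ∧ b.Ok N s ∧ a.eval s + b.eval s < N := Iff.rfl
@[simp] theorem ok_sub : (a - b).Ok N s ↔ a.Ok N s ∧ b.Ok N s := Iff.rfl
@[simp] theorem ok_mul : (a * b).Ok N s ↔ a.Ok N s ∧ b.Ok N s ∧ a.eval s * b.eval s < N := Iff.rfl
@[simp] theorem ok_div : (a / b).Ok N s ↔ a.Ok N s ∧ b.Ok N s := Iff.rfl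
@[simp] theorem ok_mod : (a % b).Ok N s ↔ a.Ok N s ∧ b.Ok N s := Iff.rfl
@[simp] theorem ok_and : (a &&& b).Ok N s ↔ a.Ok N s ∧ b.Ok N s := Iff.rfl
@[simp] theorem ok_or : (a ||| b).Ok N s ↔ a.Ok N s ∧ b.Ok N s := Iff.rfl
@[simp] theorem ok_xor : (a ^^^ b).Ok N s ↔ a.Ok N s ∧ b.Ok N s := Iff.rfl
@[simp] theorem ok_shl :
    (a <<< b).Ok N s ↔ a.Ok N s ∧ b.Ok N s ∧ a.eval s <<< b.eval s < N := Iff.rfl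
@[simp] theorem ok_shr : (a >>> b).Ok N s ↔ a.Ok N s ∧ b.Ok N s := Iff.rfl
@[simp] theorem ok_msb : (msb a).Ok N s ↔ a.Ok N s := Iff.rfl
@[simp] theorem ok_load : (load a).Ok N s ↔ a.Ok N s := Iff.rfl
end

/-- Every operation on words below a power of two gives a word below it, under `Ok`. -/
theorem op_lt {o : WordOp} {a b : Expr} {s : St} {bits : ℕ} (h : (op o a b).Ok (2 ^ bits) s)
    (ha : a.eval s < 2 ^ bits) (hb : b.eval s < 2 ^ bits) :
    o.eval (a.eval s) (b.eval s) < 2 ^ bits := by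
  cases o
  case add => exact h.2.2
  case mul => exact h.2.2
  case shiftLeft => exact h.2.2
  case sub => exact lt_of_le_of_lt (Nat.sub_le _ _) ha
  case div => exact lt_of_le_of_lt (Nat.div_le_self _ _) ha
  case mod => exact lt_of_le_of_lt (Nat.mod_le _ _) ha
  case and => exact Nat.and_lt_two_pow _ hb
  case or => exact Nat.or_lt_two_pow ha hb
  case xor => exact Nat.xor_lt_two_pow ha hb
  case shiftRight => exact lt_of_le_of_lt (Nat.shiftRight_le _ _) ha

theorem Ok.op_left {o : WordOp} {a b : Expr} {s : St} {N : ℕ} (h : (op o a b).Ok N s) :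
    a.Ok N s := by cases o <;> exact h.1

theorem Ok.op_right {o : WordOp} {a b : Expr} {s : St} {N : ℕ} (h : (op o a b).Ok N s) :
    b.Ok N s := by
  cases o
  case add => exact h.2.1
  case mul => exact h.2.1
  case shiftLeft => exact h.2.1
  all_goals exact h.2

theorem eval_lt {T L bits : ℕ} (hL : L < 2 ^ bits) {s : St} (hs : s.Bdd (2 ^ bits)) :
    ∀ {e : Expr}, e.wf T L = true → e.Ok (2 ^ bits) s → e.eval s < 2 ^ bits
  | reg n, _, _ => hs.1 n
  | lit n, h, _ => lt_of_le_of_lt (by simpa [wf] using h) hL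
  | op o a b, h, hk => by
    simp only [wf, Bool.and_eq_true] at h
    exact op_lt hk (eval_lt hL hs h.1 hk.op_left) (eval_lt hL hs h.2 hk.op_right)
  | msb a, h, hk => by
    have ha : a.eval s < 2 ^ bits := eval_lt hL hs (by simpa [wf] using h) hk
    refine lt_of_le_of_lt ?_ ha
    show Nat.log2 (a.eval s) ≤ a.eval s
    exact Nat.log2_le_self _
  | load a, _, _ => hs.2 _

end Expr

namespace Stmt

def writes : Stmt → List ℕ
  | skip => []
  | set d _ => [d]
  | store _ _ => []
  | seq c d => c.writes ++ d.writes
  | ite _ _ c d => c.writes ++ d.writes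
  | loop _ _ c => c.writes

def wf (T L : ℕ) : Stmt → Bool
  | skip => true
  | set d e => decide (d < T) && e.wf T L
  | store a e => a.wf T L && e.wf T L
  | seq c d => c.wf T L && d.wf T L
  | ite a b c d => a.wf T L && b.wf T L && c.wf T L && d.wf T L
  | loop a b c => a.wf T L && b.wf T L && c.wf T L

/-- Sequential composition of a list of statements. -/
def block : List Stmt → Stmt
  | [] => skip
  | [c] => c
  | c :: d :: cs => seq c (block (d :: cs))

end Stmt

/-! ### Timed semantics of statements and rules for total correctness -/

/-- `Exec N c s t s'`: from `s`, statement `c` ends in `s'` after `t` elementary statements, and all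
operations stay below `N`. -/
inductive Exec (N : ℕ) : Stmt → St → ℕ → St → Prop
  | skip (s) : Exec N .skip s 0 s
  | set {s d e} (h : e.Ok N s) : Exec N (.set d e) s 1 (s.set d (e.eval s))
  | store {s a e} (h : a.Ok N s) (h' : e.Ok N s) :
      Exec N (.store a e) s 1 (s.put (a.eval s) (e.eval s))
  | seq {c d s s₁ s₂ t₁ t₂} (h : Exec N c s t₁ s₁) (h' : Exec N d s₁ t₂ s₂) :
      Exec N (.seq c d) s (t₁ + t₂) s₂
  | ite_true {a b c d s s' t} (ha : a.Ok N s) (hb : b.Ok N s) (h : a.eval s < b.eval s)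
      (h' : Exec N c s t s') : Exec N (.ite a b c d) s (t + 1) s'
  | ite_false {a b c d s s' t} (ha : a.Ok N s) (hb : b.Ok N s) (h : ¬ a.eval s < b.eval s)
      (h' : Exec N d s t s') : Exec N (.ite a b c d) s (t + 1) s'
  | loop_true {a b c s s₁ s₂ t₁ t₂} (ha : a.Ok N s) (hb : b.Ok N s) (h : a.eval s < b.eval s)
      (h₁ : Exec N c s t₁ s₁) (h₂ : Exec N (.loop a b c) s₁ t₂ s₂) :
      Exec N (.loop a b c) s (t₁ + 1 + t₂) s₂
  | loop_false {a b c s} (ha : a.Ok N s) (hb : b.Ok N s) (h : ¬ a.eval s < b.eval s) :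
      Exec N (.loop a b c) s 1 s

theorem Exec.frame {N : ℕ} {c : Stmt} {s s' : St} {t : ℕ} (h : Exec N c s t s') :
    ∀ x, x ∉ c.writes → s'.r x = s.r x := by
  induction h with
  | skip => intro x _; rfl
  | set => intro x hx; simp [Stmt.writes] at hx; simp [hx]
  | store => intro x _; rfl
  | seq _ _ ih₁ ih₂ =>
    intro x hx; simp only [Stmt.writes, List.mem_append, not_or] at hx
    rw [ih₂ x hx.2, ih₁ x hx.1]
  | ite_true _ _ _ _ ih =>
    intro x hx; simp only [Stmt.writes, List.mem_append, not_or] at hx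
    exact ih x hx.1
  | ite_false _ _ _ _ ih =>
    intro x hx; simp only [Stmt.writes, List.mem_append, not_or] at hx
    exact ih x hx.2
  | loop_true _ _ _ _ _ ih₁ ih₂ => intro x hx; rw [ih₂ x hx, ih₁ x hx]
  | loop_false => intro x _; rfl

/-- From `s`, statement `c` ends within `T` elementary statements in a state that satisfies `Q`,
provided that the words in `s` are below `N`; then so are all the later ones. -/
def Run (N : ℕ) (c : Stmt) (s : St) (T : ℕ) (Q : St → Prop) : Prop :=
  s.Bdd N → ∃ t s', t ≤ T ∧ Exec N c s t s' ∧ s'.Bdd N ∧ Q s'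

/-- Registers that `c` does not write agree. -/
def Frame (c : Stmt) (s s' : St) : Prop := ∀ x, x ∉ c.writes → s'.r x = s.r x

/-- A bound on words that is good for a statement: a power of two above its literals. -/
structure WordBound (N : ℕ) : Prop where
  pow : ∃ bits, N = 2 ^ bits
  lit : 1000 < N

theorem Expr.eval_lt' {N : ℕ} (hN : WordBound N) {s : St} (hs : s.Bdd N) {e : Expr}
    (hw : e.wf 100 1000 = true) (hk : e.Ok N s) : e.eval s < N := by
  obtain ⟨⟨bits, rfl⟩, hl⟩ := hN
  exact Expr.eval_lt hl hs hw hk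

namespace Run
variable {N : ℕ} {c d : Stmt} {s : St} {T T₁ T₂ : ℕ} {Q Q' : St → Prop} {a b e : Expr}

/-- `Run` has the bound on the initial words as a premise; this makes it available as a hypothesis
of the whole proof. -/
theorem of_bdd (h : s.Bdd N → Run N c s T Q) : Run N c s T Q := fun hs => h hs hs

theorem conseq (h : Run N c s T₁ Q) (hT : T₁ ≤ T)
    (hQ : ∀ s', s'.Bdd N → Frame c s s' → Q s' → Q' s') : Run N c s T Q' := fun hs => by
  obtain ⟨t, s', ht, he, hb, hq⟩ := h hs
  exact ⟨t, s', ht.trans hT, he, hb, hQ s' hb he.frame hq⟩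

theorem skip (h : Q s) : Run N .skip s T Q := fun hs => ⟨0, s, Nat.zero_le _, .skip s, hs, h⟩

theorem seq (h : Run N c s T₁ Q) (hT : T₁ ≤ T)
    (h' : ∀ s', s'.Bdd N → Frame c s s' → Q s' → Run N d s' (T - T₁) Q') :
    Run N (.seq c d) s T Q' := fun hs => by
  obtain ⟨t, s', ht, he, hb, hq⟩ := h hs
  obtain ⟨t', s'', ht', he', hb', hq'⟩ := h' s' hb he.frame hq hb
  exact ⟨t + t', s'', by omega, .seq he he', hb', hq'⟩

theorem set {r : ℕ} (hN : WordBound N) (hw : e.wf 100 1000 = true) (hT : 1 ≤ T)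
    (he : s.Bdd N → e.Ok N s) (h : Q (s.set r (e.eval s))) : Run N (.set r e) s T Q := fun hs =>
  ⟨1, _, hT, .set (he hs), hs.set (e.eval_lt' hN hs hw (he hs)), h⟩

theorem store (hN : WordBound N) (hw : e.wf 100 1000 = true) (hT : 1 ≤ T)
    (ha : s.Bdd N → a.Ok N s) (he : s.Bdd N → e.Ok N s) (h : Q (s.put (a.eval s) (e.eval s))) :
    Run N (.store a e) s T Q := fun hs =>
  ⟨1, _, hT, .store (ha hs) (he hs), hs.put (e.eval_lt' hN hs hw (he hs)), h⟩

theorem set_seq {r : ℕ} (hN : WordBound N) (hw : e.wf 100 1000 = true) (hT : 1 ≤ T)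
    (he : s.Bdd N → e.Ok N s) (h : Run N d (s.set r (e.eval s)) (T - 1) Q) :
    Run N (.seq (.set r e) d) s T Q := fun hs => by
  obtain ⟨t', s'', ht', he', hb', hq'⟩ := h (hs.set (e.eval_lt' hN hs hw (he hs)))
  exact ⟨1 + t', s'', by omega, .seq (.set (he hs)) he', hb', hq'⟩

theorem store_seq (hN : WordBound N) (hw : e.wf 100 1000 = true) (hT : 1 ≤ T)
    (ha : s.Bdd N → a.Ok N s) (he : s.Bdd N → e.Ok N s)
    (h : Run N d (s.put (a.eval s) (e.eval s)) (T - 1) Q) :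
    Run N (.seq (.store a e) d) s T Q := fun hs => by
  obtain ⟨t', s'', ht', he', hb', hq'⟩ := h (hs.put (e.eval_lt' hN hs hw (he hs)))
  exact ⟨1 + t', s'', by omega, .seq (.store (ha hs) (he hs)) he', hb', hq'⟩

theorem ite (hT : 1 ≤ T) (ha : s.Bdd N → a.Ok N s) (hb : s.Bdd N → b.Ok N s)
    (h₁ : a.eval s < b.eval s → Run N c s (T - 1) Q)
    (h₂ : ¬ a.eval s < b.eval s → Run N d s (T - 1) Q) : Run N (.ite a b c d) s T Q := fun hs => by
  by_cases h : a.eval s < b.eval s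
  · obtain ⟨t', s'', ht', he', hb', hq'⟩ := h₁ h hs
    exact ⟨t' + 1, s'', by omega, .ite_true (ha hs) (hb hs) h he', hb', hq'⟩
  · obtain ⟨t', s'', ht', he', hb', hq'⟩ := h₂ h hs
    exact ⟨t' + 1, s'', by omega, .ite_false (ha hs) (hb hs) h he', hb', hq'⟩

/-- Rule for loops: `I τ s` says that `s` is an admissible state with time `τ` left. -/
theorem loop (I : ℕ → St → Prop) (h0 : I T s)
    (hstep : ∀ τ s', s'.Bdd N → Frame c s s' → I τ s' → a.Ok N s' ∧ b.Ok N s' ∧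
      (a.eval s' < b.eval s' → ∃ T', T' + 1 ≤ τ ∧ Run N c s' T' (I (τ - (T' + 1)))) ∧
      (¬ a.eval s' < b.eval s' → 1 ≤ τ ∧ Q s')) :
    Run N (.loop a b c) s T Q := by
  -- Strong induction on the time left: every round spends at least one unit, so the budget also
  -- proves termination.
  have key : ∀ τ s', Frame c s s' → I τ s' → Run N (.loop a b c) s' τ Q := by
    intro τ
    induction τ using Nat.strong_induction_on with
    | _ τ ih =>
    intro s' hf hI hs
    obtain ⟨ha, hb, h1, h2⟩ := hstep τ s' hs hf hI
    by_cases h : a.eval s' < b.eval s'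
    · obtain ⟨T', hT', hr⟩ := h1 h
      obtain ⟨t, s₁, ht, he, hb₁, hq⟩ := hr hs
      obtain ⟨t', s₂, ht', he', hb', hq'⟩ := ih (τ - (T' + 1)) (by omega) s₁
        (fun x hx => (he.frame x hx).trans (hf x hx)) hq hb₁
      exact ⟨t + 1 + t', s₂, by omega, .loop_true ha hb h he he', hb', hq'⟩
    · exact ⟨1, s', (h2 h).1, .loop_false ha hb h, hs, (h2 h).2⟩
  exact key T s (fun _ _ => rfl) h0

/-- Rule for loops that run a known number of times. -/
theorem for_loop (I : ℕ → St → Prop) (n B : ℕ) (h0 : I 0 s) (hT : n * (B + 1) + 1 ≤ T)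
    (hok : ∀ j s', s'.Bdd N → Frame c s s' → I j s' → a.Ok N s' ∧ b.Ok N s' ∧
      (a.eval s' < b.eval s' ↔ j < n))
    (hstep : ∀ j s', s'.Bdd N → Frame c s s' → j < n → I j s' → Run N c s' B (I (j + 1)))
    (hQ : ∀ s', s'.Bdd N → Frame c s s' → I n s' → Q s') :
    Run N (.loop a b c) s T Q := by
  -- The time left pays for the remaining `n - j` rounds and for the final failing test.
  apply loop (fun τ s' => ∃ j ≤ n, (n - j) * (B + 1) + 1 ≤ τ ∧ I j s')
  · exact ⟨0, Nat.zero_le _, by simpa using hT, h0⟩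
  · rintro τ s' hs hf ⟨j, hj, hτ, hI⟩
    obtain ⟨ha, hb, hc⟩ := hok j s' hs hf hI
    refine ⟨ha, hb, fun h => ⟨B, ?_, ?_⟩, fun h => ⟨by omega, ?_⟩⟩
    · have : 1 ≤ n - j := by have := hc.1 h; omega
      nlinarith
    · refine conseq (hstep j s' hs hf (hc.1 h) hI) le_rfl fun s'' _ _ h'' =>
        ⟨j + 1, hc.1 h, ?_, h''⟩
      have h1 : n - j = (n - (j + 1)) + 1 := by have := hc.1 h; omega
      rw [h1] at hτ
      have : (n - (j + 1) + 1) * (B + 1) = (n - (j + 1)) * (B + 1) + (B + 1) := by ring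
      omega
    · have : j = n := by
        by_contra hne
        exact h (hc.2 (by omega))
      subst this
      exact hQ s' hs hf hI

end Run

/-! ### Series of iterations, for recursion with an explicit stack -/

/-- Some complete iterations of the loop lead from `s` to a state that satisfies `Q`. -/
inductive Iter (N : ℕ) (a b : Expr) (c : Stmt) : St → ℕ → St → Prop
  | refl (s) : Iter N a b c s 0 s
  | step {s s₁ s₂ t₁ t₂} (ha : a.Ok N s) (hb : b.Ok N s) (h : a.eval s < b.eval s)
      (h₁ : Exec N c s t₁ s₁) (h₂ : Iter N a b c s₁ t₂ s₂) : Iter N a b c s (t₁ + 1 + t₂) s₂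

/-- `Run` for a number of complete iterations of a loop. -/
def RunIter (N : ℕ) (a b : Expr) (c : Stmt) (s : St) (T : ℕ) (Q : St → Prop) : Prop :=
  s.Bdd N → ∃ t s', t ≤ T ∧ Iter N a b c s t s' ∧ s'.Bdd N ∧ Q s'

namespace RunIter
variable {N : ℕ} {c : Stmt} {s : St} {T T₁ T₂ : ℕ} {Q Q' : St → Prop} {a b : Expr}

theorem of_bdd (h : s.Bdd N → RunIter N a b c s T Q) : RunIter N a b c s T Q := fun hs => h hs hs

theorem refl (h : Q s) : RunIter N a b c s T Q := fun hs => ⟨0, s, Nat.zero_le _, .refl s, hs, h⟩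

theorem _root_.TCAM.Iter.frame {s s' : St} {t : ℕ} (h : Iter N a b c s t s') : Frame c s s' := by
  induction h with
  | refl => intro x _; rfl
  | step _ _ _ h₁ _ ih => intro x hx; rw [ih x hx, h₁.frame x hx]

theorem _root_.TCAM.Iter.trans {s s₁ s₂ : St} {t₁ t₂ : ℕ} (h : Iter N a b c s t₁ s₁)
    (h' : Iter N a b c s₁ t₂ s₂) : Iter N a b c s (t₁ + t₂) s₂ := by
  induction h with
  | refl => simpa using h'
  | step ha hb hl h₁ _ ih => rw [add_assoc]; exact .step ha hb hl h₁ (ih h')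

theorem trans (h : RunIter N a b c s T₁ Q) (hT : T₁ ≤ T)
    (h' : ∀ s', s'.Bdd N → Frame c s s' → Q s' → RunIter N a b c s' (T - T₁) Q') :
    RunIter N a b c s T Q' := fun hs => by
  obtain ⟨t, s', ht, he, hb, hq⟩ := h hs
  obtain ⟨t', s'', ht', he', hb', hq'⟩ := h' s' hb he.frame hq hb
  exact ⟨t + t', s'', by omega, he.trans he', hb', hq'⟩

theorem step (ha : a.Ok N s) (hb : b.Ok N s) (hl : a.eval s < b.eval s) (h : Run N c s T₁ Q)
    (hT : T₁ + 1 ≤ T)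
    (h' : ∀ s', s'.Bdd N → Frame c s s' → Q s' → RunIter N a b c s' (T - (T₁ + 1)) Q') :
    RunIter N a b c s T Q' := fun hs => by
  obtain ⟨t, s', ht, he, hbd, hq⟩ := h hs
  obtain ⟨t', s'', ht', he', hb', hq'⟩ := h' s' hbd he.frame hq hbd
  exact ⟨t + 1 + t', s'', by omega, .step ha hb hl he he', hb', hq'⟩

theorem conseq (h : RunIter N a b c s T₁ Q) (hT : T₁ ≤ T)
    (hQ : ∀ s', s'.Bdd N → Frame c s s' → Q s' → Q' s') : RunIter N a b c s T Q' :=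
  h.trans hT fun s' hb hf hq => refl (hQ s' hb hf hq)

/-- A recursive call is a series of iterations of one loop body. Series can be chained; once the
test fails, they make up an execution of the loop. -/
theorem run_loop (h : RunIter N a b c s T₁ fun s' => a.Ok N s' ∧ b.Ok N s' ∧
      ¬ a.eval s' < b.eval s' ∧ Q s') (hT : T₁ + 1 ≤ T) : Run N (.loop a b c) s T Q := fun hs => by
  obtain ⟨t, s', ht, he, hb, h1, h2, h3, hq⟩ := h hs
  have : Exec N (.loop a b c) s (t + 1) s' := by
    clear ht hb hs h hq
    induction he with
    | refl s => exact (by simpa using Exec.loop_false (c := c) h1 h2 h3)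
    | step ha' hb' hl h₁ h₂ ih =>
      rw [add_assoc]
      exact .loop_true ha' hb' hl h₁ (ih h1 h2 h3)
  exact ⟨t + 1, s', by omega, this, hb, hq⟩

end RunIter

end TCAM

namespace TCAM

/-! ### Compilation -/

namespace Expr

/-- Code that puts the value into register `t`, using only registers from `t` on. -/
def comp (t : ℕ) : Expr → List Instr
  | reg n => [.op .or t n n]
  | lit n => [.const t n]
  | op o a b => a.comp t ++ (b.comp (t + 1) ++ [.op o t t (t + 1)])
  | msb a => a.comp t ++ [.msb t t]
  | load a => a.comp t ++ [.load t t]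

end Expr

namespace Stmt

/-- Code for a statement, to be placed at line `p`. -/
def comp (p : ℕ) : Stmt → List Instr
  | skip => []
  | set d e => e.comp 100 ++ [.op .or d 100 100]
  | store a e => a.comp 100 ++ (e.comp 101 ++ [.store 100 101])
  | seq c d => c.comp p ++ d.comp (p + (c.comp p).length)
  | ite a b c d =>
    let q := p + (a.comp 100).length + (b.comp 101).length
    let u := d.comp (q + 1)
    let v := c.comp (q + 1 + u.length + 1)
    a.comp 100 ++ (b.comp 101 ++ (.jumpLT 100 101 (q + 1 + u.length + 1) :: (u ++
      (.jump (q + 1 + u.length + 1 + v.length) :: v))))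
  | loop a b c =>
    let q := p + (a.comp 100).length + (b.comp 101).length
    let u := c.comp (q + 2)
    a.comp 100 ++ (b.comp 101 ++ (.jumpLT 100 101 (q + 2) ::
      .jump (q + 2 + u.length + 1) :: (u ++ [.jump p])))

/-- Number of machine steps for one elementary statement. -/
def unit : Stmt → ℕ
  | skip => 1
  | set _ e => (e.comp 100).length + 1
  | store a e => (a.comp 100).length + (e.comp 101).length + 1
  | seq c d => c.unit + d.unit
  | ite a b c d => (a.comp 100).length + (b.comp 101).length + 2 + c.unit + d.unit
  | loop a b c => (a.comp 100).length + (b.comp 101).length + 2 + c.unit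

end Stmt

def Config.Bdd (N : ℕ) (c : Config) : Prop := (∀ x, c.reg x < N) ∧ ∀ x, c.mem x < N

theorem Program.run_add (prog : Program) (t u : ℕ) (c : Config) :
    prog.run (t + u) c = prog.run u (prog.run t c) := by
  unfold Program.run
  rw [add_comm, Function.iterate_add_apply]

/-- The machine goes from `c` to `c'` in `t` steps through configurations with words below `N`. -/
def Program.Goes (prog : Program) (N : ℕ) (c : Config) (t : ℕ) (c' : Config) : Prop :=
  prog.run t c = c' ∧ ∀ u ≤ t, (prog.run u c).Bdd N

namespace Program.Goes
variable {prog : Program} {N : ℕ} {c c₁ c₂ : Config} {t t₁ t₂ : ℕ}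

theorem refl (h : c.Bdd N) : prog.Goes N c 0 c :=
  ⟨rfl, fun u hu => by rw [Nat.le_zero.1 hu]; exact h⟩

theorem bdd (h : prog.Goes N c t c₁) : c₁.Bdd N := h.1 ▸ h.2 t le_rfl

theorem trans (h : prog.Goes N c t₁ c₁) (h' : prog.Goes N c₁ t₂ c₂) :
    prog.Goes N c (t₁ + t₂) c₂ := by
  refine ⟨by rw [run_add, h.1, h'.1], fun u hu => ?_⟩
  by_cases hut : u ≤ t₁
  · exact h.2 u hut
  · obtain ⟨v, rfl⟩ := Nat.exists_eq_add_of_le (le_of_not_ge hut)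
    rw [run_add, h.1]
    exact h'.2 v (by omega)

theorem single {i : Instr} (hb : c.Bdd N) (hi : prog[c.pc]? = some i)
    (he : (i.exec c).Bdd N) : prog.Goes N c 1 (i.exec c) := by
  have h1 : prog.run 1 c = i.exec c := by simp [Program.run, Program.step, hi]
  refine ⟨h1, fun u hu => ?_⟩
  obtain rfl | rfl : u = 0 ∨ u = 1 := by omega
  · exact hb
  · rw [h1]; exact he

theorem jump {l : ℕ} (hb : c.Bdd N) (hi : prog[c.pc]? = some (.jump l)) :
    prog.Goes N c 1 ⟨l, c.reg, c.mem⟩ := single hb hi hb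

theorem jumpLT_true {a b l : ℕ} (hb : c.Bdd N) (hi : prog[c.pc]? = some (.jumpLT a b l))
    (h : c.reg a < c.reg b) : prog.Goes N c 1 ⟨l, c.reg, c.mem⟩ := by
  have := single hb hi hb
  simpa [Instr.exec, h] using this

theorem jumpLT_false {a b l : ℕ} (hb : c.Bdd N) (hi : prog[c.pc]? = some (.jumpLT a b l))
    (h : ¬ c.reg a < c.reg b) : prog.Goes N c 1 ⟨c.pc + 1, c.reg, c.mem⟩ := by
  have := single hb hi hb
  simpa [Instr.exec, h] using this

end Program.Goes

/-- The list `code` stands at line `p` of the program. -/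
def CodeAt (prog : Program) (p : ℕ) (code : List Instr) : Prop :=
  ∃ pre post, prog = pre ++ (code ++ post) ∧ pre.length = p

namespace CodeAt
variable {prog : Program} {p : ℕ} {u v : List Instr} {i : Instr}

theorem left (h : CodeAt prog p (u ++ v)) : CodeAt prog p u := by
  obtain ⟨pre, post, rfl, hp⟩ := h
  exact ⟨pre, v ++ post, by simp, hp⟩

theorem right (h : CodeAt prog p (u ++ v)) : CodeAt prog (p + u.length) v := by
  obtain ⟨pre, post, rfl, hp⟩ := h
  exact ⟨pre ++ u, post, by simp, by simp [hp]⟩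

theorem head (h : CodeAt prog p (i :: v)) : prog[p]? = some i := by
  obtain ⟨pre, post, rfl, rfl⟩ := h
  simp

theorem tail (h : CodeAt prog p (i :: v)) : CodeAt prog (p + 1) v := by
  obtain ⟨pre, post, rfl, hp⟩ := h
  exact ⟨pre ++ [i], post, by simp, by simp [hp]⟩

end CodeAt

/-- The configuration `c` represents the state `s`. -/
def Rep (c : Config) (s : St) : Prop := (∀ x < 100, c.reg x = s.r x) ∧ c.mem = s.m

theorem Config.Bdd.update {N : ℕ} {c : Config} (h : c.Bdd N) (p d : ℕ) {v : ℕ} (hv : v < N) :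
    Config.Bdd N ⟨p, Function.update c.reg d v, c.mem⟩ := by
  refine ⟨fun x => ?_, h.2⟩
  simp only [Function.update_apply]; split
  · exact hv
  · exact h.1 x

/-- The registers below `t` are left alone. So the first operand, in `t`, survives the evaluation of
the second one into `t + 1`, and the variables of the program, all below `100`, survive every
evaluation. -/
theorem Expr.comp_goes {prog : Program} {N : ℕ} (hN : WordBound N) {s : St} (hs : s.Bdd N) :
    ∀ (e : Expr) (t : ℕ) (c : Config), 100 ≤ t → e.wf 100 1000 = true → e.Ok N s →
      CodeAt prog c.pc (e.comp t) → Rep c s → c.Bdd N →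
      ∃ c', prog.Goes N c (e.comp t).length c' ∧ c'.pc = c.pc + (e.comp t).length ∧
        c'.mem = c.mem ∧ c'.reg t = e.eval s ∧ ∀ x < t, c'.reg x = c.reg x := by
  intro e
  induction e with
  | reg n =>
    intro t c ht hw _ hc hr hb
    have hn : n < 100 := by simpa [Expr.wf] using hw
    refine ⟨_, Program.Goes.single hb hc.head ?_, rfl, rfl, ?_, fun x hx => ?_⟩
    · exact hb.update _ _ (by simpa [WordOp.eval] using hb.1 n)
    · simp [Instr.exec, WordOp.eval, hr.1 n hn]
    · simp [Instr.exec, Function.update_apply, hx.ne]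
  | lit n =>
    intro t c ht hw _ hc hr hb
    have hn : n ≤ 1000 := by simpa [Expr.wf] using hw
    refine ⟨_, Program.Goes.single hb hc.head ?_, rfl, rfl, ?_, fun x hx => ?_⟩
    · exact hb.update _ _ (lt_of_le_of_lt hn hN.lit)
    · simp [Instr.exec]
    · simp [Instr.exec, Function.update_apply, hx.ne]
  | op o a b iha ihb =>
    intro t c ht hw hk hc hr hb
    have hw' := hw
    simp only [Expr.wf, Bool.and_eq_true] at hw
    obtain ⟨c₁, hg₁, hp₁, hm₁, he₁, hf₁⟩ := iha t c ht hw.1 hk.op_left hc.left hr hb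
    obtain ⟨c₂, hg₂, hp₂, hm₂, he₂, hf₂⟩ := ihb (t + 1) c₁ (by omega) hw.2 hk.op_right
      (by rw [hp₁]; exact hc.right.left)
      ⟨fun x hx => by rw [hf₁ x (by omega), hr.1 x hx], by rw [hm₁, hr.2]⟩ hg₁.bdd
    have hv : c₂.reg t = a.eval s := by rw [hf₂ t (by omega), he₁]
    have hlt : o.eval (c₂.reg t) (c₂.reg (t + 1)) < N := by
      rw [hv, he₂]; exact Expr.eval_lt' hN hs hw' hk
    refine ⟨Instr.exec c₂ (.op o t t (t + 1)), ?_, ?_, ?_, ?_, fun x hx => ?_⟩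
    · have := (hg₁.trans hg₂).trans (Program.Goes.single (i := .op o t t (t + 1)) hg₂.bdd
        (by rw [hp₂, hp₁]; exact hc.right.right.head) (hg₂.bdd.update _ _ hlt))
      simpa [Expr.comp, add_assoc] using this
    · simp [Instr.exec, Expr.comp, hp₂, hp₁, add_assoc]
    · simp [Instr.exec, hm₂, hm₁]
    · simp [Instr.exec, Expr.eval, hv, he₂]
    · simp [Instr.exec, Function.update_apply, hx.ne, hf₂ x (by omega), hf₁ x hx]
  | msb a iha =>
    intro t c ht hw hk hc hr hb
    obtain ⟨c₁, hg₁, hp₁, hm₁, he₁, hf₁⟩ := iha t c ht hw hk hc.left hr hb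
    have hlt : Nat.log2 (c₁.reg t) < N := lt_of_le_of_lt (Nat.log2_le_self _) (hg₁.bdd.1 t)
    refine ⟨Instr.exec c₁ (.msb t t), ?_, ?_, ?_, ?_, fun x hx => ?_⟩
    · have := hg₁.trans (Program.Goes.single (i := .msb t t) hg₁.bdd
        (by rw [hp₁]; exact hc.right.head) (hg₁.bdd.update _ _ hlt))
      simpa [Expr.comp] using this
    · simp [Instr.exec, Expr.comp, hp₁, add_assoc]
    · simp [Instr.exec, hm₁]
    · simp [Instr.exec, Expr.eval, he₁]
    · simp [Instr.exec, Function.update_apply, hx.ne, hf₁ x hx]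
  | load a iha =>
    intro t c ht hw hk hc hr hb
    obtain ⟨c₁, hg₁, hp₁, hm₁, he₁, hf₁⟩ := iha t c ht hw hk hc.left hr hb
    refine ⟨Instr.exec c₁ (.load t t), ?_, ?_, ?_, ?_, fun x hx => ?_⟩
    · have := hg₁.trans (Program.Goes.single (i := .load t t) hg₁.bdd
        (by rw [hp₁]; exact hc.right.head) (hg₁.bdd.update _ _ (hg₁.bdd.2 _)))
      simpa [Expr.comp] using this
    · simp [Instr.exec, Expr.comp, hp₁, add_assoc]
    · simp [Instr.exec, hm₁]
    · simp [Instr.exec, Expr.eval, he₁, hm₁, hr.2]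
    · simp [Instr.exec, Function.update_apply, hx.ne, hf₁ x hx]

/-- Evaluation of two expressions into the registers `100` and `101`. -/
theorem Expr.comp_goes_two {prog : Program} {N : ℕ} (hN : WordBound N) {s : St} (hs : s.Bdd N)
    {a b : Expr} {c : Config} {v : List Instr} (ha : a.wf 100 1000 = true)
    (hb : b.wf 100 1000 = true) (hka : a.Ok N s) (hkb : b.Ok N s)
    (hc : CodeAt prog c.pc (a.comp 100 ++ (b.comp 101 ++ v))) (hr : Rep c s) (hbd : c.Bdd N) :
    ∃ c', prog.Goes N c ((a.comp 100).length + (b.comp 101).length) c' ∧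
      c'.pc = c.pc + (a.comp 100).length + (b.comp 101).length ∧ Rep c' s ∧
      c'.reg 100 = a.eval s ∧ c'.reg 101 = b.eval s ∧ CodeAt prog c'.pc v := by
  obtain ⟨c₁, hg₁, hp₁, hm₁, he₁, hf₁⟩ :=
    Expr.comp_goes hN hs a 100 c le_rfl ha hka hc.left hr hbd
  have hr₁ : Rep c₁ s := ⟨fun x hx => by rw [hf₁ x hx, hr.1 x hx], by rw [hm₁, hr.2]⟩
  obtain ⟨c₂, hg₂, hp₂, hm₂, he₂, hf₂⟩ :=
    Expr.comp_goes hN hs b 101 c₁ (by omega) hb hkb (by rw [hp₁]; exact hc.right.left) hr₁ hg₁.bdd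
  refine ⟨c₂, hg₁.trans hg₂, by omega, ⟨fun x hx => ?_, by rw [hm₂, hr₁.2]⟩, ?_, he₂, ?_⟩
  · rw [hf₂ x (by omega), hr₁.1 x hx]
  · rw [hf₂ 100 (by omega), he₁]
  · rw [hp₂, hp₁]; exact hc.right.right

/-- The induction is on the execution, not on the statement, because a loop unfolds to itself. Every
elementary step is charged with the code length of the whole statement, which makes the bounds for
the parts add up. -/
theorem Exec.goes {prog : Program} {N : ℕ} (hN : WordBound N) {st : Stmt} {s s' : St} {t : ℕ}
    (h : Exec N st s t s') : ∀ c : Config, s.Bdd N → st.wf 100 1000 = true →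
      CodeAt prog c.pc (st.comp c.pc) → Rep c s → c.Bdd N →
      ∃ c' T, T ≤ t * st.unit ∧ prog.Goes N c T c' ∧ c'.pc = c.pc + (st.comp c.pc).length ∧
        Rep c' s' ∧ s'.Bdd N := by
  induction h with
  | skip s =>
    intro c hs _ _ hr hb
    exact ⟨c, 0, by simp, .refl hb, by simp [Stmt.comp], hr, hs⟩
  | @set s d e h =>
    intro c hs hw hc hr hb
    simp only [Stmt.wf, Bool.and_eq_true, decide_eq_true_eq] at hw
    obtain ⟨c₁, hg₁, hp₁, hm₁, he₁, hf₁⟩ :=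
      Expr.comp_goes hN hs e 100 c le_rfl hw.2 h hc.left hr hb
    have hlt := Expr.eval_lt' hN hs hw.2 h
    refine ⟨Instr.exec c₁ (.op .or d 100 100), _, ?_, hg₁.trans (Program.Goes.single hg₁.bdd
      (by rw [hp₁]; exact hc.right.head) (hg₁.bdd.update _ _ ?_)), ?_, ⟨fun x hx => ?_, ?_⟩,
      hs.set hlt⟩
    · simp [Stmt.unit]
    · simpa [WordOp.eval] using hg₁.bdd.1 100
    · simp [Instr.exec, Stmt.comp, hp₁, add_assoc]
    · simp only [Instr.exec, Function.update_apply, St.set_r, WordOp.eval, Nat.or_self, he₁]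
      split
      · rfl
      · rw [hf₁ x hx, hr.1 x hx]
    · simp [Instr.exec, hm₁, hr.2]
  | @store s a e h h' =>
    intro c hs hw hc hr hb
    simp only [Stmt.wf, Bool.and_eq_true] at hw
    obtain ⟨c₂, hg, hp, hr₂, ha, he, hc₂⟩ :=
      Expr.comp_goes_two hN hs hw.1 hw.2 h h' hc hr hb
    have hlt := Expr.eval_lt' hN hs hw.2 h'
    have hs' := hs.put (a := a.eval s) hlt
    have hmem : Function.update c₂.mem (c₂.reg 100) (c₂.reg 101) = (s.put (a.eval s) (e.eval s)).m := by
      rw [ha, he, hr₂.2]; rfl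
    refine ⟨Instr.exec c₂ (.store 100 101), _, ?_, hg.trans (Program.Goes.single hg.bdd
      hc₂.head ⟨hg.bdd.1, ?_⟩), ?_, ⟨fun x hx => ?_, ?_⟩, hs'⟩
    · simp [Stmt.unit]
    · intro x
      simp only [Instr.exec]
      rw [hmem]; exact hs'.2 x
    · simp [Instr.exec, Stmt.comp, hp, add_assoc]
    · simp [Instr.exec, hr₂.1 x hx]
    · exact hmem
  | @seq c₁ c₂ s s₁ s₂ t₁ t₂ h h' ih₁ ih₂ =>
    intro c hs hw hc hr hb
    simp only [Stmt.wf, Bool.and_eq_true] at hw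
    obtain ⟨d₁, T₁, hT₁, hg₁, hp₁, hr₁, hs₁⟩ := ih₁ c hs hw.1 hc.left hr hb
    obtain ⟨d₂, T₂, hT₂, hg₂, hp₂, hr₂, hs₂⟩ := ih₂ d₁ hs₁ hw.2
      (by rw [hp₁]; exact hc.right) hr₁ hg₁.bdd
    refine ⟨d₂, T₁ + T₂, ?_, hg₁.trans hg₂, ?_, hr₂, hs₂⟩
    · simp only [Stmt.unit]
      nlinarith [Nat.zero_le (t₁ * c₂.unit), Nat.zero_le (t₂ * c₁.unit)]
    · simp only [Stmt.comp, List.length_append]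
      rw [hp₂, hp₁, add_assoc]
  | @ite_true a b c₁ c₂ s s' t ha hb hl h' ih =>
    intro c hs hw hc hr hbd
    simp only [Stmt.wf, Bool.and_eq_true] at hw
    obtain ⟨d, hg, hp, hrd, hea, heb, hcd⟩ :=
      Expr.comp_goes_two hN hs hw.1.1.1 hw.1.1.2 ha hb hc hr hbd
    have hg₁ := Program.Goes.jumpLT_true hg.bdd hcd.head (by rwa [hea, heb])
    have hcd' := hcd.tail.right.tail
    rw [hp] at hcd'
    obtain ⟨d₂, T₂, hT₂, hg₂, hp₂, hr₂, hs₂⟩ := ih ⟨_, d.reg, d.mem⟩ hs hw.1.2 hcd' hrd hg₁.bdd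
    refine ⟨d₂, _, ?_, (hg.trans hg₁).trans hg₂, ?_, hr₂, hs₂⟩
    · simp only [Stmt.unit]
      nlinarith [Nat.zero_le (t * ((a.comp 100).length + (b.comp 101).length + 2 + c₂.unit))]
    · rw [hp₂]
      simp only [Stmt.comp, List.length_append, List.length_cons]
      omega
  | @ite_false a b c₁ c₂ s s' t ha hb hl h' ih =>
    intro c hs hw hc hr hbd
    simp only [Stmt.wf, Bool.and_eq_true] at hw
    obtain ⟨d, hg, hp, hrd, hea, heb, hcd⟩ :=
      Expr.comp_goes_two hN hs hw.1.1.1 hw.1.1.2 ha hb hc hr hbd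
    have hg₁ := Program.Goes.jumpLT_false hg.bdd hcd.head (by rwa [hea, heb])
    have hcd' := hcd.tail
    rw [hp] at hcd' hg₁
    obtain ⟨d₂, T₂, hT₂, hg₂, hp₂, hr₂, hs₂⟩ := ih ⟨_, d.reg, d.mem⟩ hs hw.2 hcd'.left hrd hg₁.bdd
    have hg₃ := Program.Goes.jump hg₂.bdd (by rw [hp₂]; exact hcd'.right.head)
    refine ⟨_, _, ?_, ((hg.trans hg₁).trans hg₂).trans hg₃, ?_, hr₂, hs₂⟩
    · simp only [Stmt.unit]
      nlinarith [Nat.zero_le (t * ((a.comp 100).length + (b.comp 101).length + 2 + c₁.unit))]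
    · simp only [Stmt.comp, List.length_append, List.length_cons]
      omega
  | @loop_true a b c₁ s s₁ s₂ t₁ t₂ ha hb hl h₁ h₂ ih₁ ih₂ =>
    intro c hs hw hc hr hbd
    have hw' := hw
    simp only [Stmt.wf, Bool.and_eq_true] at hw
    obtain ⟨d, hg, hp, hrd, hea, heb, hcd⟩ :=
      Expr.comp_goes_two hN hs hw.1.1 hw.1.2 ha hb hc hr hbd
    have hg₁ := Program.Goes.jumpLT_true hg.bdd hcd.head (by rwa [hea, heb])
    have hcd' := hcd.tail.tail
    rw [hp] at hcd'
    obtain ⟨d₂, T₂, hT₂, hg₂, hp₂, hr₂, hs₂⟩ := ih₁ ⟨_, d.reg, d.mem⟩ hs hw.2 hcd'.left hrd hg₁.bdd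
    have hg₃ := Program.Goes.jump hg₂.bdd (by rw [hp₂]; exact hcd'.right.head)
    -- The jump back leads to the first line of the same loop, where the remaining rounds are a
    -- shorter execution.
    obtain ⟨d₃, T₃, hT₃, hg₄, hp₃, hr₃, hs₃⟩ := ih₂ ⟨c.pc, d₂.reg, d₂.mem⟩ hs₂ hw' hc hr₂ hg₂.bdd
    refine ⟨d₃, _, ?_, (((hg.trans hg₁).trans hg₂).trans hg₃).trans hg₄, hp₃, hr₃, hs₃⟩
    · simp only [Stmt.unit] at hT₃ ⊢
      nlinarith [Nat.zero_le (t₁ * ((a.comp 100).length + (b.comp 101).length + 2))]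
  | @loop_false a b c₁ s ha hb hl =>
    intro c hs hw hc hr hbd
    simp only [Stmt.wf, Bool.and_eq_true] at hw
    obtain ⟨d, hg, hp, hrd, hea, heb, hcd⟩ :=
      Expr.comp_goes_two hN hs hw.1.1 hw.1.2 ha hb hc hr hbd
    have hg₁ := Program.Goes.jumpLT_false hg.bdd hcd.head (by rwa [hea, heb])
    have hg₂ := Program.Goes.jump hg₁.bdd hcd.tail.head
    refine ⟨_, _, ?_, (hg.trans hg₁).trans hg₂, ?_, hrd, hs⟩
    · simp only [Stmt.unit]
      omega
    · simp only [Stmt.comp, List.length_append, List.length_cons, List.length_nil]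
      omega

/-- The state at the beginning. -/
def initSt {k : ℕ} (args : List ℕ) (P : Fin k → ℕ) : St :=
  ⟨(initial args P).reg, (initial args P).mem⟩

/-- From runs of a structured statement to runs of the machine. -/
theorem Run.outputsWithin {k : ℕ} {st : Stmt} {bits : ℕ} {args : List ℕ} {P out : Fin k → ℕ}
    {T : ℕ} (hbits : 1000 < 2 ^ bits) (hw : st.wf 100 1000 = true)
    (hb : (initSt args P).Bdd (2 ^ bits))
    (h : Run (2 ^ bits) st (initSt args P) T fun s => ∀ i : Fin k, s.m i = out i) {τ : ℝ}
    (hτ : ((st.unit * T : ℕ) : ℝ) ≤ τ) :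
    Program.OutputsWithin (st.comp 0) bits (initial args P) out τ := by
  obtain ⟨t, s', ht, he, hbd, hq⟩ := h hb
  obtain ⟨c', T', hT', hg, hp, hr, -⟩ := he.goes (prog := st.comp 0) ⟨⟨bits, rfl⟩, hbits⟩
    (initial args P) hb hw ⟨[], [], by simp [initial], rfl⟩ ⟨fun _ _ => rfl, rfl⟩ hb
  refine ⟨T', le_trans ?_ hτ, ?_, ?_, ?_⟩
  · have : T' ≤ st.unit * T := hT'.trans (by rw [mul_comm]; gcongr)
    exact_mod_cast this
  · rw [hg.1, hp]; simp [initial]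
  · intro i; rw [hg.1, hr.2]; exact hq i
  · intro u hu m
    exact ⟨(hg.2 u hu).1 m, (hg.2 u hu).2 m⟩

end TCAM

namespace TCAM

/-! ### Sequences of transfers -/

section Transfers
variable {ι : Type*} [DecidableEq ι] [Fintype ι]

/-- The vector of a unit transfer from `i` to `j`. -/
def move (i j : ι) : ι → ℤ := Pi.single j 1 - Pi.single i 1

theorem move_apply (i j m : ι) :
    move i j m = (if m = j then 1 else 0) - (if m = i then 1 else 0) := by
  simp [move, Pi.single_apply]

/-- `Zeroes n v`: at most `n` transfers turn the vector `v` into zero. -/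
inductive Zeroes : ℕ → (ι → ℤ) → Prop
  | zero (n) : Zeroes n 0
  | step {n : ℕ} {v : ι → ℤ} (i j : ι) (l : ℕ)
      (h : Zeroes n (v + (2 : ℤ) ^ l • move i j)) :
      Zeroes (n + 1) v

theorem Zeroes.mono {n m : ℕ} {v : ι → ℤ} (h : Zeroes n v) (hm : n ≤ m) : Zeroes m v := by
  induction h generalizing m with
  | zero n => exact .zero m
  | @step n v i j l h ih =>
    obtain ⟨m, rfl⟩ : ∃ m', m = m' + 1 := ⟨m - 1, by omega⟩
    exact .step i j l (ih (by omega))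

theorem Zeroes.one_le {n : ℕ} {v : ι → ℤ} (h : Zeroes n v) (hv : v ≠ 0) : 1 ≤ n := by
  cases h with
  | zero => exact absurd rfl hv
  | step => omega

/-- The terms outside `i` and `j` cancel; written without subtraction of sums. -/
theorem sum_exchange {f g : ι → ℤ} {i j : ι} (hij : i ≠ j)
    (h : ∀ m, m ≠ i → m ≠ j → f m = g m) :
    ∑ m, f m + (g i + g j) = ∑ m, g m + (f i + f j) := by
  have key : ∀ u : ι → ℤ, ∑ m, u m = u i + (u j + ∑ m ∈ (Finset.univ.erase i).erase j, u m) := by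
    intro u
    rw [Finset.add_sum_erase _ _ (Finset.mem_erase.2 ⟨hij.symm, Finset.mem_univ j⟩),
      Finset.add_sum_erase _ _ (Finset.mem_univ i)]
  rw [key f, key g, Finset.sum_congr (g := g) rfl fun m hm => ?_]
  · ring
  · simp only [Finset.mem_erase] at hm
    exact h m hm.2.1 hm.1

theorem sum_single_sub (i j : ι) :
    ∑ m, move i j m = 0 := by
  simp [move_apply]

theorem sum_abs_add {d : ι → ℤ} {i j : ι} (hij : i ≠ j) (c : ℤ) :
    ∑ m, |(d + c • move i j) m| + (|d i| + |d j|) =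
      ∑ m, |d m| + (|d i - c| + |d j + c|) := by
  have := sum_exchange (f := fun m => |(d + c • move i j) m|)
    (g := fun m => |d m|) hij (fun m h1 h2 => by simp [move_apply, h1, h2])
  simpa [move_apply, hij, hij.symm, sub_eq_add_neg] using this

theorem sum_add_single {d : ι → ℤ} {i j : ι} (c : ℤ) (h : ∑ m, d m = 0) :
    ∑ m, (d + c • move i j) m = 0 := by
  simp only [Pi.add_apply, Pi.smul_apply, Finset.sum_add_distrib, h, ← Finset.smul_sum,
    sum_single_sub, smul_zero, add_zero]

theorem exists_pos_of_sum_zero {d : ι → ℤ} (h : ∑ m, d m = 0) {j : ι} (hj : d j < 0) :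
    ∃ i, 0 < d i := by
  by_contra hne
  push Not at hne
  have := Finset.sum_lt_sum (s := Finset.univ) (f := d) (g := fun _ => 0)
    (fun i _ => hne i) ⟨j, Finset.mem_univ j, hj⟩
  simp [h] at this

theorem exists_neg_of_sum_zero {d : ι → ℤ} (h : ∑ m, d m = 0) {j : ι} (hj : 0 < d j) :
    ∃ i, d i < 0 := by
  obtain ⟨i, hi⟩ := exists_pos_of_sum_zero (d := -d) (j := j) (by simp [h]) (by simpa using hj)
  exact ⟨i, by simpa using hi⟩

theorem exists_pos_neg {d : ι → ℤ} (h : ∑ m, d m = 0) (hd : d ≠ 0) :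
    ∃ i j, 0 < d i ∧ d j < 0 := by
  obtain ⟨i, hi⟩ := Function.ne_iff.1 hd
  simp only [Pi.zero_apply] at hi
  rcases lt_or_gt_of_ne hi with hi | hi
  · obtain ⟨j, hj⟩ := exists_pos_of_sum_zero h hi
    exact ⟨j, i, hj, hi⟩
  · obtain ⟨j, hj⟩ := exists_neg_of_sum_zero h hi
    exact ⟨i, j, hi, hj⟩

theorem eq_zero_of_sum_abs_le {d : ι → ℤ} (h : ∑ m, |d m| ≤ 0) : d = 0 := by
  funext i
  have := (Finset.sum_eq_zero_iff_of_nonneg (fun i _ => abs_nonneg (d i))).1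
    (le_antisymm h (Finset.sum_nonneg fun i _ => abs_nonneg (d i))) i (Finset.mem_univ i)
  simpa using this

/-- Changing a vector by `2 ^ l • d`, where `d` has sum zero, costs half the sum of `|d|`. -/
theorem Zeroes.of_add {l : ℕ} {t : ℕ} : ∀ {n : ℕ} {v d : ι → ℤ}, ∑ m, d m = 0 →
    ∑ m, |d m| ≤ 2 * t → Zeroes n (v + (2 : ℤ) ^ l • d) → Zeroes (n + t) v := by
  induction t with
  | zero =>
    intro n v d _ h hz
    have hd : d = 0 := eq_zero_of_sum_abs_le (by simpa using h)
    simpa [hd] using hz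
  | succ t ih =>
    intro n v d hd h hz
    by_cases h0 : d = 0
    · subst h0
      exact Zeroes.mono (by simpa using hz) (Nat.le_add_right _ _)
    · obtain ⟨i, j, hi, hj⟩ := exists_pos_neg hd h0
      have hij : i ≠ j := by rintro rfl; omega
      have hs := sum_abs_add (d := d) hij 1
      have h1 : |d i - 1| = |d i| - 1 := by rw [abs_of_nonneg (by omega), abs_of_pos hi]
      have h2 : |d j + 1| = |d j| - 1 := by rw [abs_of_nonpos (by omega), abs_of_neg hj]; ring
      refine Zeroes.step j i l (ih (sum_add_single (i := i) (j := j) 1 hd) ?_ ?_)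
      · push_cast at h; omega
      · convert hz using 1
        funext m
        simp only [move_apply, Pi.add_apply, Pi.smul_apply, smul_eq_mul]
        ring

theorem Zeroes.of_add_one {t : ℕ} {n : ℕ} {v w d : ι → ℤ} (h0 : ∑ m, d m = 0)
    (h1 : ∑ m, |d m| ≤ 2 * t) (h : Zeroes n w) (hw : v + d = w) : Zeroes (n + t) v :=
  Zeroes.of_add (l := 0) h0 h1 (by simpa [hw] using h)

theorem Zeroes.two_smul {n : ℕ} {v : ι → ℤ} (h : Zeroes n v) : Zeroes n ((2 : ℤ) • v) := by
  induction h with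
  | zero n => rw [smul_zero]; exact .zero n
  | @step n v i j l h ih =>
    refine .step i j (l + 1) ?_
    convert ih using 1
    rw [smul_add, smul_smul, pow_succ, mul_comm]

/-- Splitting off the transfers of units. -/
theorem Zeroes.split {n : ℕ} {v : ι → ℤ} (h : Zeroes n v) :
    ∃ (t : ℕ) (d w : ι → ℤ), t ≤ n ∧ ∑ m, d m = 0 ∧ ∑ m, |d m| ≤ 2 * t ∧ v + d = (2 : ℤ) • w ∧
      Zeroes (n - t) w := by
  induction h with
  | zero n => exact ⟨0, 0, 0, Nat.zero_le _, by simp, by simp, by simp, .zero _⟩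
  | @step n v i j l h ih =>
    obtain ⟨t, d, w, ht, hd, hs, hw, hz⟩ := ih
    -- A unit transfer is absorbed in `d`; a larger one stays a transfer, of half the size, for `w`.
    rcases l with _ | l
    · refine ⟨t + 1, d + (1 : ℤ) • move i j, w, by omega,
        sum_add_single 1 hd, ?_, ?_, by simpa using hz⟩
      · by_cases hij : i = j
        · subst hij; simp [move]; omega
        · have := sum_abs_add (d := d) hij 1
          have h1 := abs_sub (d i) 1
          have h2 := abs_add_le (d j) 1
          simp only [abs_one] at h1 h2
          push_cast; omega
      · rw [← hw]; simp [add_comm, add_left_comm]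
    · refine ⟨t, d, w - (2 : ℤ) ^ l • move i j, by omega, hd,
        hs, ?_, ?_⟩
      · rw [smul_sub, ← hw, smul_smul, ← pow_succ']; abel
      · rw [show n + 1 - t = (n - t) + 1 by omega]
        exact .step i j l (by simpa using hz)

/-- The unit transfers can be taken to change each entry by at most one. -/
theorem Zeroes.split_balanced {n : ℕ} {v : ι → ℤ} (h : Zeroes n v) :
    ∃ (t : ℕ) (d w : ι → ℤ), t ≤ n ∧ ∑ m, d m = 0 ∧ ∑ m, |d m| ≤ 2 * t ∧ v + d = (2 : ℤ) • w ∧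
      (∀ i, |d i| ≤ 1) ∧ Zeroes (n - t) w := by
  obtain ⟨t, d, w, ht, hd, hs, hw, hz⟩ := h.split
  induction t generalizing d w with
  | zero =>
    have : d = 0 := eq_zero_of_sum_abs_le (by simpa using hs)
    exact ⟨0, d, w, ht, hd, hs, hw, by simp [this], hz⟩
  | succ t ih =>
    by_cases hb : ∀ i, |d i| ≤ 1
    · exact ⟨t + 1, d, w, ht, hd, hs, hw, hb, hz⟩
    push Not at hb
    obtain ⟨i, hi⟩ := hb
    -- An entry of size at least two has a partner of the opposite sign, since the sum is zero.
    have key : ∃ i j, 0 < d i ∧ d j < 0 ∧ (2 ≤ d i ∨ d j ≤ -2) := by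
      rcases le_or_gt 0 (d i) with h0 | h0
      · rw [abs_of_nonneg h0] at hi
        obtain ⟨j, hj⟩ := exists_neg_of_sum_zero hd (j := i) (by omega)
        exact ⟨i, j, by omega, hj, .inl (by omega)⟩
      · rw [abs_of_neg h0] at hi
        obtain ⟨j, hj⟩ := exists_pos_of_sum_zero hd (j := i) (by omega)
        exact ⟨j, i, hj, by omega, .inr (by omega)⟩
    obtain ⟨i, j, h1, h2, h3⟩ := key
    have hij : i ≠ j := by rintro rfl; omega
    -- Two units are moved back, which saves at least one unit transfer; it is compensated by one
    -- transfer of a unit on `w`. The total does not increase.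
    refine ih (d + (2 : ℤ) • move i j)
      (w + move i j) (by omega) (sum_add_single 2 hd) ?_ ?_ ?_
    · have := sum_abs_add (d := d) hij 2
      push_cast at hs
      rcases h3 with h3 | h3
      · have e1 : |d i - 2| = |d i| - 2 := by rw [abs_of_nonneg (by omega), abs_of_pos h1]
        have e2 : |d j + 2| ≤ |d j| := by
          rw [abs_of_neg h2, abs_le]; omega
        omega
      · have e1 : |d j + 2| = |d j| - 2 := by
          rw [abs_of_nonpos (by omega), abs_of_neg h2]; ring
        have e2 : |d i - 2| ≤ |d i| := by
          rw [abs_of_pos h1, abs_le]; omega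
        omega
    · rw [smul_add, ← hw, add_assoc]
    · have := hz.of_add_one (v := w + move i j)
        (d := (1 : ℤ) • move j i) (t := 1)
        (by simpa using sum_single_sub j i)
        (by
          have := sum_abs_add (d := 0) hij.symm 1
          simp at this ⊢
          omega) (by rw [one_smul]; unfold move; abel)
      rwa [show n - (t + 1) + 1 = n - t by omega] at this

theorem Zeroes.perm {n : ℕ} {v : ι → ℤ} (σ : Equiv.Perm ι) (h : Zeroes n v) :
    Zeroes n (v ∘ σ) := by
  induction h with
  | zero n => exact .zero n
  | @step n v i j l h ih =>
    refine .step (σ.symm i) (σ.symm j) l ?_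
    convert ih using 1
    funext m
    simp [move_apply, Equiv.eq_symm_apply]

end Transfers

end TCAM

namespace TCAM

/-! ### The reversed digit order and exactness of the greedy round -/

/-- The order of integers by their binary digits, the lowest digit being the most significant. -/
inductive RLe : ℤ → ℤ → Prop
  | refl (a) : RLe a a
  | lt {a b : ℤ} (ha : a % 2 = 0) (hb : b % 2 = 1) : RLe a b
  | step {a b : ℤ} (h : a % 2 = b % 2) (h' : RLe (a / 2) (b / 2)) : RLe a b

section Transfers
variable {ι : Type*} [DecidableEq ι] [Fintype ι]

theorem Zeroes.add_move {n : ℕ} {w : ι → ℤ} (i j : ι) (h : Zeroes n w) :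
    Zeroes (n + 1) (w + move i j) :=
  .step j i 0 (by
    have : w + move i j + (2 : ℤ) ^ 0 • move j i = w := by
      rw [pow_zero, one_smul]; unfold move; abel
    rwa [this])

/-- A unit is best added to the entry that is larger in the reversed order. -/
theorem Zeroes.swap {y : ι → ℤ} {i j : ι} {n : ℕ} (h : RLe (y i) (y j))
    (hz : Zeroes n (y + Pi.single i 1)) : Zeroes n (y + Pi.single j 1) := by
  by_cases hij : i = j
  · subst hij; exact hz
  generalize ha : y i = a at h
  generalize hb : y j = b at h
  -- First way to replace the unit at `i` by one at `j`: the correction goes into `d`, and `w` stays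
  -- the same. This works if the unit transfers do not become more.
  have keyA : ∀ {n t : ℕ} {y d w : ι → ℤ}, t ≤ n → ∑ m, d m = 0 → ∑ m, |d m| ≤ 2 * t →
      y + Pi.single i 1 + d = (2 : ℤ) • w → Zeroes (n - t) w →
      |d i + 1| + |d j - 1| ≤ |d i| + |d j| → Zeroes n (y + Pi.single j 1) := by
    intro n t y d w ht hd hs hw hz h
    have h1 := sum_abs_add (d := d) hij (-1)
    have := hz.two_smul.of_add_one (v := y + Pi.single j 1) (d := d + (-1 : ℤ) • move i j) (t := t)
      (sum_add_single _ hd) (by rw [sub_neg_eq_add, ← sub_eq_add_neg] at h1; omega)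
      (by rw [← hw]; unfold move; rw [neg_one_smul]; abel)
    rwa [Nat.sub_add_cancel ht] at this
  -- Second way: `d` is corrected in the opposite direction, so that `w` also gets its unit moved
  -- from `i` to `j`. The `r` unit transfers saved may be spent on the changed `w`.
  have keyB : ∀ {n t r : ℕ} {y d w : ι → ℤ}, t ≤ n → ∑ m, d m = 0 → ∑ m, |d m| ≤ 2 * t →
      y + Pi.single i 1 + d = (2 : ℤ) • w → Zeroes (n - t + r) (w + move i j) →
      |d i - 1| + |d j + 1| + 2 * r ≤ |d i| + |d j| → Zeroes n (y + Pi.single j 1) := by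
    intro n t r y d w ht hd hs hw hz h
    have h1 := sum_abs_add (d := d) hij 1
    have h2 : (0 : ℤ) ≤ ∑ m, |(d + (1 : ℤ) • move i j) m| :=
      Finset.sum_nonneg fun _ _ => abs_nonneg _
    have hr : r ≤ t := by omega
    have := hz.two_smul.of_add_one (v := y + Pi.single j 1) (d := d + (1 : ℤ) • move i j)
      (t := t - r) (sum_add_single _ hd) (by omega)
      (by rw [smul_add, ← hw]; unfold move; rw [one_smul, _root_.two_smul]; abel)
    rwa [show n - t + r + (t - r) = n by omega] at this
  have val : ∀ {y d w : ι → ℤ}, y + Pi.single i 1 + d = (2 : ℤ) • w →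
      y i + 1 + d i = 2 * w i ∧ y j + d j = 2 * w j := by
    intro y d w h
    have h1 := congrFun h i
    have h2 := congrFun h j
    simp [Pi.single_apply, Ne.symm hij] at h1 h2
    exact ⟨h1, h2⟩
  induction h generalizing y n with
  | refl a =>
    -- The two entries of `y` are equal, so exchanging the coordinates is all that is needed.
    have := hz.perm (Equiv.swap i j)
    convert this using 1
    funext m
    by_cases h1 : m = i
    · subst h1; simp [Pi.single_apply, hij, Ne.symm hij, ha, hb]
    by_cases h2 : m = j
    · subst h2; simp [Pi.single_apply, hij, Ne.symm hij, ha, hb]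
    simp [Pi.single_apply, Equiv.swap_apply_of_ne_of_ne h1 h2, h1, h2]
  | lt h0 h1 =>
    obtain ⟨t, d, w, ht, hd, hs, hw, hz⟩ := hz.split
    obtain ⟨hi, hj⟩ := val hw
    by_cases h : d i ≤ -1 ∨ 1 ≤ d j
    · refine keyA ht hd hs hw hz ?_
      rcases h with h | h
      · rw [abs_of_nonpos (by omega : d i + 1 ≤ 0), abs_of_neg (by omega : d i < 0)]
        have := abs_sub (d j) 1
        simp at this; omega
      · rw [abs_of_nonneg (by omega : 0 ≤ d j - 1), abs_of_pos (by omega : 0 < d j)]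
        have := abs_add_le (d i) 1
        simp at this; omega
    -- Here `y i` is even and `y j` odd, so `d i` and `d j` are odd, positive and negative. Both
    -- shrink, which saves one transfer, and that one moves the unit in `w`.
    · refine keyB (r := 1) ht hd hs hw (hz.add_move i j) ?_
      rw [abs_of_nonneg (by omega : 0 ≤ d i - 1), abs_of_pos (by omega : 0 < d i),
        abs_of_nonpos (by omega : d j + 1 ≤ 0), abs_of_neg (by omega : d j < 0)]
      push_cast; omega
  | step h h' ih =>
    obtain ⟨t, d, w, ht, hd, hs, hw, hb, hz⟩ := hz.split_balanced
    obtain ⟨hi, hj⟩ := val hw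
    have bi := abs_le.1 (hb i)
    have bj := abs_le.1 (hb j)
    by_cases hc : d i = -1 ∨ d j = 1
    · refine keyA ht hd hs hw hz ?_
      rcases hc with hc | hc
      · have : d j = 0 := by omega
        simp [hc, this]
      · have : d i = 0 := by omega
        simp [hc, this]
    -- Nothing is saved here, but halving leads to the same problem: `w - Pi.single i 1` has the
    -- entries `y i / 2` and `y j / 2`, which are comparable by `h'`.
    · have hz' : Zeroes (n - t) (w - Pi.single i 1 + Pi.single i 1) := by simpa using hz
      have := ih hz' (by simp; omega) (by simp [Pi.single_apply, Ne.symm hij]; omega)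
      refine keyB (r := 0) ht hd hs hw ?_ ?_
      · rw [show w + move i j = w - Pi.single i 1 + Pi.single j 1 by unfold move; abel]
        exact this
      · by_cases h1 : d i = 1
        · have : d j = 0 := by omega
          simp [h1, this]
        · have h2 : d i = 0 := by omega
          have h3 : d j = -1 := by omega
          simp [h2, h3]

/-- The indicator vector of a finite set. -/
def ind (A : Finset ι) : ι → ℤ := fun m => if m ∈ A then 1 else 0

theorem sum_ind (A : Finset ι) : ∑ m, ind A m = A.card := by
  simp [ind]

theorem ind_insert {A : Finset ι} {i : ι} (h : i ∉ A) : ind (insert i A) = ind A + Pi.single i 1 := by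
  funext m
  by_cases hm : m = i
  · subst hm; simp [ind, h]
  · simp [ind, hm]

theorem ind_erase {A : Finset ι} {i : ι} (h : i ∈ A) : ind (A.erase i) + Pi.single i 1 = ind A := by
  rw [← ind_insert (Finset.notMem_erase i A), Finset.insert_erase h]

/-- Among the subsets of `O` of a given size, it is best to increase a largest one. -/
theorem Zeroes.to_top {n : ℕ} {y : ι → ℤ} {O A B : Finset ι} (hA : A ⊆ O) (hB : B ⊆ O)
    (hcard : A.card = B.card) (htop : ∀ i ∈ O, i ∉ B → ∀ j ∈ B, RLe (y i) (y j))
    (hz : Zeroes n (y + ind A)) : Zeroes n (y + ind B) := by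
  induction hc : (A \ B).card generalizing A with
  | zero =>
    have : A = B := Finset.eq_of_subset_of_card_le
      (by rwa [Finset.card_eq_zero, Finset.sdiff_eq_empty_iff_subset] at hc) hcard.ge
    rwa [← this]
  | succ c ih =>
    obtain ⟨i, hi⟩ : (A \ B).Nonempty := Finset.card_pos.1 (by omega)
    obtain ⟨j, hj⟩ : (B \ A).Nonempty := Finset.card_pos.1 (by
      rw [Finset.card_sdiff_comm hcard.symm]; omega)
    rw [Finset.mem_sdiff] at hi hj
    have hij : j ∉ A.erase i := fun h => hj.2 (Finset.mem_of_mem_erase h)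
    have hne : j ≠ i := by rintro rfl; exact hi.2 hj.1
    refine ih (A := insert j (A.erase i)) ?_ ?_ ?_ ?_
    · intro m hm
      rcases Finset.mem_insert.1 hm with rfl | hm
      · exact hB hj.1
      · exact hA (Finset.mem_of_mem_erase hm)
    · rw [Finset.card_insert_of_notMem hij, Finset.card_erase_of_mem hi.1, ← hcard]
      have := Finset.card_pos.2 ⟨i, hi.1⟩
      omega
    · rw [ind_insert hij, ← add_assoc]
      refine Zeroes.swap (i := i) ?_ ?_
      · have h1 : ind (A.erase i) i = 0 := by simp [ind]
        have h2 : ind (A.erase i) j = 0 := by simp [ind, hj.2]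
        simp only [Pi.add_apply, h1, h2, add_zero]
        exact htop i (hA hi.1) hi.2 j hj.1
      · rwa [add_assoc, ind_erase hi.1]
    · have : insert j (A.erase i) \ B = (A \ B).erase i := by
        ext m
        simp only [Finset.mem_sdiff, Finset.mem_insert, Finset.mem_erase]
        constructor
        · rintro ⟨rfl | h, h'⟩
          · exact absurd hj.1 h'
          · exact ⟨h.1, h.2, h'⟩
        · rintro ⟨h1, h2, h3⟩
          exact ⟨.inr ⟨h1, h2⟩, h3⟩
      rw [this, Finset.card_erase_of_mem (Finset.mem_sdiff.2 hi), hc]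
      rfl

/-- The entries of `U` go up and the equally many other odd ones go down, by `U.card` unit
transfers; what results is even and can be halved. No order is needed for this direction. -/
theorem Zeroes.of_half {n : ℕ} {v : ι → ℤ} {O U : Finset ι} (hO : ∀ m, m ∈ O ↔ v m % 2 = 1)
    (hU : U ⊆ O) (hcard : 2 * U.card = O.card)
    (hz : Zeroes n ((fun m => v m / 2) + ind U)) : Zeroes (n + U.card) v := by
  have hd : (O \ U).card = U.card := by rw [Finset.card_sdiff_of_subset hU]; omega
  have hval : ∀ m, ind U m - ind (O \ U) m =
      if m ∈ U then 1 else if m ∈ O then -1 else 0 := by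
    intro m
    by_cases h1 : m ∈ U
    · simp [ind, h1]
    · by_cases h2 : m ∈ O <;> simp [ind, h1, h2]
  refine hz.two_smul.of_add_one (d := ind U - ind (O \ U)) ?_ ?_ ?_
  · simp only [Pi.sub_apply, Finset.sum_sub_distrib, sum_ind, hd, sub_self]
  · have : ∀ m ∈ Finset.univ, |(ind U - ind (O \ U)) m| ≤ ind U m + ind (O \ U) m := by
      intro m _
      rw [Pi.sub_apply, hval]
      by_cases h1 : m ∈ U
      · simp [ind, h1]
      · by_cases h2 : m ∈ O <;> simp [ind, h1, h2]
    refine (Finset.sum_le_sum this).trans ?_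
    rw [Finset.sum_add_distrib, sum_ind, sum_ind, hd]
    omega
  · funext m
    simp only [Pi.add_apply, Pi.sub_apply, Pi.smul_apply, smul_eq_mul, ind, Finset.mem_sdiff]
    have := hO m
    by_cases h1 : m ∈ U
    · have := this.1 (hU h1)
      simp [h1]; omega
    · by_cases h2 : m ∈ O
      · have := this.1 h2
        simp [h1, h2]; omega
      · have := mt this.2 h2
        simp [h1, h2]; omega

/-- In a balanced splitting, `d` is `1` or `-1` at the odd entries and `0` at the even ones; `A` is
where it is `1`. Sum zero makes `A` half of the odd entries, and at least `A.card` transfers are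
spent on units. -/
theorem Zeroes.exists_up {n : ℕ} {v : ι → ℤ} (hz : Zeroes n v) :
    ∃ A : Finset ι, (∀ m ∈ A, v m % 2 = 1) ∧
      2 * A.card = (Finset.univ.filter fun m => v m % 2 = 1).card ∧ A.card ≤ n ∧
      Zeroes (n - A.card) ((fun m => v m / 2) + ind A) := by
  obtain ⟨t, d, w, ht, hd, hs, hw, hb, hz⟩ := hz.split_balanced
  have hval : ∀ m, v m + d m = 2 * w m := fun m => by simpa using congrFun hw m
  have hb' : ∀ m, -1 ≤ d m ∧ d m ≤ 1 := fun m => abs_le.1 (hb m)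
  set A := Finset.univ.filter fun m => d m = 1 with hA
  set O := Finset.univ.filter fun m => v m % 2 = 1 with hO
  have hAO : A ⊆ O := by
    intro m hm
    simp only [hA, hO, Finset.mem_filter, Finset.mem_univ, true_and] at hm ⊢
    have := hval m; omega
  have hdv : ∀ m, d m = 2 * ind A m - ind O m := by
    intro m
    simp only [ind, hA, hO, Finset.mem_filter, Finset.mem_univ, true_and]
    have := hval m
    have := hb' m
    split_ifs <;> omega
  have hda : ∀ m, |d m| = ind O m := by
    intro m
    simp only [ind, hO, Finset.mem_filter, Finset.mem_univ, true_and]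
    have := hval m
    have := hb' m
    split_ifs with h
    · rcases (show d m = 1 ∨ d m = -1 by omega) with h | h <;> simp [h]
    · have : d m = 0 := by omega
      simp [this]
  have hc : (2 * A.card : ℤ) = O.card := by
    simp only [hdv, Finset.sum_sub_distrib, ← Finset.mul_sum, sum_ind] at hd
    omega
  simp only [hda, sum_ind] at hs
  have hAt : A.card ≤ t := by omega
  refine ⟨A, fun m hm => by simpa [hO] using hAO hm, by exact_mod_cast hc, hAt.trans ht, ?_⟩
  have : (fun m => v m / 2) + ind A = w := by
    funext m
    simp only [Pi.add_apply, ind, hA, Finset.mem_filter, Finset.mem_univ, true_and]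
    have := hval m
    have := hb' m
    split_ifs <;> omega
  rw [this]
  exact hz.mono (by omega)

/-- One round of the greedy algorithm is exact. -/
theorem zeroes_iff_half {n : ℕ} {v : ι → ℤ} {O U : Finset ι} (hO : ∀ m, m ∈ O ↔ v m % 2 = 1)
    (hU : U ⊆ O) (hcard : 2 * U.card = O.card)
    (htop : ∀ i ∈ O, i ∉ U → ∀ j ∈ U, RLe (v i / 2) (v j / 2)) :
    Zeroes n v ↔ U.card ≤ n ∧ Zeroes (n - U.card) ((fun m => v m / 2) + ind U) := by
  constructor
  · intro hz
    obtain ⟨A, h1, h2, h3, h4⟩ := hz.exists_up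
    have hO' : O = Finset.univ.filter fun m => v m % 2 = 1 := by ext m; simp [hO]
    have hc : A.card = U.card := by rw [← hO'] at h2; omega
    rw [hc] at h3 h4
    exact ⟨h3, h4.to_top (fun m hm => (hO m).2 (h1 m hm)) hU hc htop⟩
  · rintro ⟨h, hz⟩
    have := hz.of_half hO hU hcard
    rwa [Nat.sub_add_cancel h] at this

/-- A greedy round without odd entries: nothing has to be paid. -/
theorem zeroes_two_smul {n : ℕ} {v : ι → ℤ} : Zeroes n ((2 : ℤ) • v) ↔ Zeroes n v := by
  rw [zeroes_iff_half (O := ∅) (U := ∅) (by simp) (by simp) (by simp) (by simp)]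
  have : ((fun m => ((2 : ℤ) • v) m / 2) + ind ∅ : ι → ℤ) = v := by
    funext m; simp [ind]
  rw [this]
  simp

theorem zeroes_pow_smul {n : ℕ} {v : ι → ℤ} (l : ℕ) : Zeroes n ((2 : ℤ) ^ l • v) ↔ Zeroes n v := by
  induction l with
  | zero => simp
  | succ l ih => rw [pow_succ', mul_smul, zeroes_two_smul, ih]

/-- One round of the greedy algorithm on multiples of `2 ^ l`. -/
theorem zeroes_iff_round {n l : ℕ} {v : ι → ℤ} {O U : Finset ι} (hl : ∀ m, (2 : ℤ) ^ l ∣ v m)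
    (hO : ∀ m, m ∈ O ↔ v m / 2 ^ l % 2 = 1) (hU : U ⊆ O) (hcard : 2 * U.card = O.card)
    (htop : ∀ i ∈ O, i ∉ U → ∀ j ∈ U, RLe (v i / 2 ^ l / 2) (v j / 2 ^ l / 2)) :
    Zeroes n v ↔ U.card ≤ n ∧
      Zeroes (n - U.card) (fun m => v m + 2 ^ l * (ind U m - ind (O \ U) m)) := by
  have h1 : v = (2 : ℤ) ^ l • fun m => v m / 2 ^ l := by
    funext m
    simp [Int.mul_ediv_cancel' (hl m)]
  have h2 : (fun m => v m + 2 ^ l * (ind U m - ind (O \ U) m)) =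
      (2 : ℤ) ^ l • ((2 : ℤ) • ((fun m => v m / 2 ^ l / 2) + ind U)) := by
    funext m
    conv_lhs => rw [h1]
    simp only [Pi.smul_apply, Pi.add_apply, smul_eq_mul, ← mul_add]
    congr 1
    have := hO m
    by_cases h1 : m ∈ U
    · have := this.1 (hU h1)
      simp [ind, h1]; omega
    · by_cases h2 : m ∈ O
      · have := this.1 h2
        simp [ind, h1, h2]; omega
      · have := mt this.2 h2
        simp [ind, h1, h2]; omega
  rw [h2, zeroes_pow_smul, zeroes_two_smul, ← zeroes_iff_half hO hU hcard htop]
  conv_lhs => rw [h1]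
  rw [zeroes_pow_smul]

theorem Zeroes.sum_eq_zero {n : ℕ} {v : ι → ℤ} (h : Zeroes n v) : ∑ m, v m = 0 := by
  induction h with
  | zero => simp
  | @step n v i j l h ih =>
    simpa [Finset.sum_add_distrib, ← Finset.mul_sum, sum_single_sub] using ih

/-! ### Upper bounds on the entries -/

/-- Dropping `i` from `A` matters only if `w i = u i + 1`. Then some `j` is below its bound, because
the bounds still have a positive sum while `w` has sum zero; moving a unit from `i` to `j` repairs
`i`. So each dropped index costs at most one transfer. -/
theorem Zeroes.shrink {n : ℕ} {w u : ι → ℤ} {A : Finset ι} {D : ℕ} (hw : ∀ m, w m ≤ u m + ind A m)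
    (hz : Zeroes n w) (hD : 0 ≤ ∑ m, u m + D) (hDA : D ≤ A.card) :
    ∃ B ⊆ A, B.card = D ∧ ∃ R : ι → ℤ, (∀ m, R m ≤ u m + ind B m) ∧
      Zeroes (n + (A.card - D)) R := by
  induction hc : A.card - D generalizing n w A with
  | zero => exact ⟨A, subset_rfl, by omega, w, hw, hz⟩
  | succ c ih =>
    obtain ⟨i, hi⟩ : A.Nonempty := Finset.card_pos.1 (by omega)
    have hcard := Finset.card_erase_of_mem hi
    have hle : ∀ m, m ≠ i → ind (A.erase i) m = ind A m := fun m hm => by simp [ind, hm]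
    have hi0 : ind (A.erase i) i = 0 := by simp [ind]
    have hi1 : ind A i = 1 := by simp [ind, hi]
    have main : ∃ w', (∀ m, w' m ≤ u m + ind (A.erase i) m) ∧ Zeroes (n + 1) w' := by
      by_cases h : w i ≤ u i
      · refine ⟨w, fun m => ?_, hz.mono (by omega)⟩
        by_cases hm : m = i
        · subst hm; rw [hi0]; omega
        · rw [hle m hm]; exact hw m
      · obtain ⟨j, -, hj⟩ := Finset.exists_lt_of_sum_lt (s := Finset.univ) (f := w)
          (g := fun m => u m + ind A m) (by
            rw [hz.sum_eq_zero, Finset.sum_add_distrib, sum_ind]; omega)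
        have hwi := hw i
        have hji : j ≠ i := by rintro rfl; omega
        refine ⟨w + move i j, fun m => ?_, hz.add_move i j⟩
        rw [Pi.add_apply, move_apply]
        by_cases hm : m = i
        · subst hm; simp only [hi0, hji.symm, if_true, if_false]; omega
        · rw [hle m hm]
          by_cases hmj : m = j
          · subst hmj; simp only [hm, if_true, if_false]; omega
          · simp only [hm, hmj, if_false]
            have := hw m; omega
    obtain ⟨w', hw', hz'⟩ := main
    obtain ⟨B, hB, hBD, R, hR, hzR⟩ := ih hw' hz' (by omega) (by omega)
    exact ⟨B, hB.trans (Finset.erase_subset _ _), hBD, R, hR, by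
      rw [show n + (c + 1) = n + 1 + c by omega]; exact hzR⟩

/-- Halving a vector that is bounded by `u`. -/
theorem Zeroes.halve {n : ℕ} {Q u : ι → ℤ} (hQ : ∀ m, Q m ≤ u m) (hz : Zeroes n Q) {D : ℕ}
    (hD : 0 ≤ ∑ m, u m / 2 + D) (hD' : D = 0 ∨ ∑ m, u m / 2 + D = 0) :
    ∃ B : Finset ι, (∀ m ∈ B, u m % 2 = 1) ∧ B.card = D ∧ D ≤ n ∧
      ∃ R : ι → ℤ, (∀ m, R m ≤ u m / 2 + ind B m) ∧ Zeroes (n - D) R := by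
  obtain ⟨A, h1, h2, h3, h4⟩ := hz.exists_up
  set A' := A.filter fun m => u m % 2 = 1 with hA'
  -- At an index of `A` the entry of `Q` is odd. If the bound is even, it is not attained, so even
  -- the entry rounded up is at most `u m / 2`.
  have hle : ∀ m, Q m / 2 + ind A m ≤ u m / 2 + ind A' m := by
    intro m
    have := h1 m
    have := hQ m
    simp only [ind, hA', Finset.mem_filter]
    by_cases hm : m ∈ A
    · have := h1 m hm
      simp only [hm, true_and, if_true]
      split_ifs <;> omega
    · simp only [hm, false_and, if_false]; omega
  have hc : A'.card ≤ A.card := Finset.card_filter_le _ _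
  -- The rounded vector has sum zero, so a deficit of the halved bounds must be made up by indices
  -- of `A'`.
  have hDA : D ≤ A'.card := by
    rcases hD' with h | h
    · omega
    · have := Finset.sum_le_sum fun m (_ : m ∈ Finset.univ) => hle m
      have h5 : ∑ m, (Q m / 2 + ind A m) = 0 := h4.sum_eq_zero
      rw [h5, Finset.sum_add_distrib, sum_ind] at this
      omega
  obtain ⟨B, hB, hBD, R, hR, hzR⟩ := h4.shrink (u := fun m => u m / 2) hle hD hDA
  exact ⟨B, fun m hm => (Finset.mem_filter.1 (hB hm)).2, hBD, by omega, R, hR, hzR.mono (by omega)⟩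

/-- As long as the halved bounds have a nonnegative sum, all the excess can be removed: each index
removed costs one transfer, and as many unit transfers were saved by halving. -/
theorem Zeroes.halve_pow {n : ℕ} {Q u : ι → ℤ} (hQ : ∀ m, Q m ≤ u m) (hz : Zeroes n Q) (l : ℕ)
    (h : 0 ≤ ∑ m, u m / 2 ^ l) : ∃ R : ι → ℤ, (∀ m, R m ≤ u m / 2 ^ l) ∧ Zeroes n R := by
  induction l with
  | zero => exact ⟨Q, by simpa using hQ, hz⟩
  | succ l ih =>
    have e : ∀ m, u m / 2 ^ (l + 1) = u m / 2 ^ l / 2 := fun m => by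
      rw [pow_succ, Int.ediv_ediv_of_nonneg (by positivity)]
    simp only [e] at h ⊢
    obtain ⟨R, hR, hzR⟩ := ih (by
      have : ∑ m, 2 * (u m / 2 ^ l / 2) ≤ ∑ m, u m / 2 ^ l :=
        Finset.sum_le_sum fun m _ => by omega
      rw [← Finset.mul_sum] at this
      omega)
    obtain ⟨B, -, hB, -, R', hR', hz'⟩ := hzR.halve hR (D := 0) (by simpa using h) (.inl rfl)
    rw [Finset.card_eq_zero] at hB
    subst hB
    exact ⟨R', fun m => by simpa [ind] using hR' m, hz'⟩

theorem exists_top_subset {S : Finset ι} (f : ι → ℕ) (D : ℕ) (hD : D ≤ S.card) :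
    ∃ B ⊆ S, B.card = D ∧ ∀ i ∈ S, i ∉ B → ∀ j ∈ B, f i ≤ f j := by
  induction D with
  | zero => exact ⟨∅, by simp, rfl, by simp⟩
  | succ D ih =>
    obtain ⟨B, hB, hc, ht⟩ := ih (by omega)
    obtain ⟨x, hx, hmax⟩ := Finset.exists_max_image (S \ B) f (Finset.card_pos.1 (by
      rw [Finset.card_sdiff_of_subset hB]; omega))
    rw [Finset.mem_sdiff] at hx
    refine ⟨insert x B, Finset.insert_subset hx.1 hB, by
      rw [Finset.card_insert_of_notMem hx.2, hc], fun i hi hib j hj => ?_⟩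
    rw [Finset.mem_insert, not_or] at hib
    rcases Finset.mem_insert.1 hj with rfl | hj
    · exact hmax i (Finset.mem_sdiff.2 ⟨hi, hib.2⟩)
    · exact ht i hi hib.2 j hj

/-- The optimum under upper bounds: round down to multiples of `2 ^ l`, with the largest possible
`l`, and decrease the smallest odd multiples. -/
theorem Zeroes.round_down {n l : ℕ} {Q u : ι → ℤ} (hQ : ∀ m, Q m ≤ u m) (hz : Zeroes n Q)
    (hneg : ∑ m, u m / 2 ^ (l + 1) < 0) {O E : Finset ι}
    (hO : ∀ m, m ∈ O ↔ u m / 2 ^ l % 2 = 1) (hE : E ⊆ O) (hEc : (E.card : ℤ) = ∑ m, u m / 2 ^ l)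
    (f : ι → ℕ) (hf : ∀ i ∈ O, ∀ j ∈ O, f i ≤ f j → RLe (u i / 2 ^ l / 2) (u j / 2 ^ l / 2))
    (hmin : ∀ i ∈ E, ∀ j ∈ O, j ∉ E → f i ≤ f j) :
    Zeroes n (fun m => 2 ^ l * (u m / 2 ^ l - ind E m)) := by
  have e : ∀ m, u m / 2 ^ (l + 1) = u m / 2 ^ l / 2 := fun m => by
    rw [pow_succ, Int.ediv_ediv_of_nonneg (by positivity)]
  simp only [e] at hneg
  -- At level `l` the bounds still have room, so a vector below them is obtained without extra
  -- transfers; only the next halving needs entries above the bounds.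
  obtain ⟨R, hR, hzR⟩ := hz.halve_pow hQ l (by omega)
  set c := fun m => u m / 2 ^ l with hc
  obtain ⟨D, hD⟩ : ∃ D : ℕ, ∑ m, c m / 2 + D = 0 := ⟨(-∑ m, c m / 2).toNat, by
    simp only [hc]; omega⟩
  obtain ⟨A, hA, hAD, hDn, R', hR', hz'⟩ := hzR.halve (u := c) hR hD.ge (.inr hD)
  -- Both sides have sum zero, so every bound is attained: apart from the choice of `A`, any
  -- solution has this form.
  have hR'eq : R' = (fun m => c m / 2) + ind A := by
    have := (Finset.sum_eq_sum_iff_of_le (s := Finset.univ) fun m _ => hR' m).1 (by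
      rw [hz'.sum_eq_zero, Finset.sum_add_distrib, sum_ind, hAD, hD])
    funext m
    exact this m (Finset.mem_univ m)
  have hOc : (O.card : ℤ) = ∑ m, c m - 2 * ∑ m, c m / 2 := by
    rw [← sum_ind, Finset.mul_sum, ← Finset.sum_sub_distrib]
    refine Finset.sum_congr rfl fun m _ => ?_
    have := hO m
    simp only [ind]
    split_ifs with h
    · have := this.1 h
      show _ = u m / 2 ^ l - 2 * (u m / 2 ^ l / 2)
      omega
    · have := mt this.2 h
      show _ = u m / 2 ^ l - 2 * (u m / 2 ^ l / 2)
      omega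
  have hEc' : (E.card : ℤ) = ∑ m, c m := hEc
  -- Indeed `O.card = ∑ c - 2 * ∑ (c / 2) = E.card + 2 * D`.
  have hOE : (O \ E).card = 2 * D := by
    rw [Finset.card_sdiff_of_subset hE]
    omega
  obtain ⟨B, hB, hBD, ht⟩ := exists_top_subset (S := O \ E) f D (by omega)
  have hBO : B ⊆ O := hB.trans Finset.sdiff_subset
  have hzB : Zeroes (n - D) ((fun m => c m / 2) + ind B) := by
    rw [hR'eq] at hz'
    -- `B` is on top not only in `O \ E` but in `O`, since `E` has the smallest entries. Thus `A`
    -- may be replaced by `B`, and undoing the halving from `B` gives the rounded vector.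
    refine hz'.to_top (O := O) (fun m hm => (hO m).2 (hA m hm)) hBO (by omega) ?_
    intro i hi hiB j hj
    have hj' := Finset.mem_sdiff.1 (hB hj)
    refine hf i hi j hj'.1 ?_
    by_cases hiE : i ∈ E
    · exact hmin i hiE j hj'.1 hj'.2
    · exact ht i (Finset.mem_sdiff.2 ⟨hi, hiE⟩) hiB j hj
  have : Zeroes n (fun m => c m - ind E m) := by
    have key : (fun m => (c m - ind E m) / 2) = fun m => c m / 2 := by
      funext m
      simp only [ind]
      split_ifs with h
      · have : c m % 2 = 1 := (hO m).1 (hE h)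
        omega
      · simp
    have := Zeroes.of_half (v := fun m => c m - ind E m) (O := O \ E) (U := B) (n := n - D)
      (fun m => by
        have := hO m
        simp only [ind, Finset.mem_sdiff]
        by_cases h : m ∈ E
        · have : c m % 2 = 1 := (hO m).1 (hE h)
          simp only [h, not_true, and_false, if_true, false_iff]
          omega
        · simpa [h] using this) hB (by omega) (by simpa only [key] using hzB)
    rwa [hBD, Nat.sub_add_cancel hDn] at this
  exact (zeroes_pow_smul l).2 this

end Transfers

end TCAM

namespace TCAM

/-! ### Complexity in terms of transfers -/

section Complexity
variable {k : ℕ}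

/-- The weights together with the weight `c` of the outside target `⊥`. -/
def vec (x : Fin k → ℤ) (c : ℤ) : Option (Fin k) → ℤ
  | none => c
  | some i => x i

/-- A partition of `2 ^ W` as a vector of sum zero. -/
def ext (W : ℕ) (P : Fin k → ℕ) : Option (Fin k) → ℤ := vec (fun i => (P i : ℤ)) (-2 ^ W)

@[simp] theorem ext_none (W : ℕ) (P : Fin k → ℕ) : ext W P none = -2 ^ W := rfl

@[simp] theorem ext_some (W : ℕ) (P : Fin k → ℕ) (i : Fin k) : ext W P (some i) = P i := rfl

theorem sum_ext (W : ℕ) (P : Fin k → ℕ) : ∑ m, ext W P m = ∑ i, (P i : ℤ) - 2 ^ W := by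
  rw [Fintype.sum_option]; simp; ring

/-- A dummy transaction becomes a transfer of `2 ^ W` to the outside target. Its weight `c` is
general because each dummy transaction changes it. -/
theorem zeroes_of_foldl {W : ℕ} (s : List (Transaction k)) : ∀ (x : Fin k → ℤ) (c : ℤ),
    s.foldl (Transaction.apply W) x = (fun _ => 0) → ∑ i, x i + c = 0 →
    Zeroes s.length (vec x c) := by
  induction s with
  | nil =>
    intro x c h hc
    have hx : x = fun _ => 0 := h
    subst hx
    have : vec (fun _ : Fin k => (0 : ℤ)) c = 0 := by
      funext m
      cases m
      · simpa [vec] using hc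
      · rfl
    rw [this]; exact .zero _
  | cons a s ih =>
    intro x c h hc
    rw [List.foldl_cons] at h
    cases a with
    | transfer i j l hij =>
      have e : vec (Transaction.apply W x (.transfer i j l hij)) c =
          vec x c + (2 : ℤ) ^ l • move (some i) (some j) := by
        funext m
        cases m with
        | none => simp [vec, move_apply]
        | some m =>
          simp only [vec, Transaction.apply, Pi.add_apply, Pi.smul_apply, move_apply,
            Option.some.injEq, smul_eq_mul]
          by_cases h1 : m = i
          · subst h1; simp [hij]; ring
          · by_cases h2 : m = j
            · subst h2; simp [h1]
            · simp [h1, h2]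
      refine .step (some i) (some j) l ?_
      rw [← e]
      refine ih _ _ h ?_
      have : ∑ m, vec (Transaction.apply W x (.transfer i j l hij)) c m = ∑ m, vec x c m := by
        rw [e]; simp [Finset.sum_add_distrib, ← Finset.mul_sum, sum_single_sub]
      rw [Fintype.sum_option, Fintype.sum_option] at this
      simp only [vec] at this
      omega
    | discharge j =>
      have e : vec (Transaction.apply W x (.discharge j)) (c + 2 ^ W) =
          vec x c + (2 : ℤ) ^ W • move (some j) none := by
        funext m
        cases m with
        | none => simp [vec, move_apply]
        | some m =>
          simp only [vec, Transaction.apply, Pi.add_apply, Pi.smul_apply, move_apply,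
            Option.some.injEq, smul_eq_mul]
          by_cases h1 : m = j
          · subst h1; simp; ring
          · simp [h1]
      refine .step (some j) none W ?_
      rw [← e]
      refine ih _ _ h ?_
      have : ∑ m, vec (Transaction.apply W x (.discharge j)) (c + 2 ^ W) m = ∑ m, vec x c m := by
        rw [e]; simp [Finset.sum_add_distrib, ← Finset.mul_sum, sum_single_sub]
      rw [Fintype.sum_option, Fintype.sum_option] at this
      simp only [vec] at this
      omega

/-- Counterpart of `Zeroes.of_add` for transactions. The list has no dummy transaction, so its
effect is the same for all `W`. -/
theorem exists_transfers (t : ℕ) : ∀ (x d : Fin k → ℤ), ∑ i, d i = 0 → ∑ i, |d i| ≤ 2 * t →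
    ∃ L : List (Transaction k), L.length ≤ t ∧ ∀ W, L.foldl (Transaction.apply W) x = x + d := by
  induction t with
  | zero =>
    intro x d _ h
    have hd : d = 0 := eq_zero_of_sum_abs_le (by simpa using h)
    exact ⟨[], le_rfl, fun W => by simp [hd]⟩
  | succ t ih =>
    intro x d hd h
    by_cases h0 : d = 0
    · exact ⟨[], by simp, fun W => by simp [h0]⟩
    · obtain ⟨i, j, hi, hj⟩ := exists_pos_neg hd h0
      have hij : i ≠ j := by rintro rfl; omega
      have hs := sum_abs_add (d := d) hij 1
      have h1 : |d i - 1| = |d i| - 1 := by rw [abs_of_nonneg (by omega), abs_of_pos hi]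
      have h2 : |d j + 1| = |d j| - 1 := by rw [abs_of_nonpos (by omega), abs_of_neg hj]; ring
      obtain ⟨L, hL, hf⟩ := ih (x + move j i) (d + (1 : ℤ) • move i j) (sum_add_single _ hd)
        (by push_cast at h; omega)
      refine ⟨.transfer j i 0 hij.symm :: L, by simpa using hL, fun W => ?_⟩
      have e : Transaction.apply W x (.transfer j i 0 hij.symm) = x + move j i := by
        funext m
        simp only [Transaction.apply, Pi.add_apply, move_apply]
        by_cases hm1 : m = j
        · subst hm1; simp [hij.symm]; ring
        · by_cases hm2 : m = i
          · subst hm2; simp only [hm1, if_true, if_false]; ring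
          · simp only [hm1, hm2, if_false]; ring
      rw [List.foldl_cons, e, hf, one_smul]
      unfold move; abel

/-- Transfers of twice as much. -/
def Transaction.shift : Transaction k → Transaction k
  | .transfer i j l h => .transfer i j (l + 1) h
  | .discharge j => .discharge j

/-- Doubling the weights doubles the sizes of the transfers; the dummy transaction doubles by itself
when `W` becomes `W + 1`. -/
theorem foldl_shift {W : ℕ} (s : List (Transaction k)) : ∀ x : Fin k → ℤ,
    (s.map Transaction.shift).foldl (Transaction.apply (W + 1)) ((2 : ℤ) • x) =
      (2 : ℤ) • s.foldl (Transaction.apply W) x := by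
  induction s with
  | nil => intro x; rfl
  | cons a s ih =>
    intro x
    rw [List.map_cons, List.foldl_cons, List.foldl_cons, ← ih]
    congr 1
    funext m
    cases a <;> simp only [Transaction.shift, Transaction.apply, Pi.smul_apply, smul_eq_mul,
      pow_succ] <;> split_ifs <;> ring

/-- Induction on `W`. While `W > 0`, the outside entry is even, so normalized unit transfers do not
touch it and are genuine transactions; halving leaves a partition of half the sum. At `W = 0` a
single target holds the weight `1` and the dummy transaction finishes. -/
theorem exists_induces (W : ℕ) : ∀ {n : ℕ} {P : Fin k → ℕ}, IsPartition W P →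
    Zeroes n (ext W P) → ∃ s : List (Transaction k), s.length ≤ n ∧ Induces W s P := by
  induction W with
  | zero =>
    intro n P hP hz
    have hn := hz.one_le fun h => by simpa using congrFun h none
    have hP' : ∑ i, P i = 1 := by simpa [IsPartition] using hP
    obtain ⟨j, hj⟩ : ∃ j, P j ≠ 0 := by
      by_contra h
      push Not at h
      simp [h] at hP'
    have key : P j + ∑ i ∈ Finset.univ.erase j, P i = 1 := by
      rw [Finset.add_sum_erase _ _ (Finset.mem_univ j), hP']
    have h0 : ∀ i ∈ Finset.univ.erase j, P i = 0 :=
      (Finset.sum_eq_zero_iff (s := Finset.univ.erase j)).1 (by omega)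
    refine ⟨[.discharge j], by simpa using hn, ?_⟩
    unfold Induces
    rw [List.foldl_cons, List.foldl_nil]
    funext m
    simp only [Transaction.apply]
    split_ifs with h
    · subst h
      have : P m = 1 := by omega
      simp [this]
    · simp [h0 m (by simp [h])]
  | succ W ih =>
    intro n P hP hz
    obtain ⟨A, h1, h2, h3, h4⟩ := hz.exists_up
    -- The outside entry is `-2 ^ (W + 1)`, hence even.
    have hnone : none ∉ A := fun h => by
      have := h1 none h
      rw [ext_none, pow_succ] at this
      omega
    set P' : Fin k → ℕ := fun i => P i / 2 + if some i ∈ A then 1 else 0 with hP'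
    have e : (fun m => ext (W + 1) P m / 2) + ind A = ext W P' := by
      funext m
      cases m with
      | none =>
        simp only [Pi.add_apply, ext_none, ind, hnone, if_false, pow_succ]
        omega
      | some i =>
        simp only [Pi.add_apply, ext_some, ind, hP']
        push_cast
        rfl
    rw [e] at h4
    have hpart : IsPartition W P' := by
      have := h4.sum_eq_zero
      rw [sum_ext] at this
      unfold IsPartition
      zify
      omega
    obtain ⟨s, hs, hind⟩ := ih hpart h4
    -- The step from `P` to `2 * P'` changes every odd entry by one, so half the number of odd
    -- entries suffices.
    obtain ⟨L, hL, hf⟩ := exists_transfers A.card (fun i => (P i : ℤ))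
      (fun i => 2 * (P' i : ℤ) - P i) (by
        rw [Finset.sum_sub_distrib, ← Finset.mul_sum]
        unfold IsPartition at hP hpart
        zify at hP hpart
        rw [hP, hpart, pow_succ]; ring) (by
        have : ∀ i : Fin k, |2 * (P' i : ℤ) - P i| =
            ind (Finset.univ.filter fun m => ext (W + 1) P m % 2 = 1) (some i) := by
          intro i
          have hA := h1 (some i)
          simp only [ext_some] at hA
          simp only [ind, Finset.mem_filter, Finset.mem_univ, true_and, ext_some, hP']
          rcases Nat.mod_two_eq_zero_or_one (P i) with h | h
          · have hi : some i ∉ A := fun hi => by have := hA hi; omega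
            have h' : ¬ (P i : ℤ) % 2 = 1 := by omega
            simp only [hi, h', if_false]
            rw [abs_eq_zero]; push_cast; omega
          · have h' : (P i : ℤ) % 2 = 1 := by omega
            simp only [h', if_true]
            by_cases hi : some i ∈ A
            · simp only [hi, if_true]
              rw [show 2 * ((P i / 2 + 1 : ℕ) : ℤ) - P i = 1 by push_cast; omega]
              rfl
            · simp only [hi, if_false]
              rw [show 2 * ((P i / 2 + 0 : ℕ) : ℤ) - P i = -1 by push_cast; omega]
              rfl
        rw [Finset.sum_congr rfl fun i _ => this i]
        have h5 := sum_ind (Finset.univ.filter fun m => ext (W + 1) P m % 2 = 1)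
        rw [Fintype.sum_option, ← h2] at h5
        have h6 : 0 ≤ ind (Finset.univ.filter fun m => ext (W + 1) P m % 2 = 1) none := by
          simp only [ind]; split_ifs <;> omega
        push_cast at h5
        omega)
    refine ⟨L ++ s.map Transaction.shift, by simp; omega, ?_⟩
    unfold Induces at hind ⊢
    rw [List.foldl_append, hf]
    have : ((fun i => (P i : ℤ)) + fun i => 2 * (P' i : ℤ) - P i) =
        (2 : ℤ) • fun i => (P' i : ℤ) := by
      funext i; simp
    rw [this, foldl_shift, hind]
    funext i; simp

theorem complexity_le_iff {W n : ℕ} {P : Fin k → ℕ} (hP : IsPartition W P) :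
    complexity W P ≤ n ↔ Zeroes n (ext W P) := by
  have hsum : ∑ m, ext W P m = 0 := by
    rw [sum_ext]
    unfold IsPartition at hP
    zify at hP
    omega
  constructor
  · intro h
    -- The infimum of the empty set would be `0`, so a sequence has to be exhibited; unit transfers
    -- alone turn any vector of sum zero into zero.
    have hne : {m : ℕ | ∃ s : List (Transaction k), s.length = m ∧ Induces W s P}.Nonempty := by
      have hz := (Zeroes.zero 0).of_add_one (v := ext W P) (d := -ext W P)
        (t := (∑ m, |ext W P m|).toNat) (by simp [hsum]) (by
          have := Finset.sum_nonneg fun m (_ : m ∈ Finset.univ) => abs_nonneg (ext W P m)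
          simp; omega) (by simp)
      obtain ⟨s, -, hs⟩ := exists_induces W hP hz
      exact ⟨_, s, rfl, hs⟩
    obtain ⟨s, hs, hind⟩ : ∃ s : List (Transaction k), s.length = complexity W P ∧ Induces W s P :=
      Nat.sInf_mem hne
    refine Zeroes.mono (zeroes_of_foldl s _ _ hind ?_) (hs.trans_le h)
    rw [sum_ext] at hsum
    exact hsum
  · intro h
    obtain ⟨s, hs, hind⟩ := exists_induces W hP h
    have : complexity W P ≤ s.length := Nat.sInf_le ⟨s, rfl, hind⟩
    exact this.trans hs

end Complexity

/-! ### Distances -/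

/-- The denominator in the definition of the distance. -/
def OneSidedDistance.weight : OneSidedDistance → ℕ → ℕ
  | .absolute, _ => 1
  | .relative, p => p

section Distance
variable {k : ℕ} {D : OneSidedDistance} {P Q : Fin k → ℕ}

theorem OneSidedDistance.dist_eq (D : OneSidedDistance) (Q P : Fin k → ℕ) :
    D.dist Q P = ⨆ i, ((Q i : ℝ) - P i) / (D.weight (P i) : ℝ) := by
  cases D <;> simp [dist, weight]

theorem OneSidedDistance.DefinedAt.weight_pos (h : D.DefinedAt P) (i : Fin k) :
    0 < D.weight (P i) := by
  cases D
  · exact Nat.one_pos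
  · exact h i

theorem IsPartition.pos {W : ℕ} (h : IsPartition W P) : 0 < k := by
  rcases Nat.eq_zero_or_pos k with rfl | hk
  · have h' : ∑ i, P i = 2 ^ W := h
    have := Nat.one_le_two_pow (n := W)
    rw [Finset.univ_eq_empty, Finset.sum_empty] at h'
    omega
  · exact hk

theorem IsPartition.le {W : ℕ} (h : IsPartition W P) (i : Fin k) : P i ≤ 2 ^ W := by
  rw [← (show ∑ i, P i = 2 ^ W from h)]
  exact Finset.single_le_sum (fun _ _ => Nat.zero_le _) (Finset.mem_univ i)

theorem OneSidedDistance.exists_dist_eq (hk : 0 < k) (D : OneSidedDistance) (Q P : Fin k → ℕ) :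
    ∃ i, D.dist Q P = ((Q i : ℝ) - P i) / (D.weight (P i) : ℝ) := by
  have : Nonempty (Fin k) := ⟨⟨0, hk⟩⟩
  obtain ⟨i, hi⟩ := exists_eq_ciSup_of_finite
    (f := fun i => ((Q i : ℝ) - P i) / (D.weight (P i) : ℝ))
  exact ⟨i, by rw [dist_eq, ← hi]⟩

theorem OneSidedDistance.le_dist (D : OneSidedDistance) (Q P : Fin k → ℕ) (i : Fin k) :
    ((Q i : ℝ) - P i) / (D.weight (P i) : ℝ) ≤ D.dist Q P := by
  rw [dist_eq]
  exact le_ciSup (f := fun i => ((Q i : ℝ) - P i) / (D.weight (P i) : ℝ))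
    (Set.finite_range _).bddAbove i

/-- The largest admissible entry `i` for distance less than `a / b`. -/
def OneSidedDistance.upper (D : OneSidedDistance) (a b p : ℕ) : ℕ := p + (a * D.weight p - 1) / b

/-- With cleared denominators the condition is `(Q i - P i) * b < a * weight`. Among integers, `x *
b < y` with `y > 0` means `x ≤ (y - 1) / b`, which explains the `- 1` in `upper`. -/
theorem OneSidedDistance.dist_lt_iff (hk : 0 < k) (hD : D.DefinedAt P) {a b : ℕ} (ha : 0 < a)
    (hb : 0 < b) : D.dist Q P < (a : ℝ) / b ↔ ∀ i, Q i ≤ D.upper a b (P i) := by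
  have key : ∀ i, ((Q i : ℝ) - P i) / (D.weight (P i) : ℝ) < (a : ℝ) / b ↔
      Q i ≤ D.upper a b (P i) := by
    intro i
    have hw := hD.weight_pos i
    have hb' : (0 : ℝ) < b := by exact_mod_cast hb
    have hw' : (0 : ℝ) < D.weight (P i) := by exact_mod_cast hw
    rw [div_lt_div_iff₀ hw' hb']
    have haw : 0 < a * D.weight (P i) := Nat.mul_pos ha hw
    have e1 : ((Q i : ℝ) - P i) * b < a * D.weight (P i) ↔
        Q i * b < a * D.weight (P i) + P i * b := by
      rw [sub_mul, sub_lt_iff_lt_add]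
      exact_mod_cast Iff.rfl
    rw [e1, upper]
    constructor
    · intro h
      by_contra hlt
      push Not at hlt
      have h1 := Nat.lt_mul_div_succ (a * D.weight (P i) - 1) hb
      have h2 : (P i + (a * D.weight (P i) - 1) / b + 1) * b ≤ Q i * b :=
        Nat.mul_le_mul_right b hlt
      have h3 : (P i + (a * D.weight (P i) - 1) / b + 1) * b =
        P i * b + b * ((a * D.weight (P i) - 1) / b + 1) := by ring
      omega
    · intro h
      have h1 := Nat.mul_div_le (a * D.weight (P i) - 1) b
      have h2 := Nat.mul_le_mul_right b h
      have h3 : (P i + (a * D.weight (P i) - 1) / b) * b =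
        P i * b + b * ((a * D.weight (P i) - 1) / b) := by ring
      omega
  constructor
  · intro h i
    exact (key i).1 (lt_of_le_of_lt (D.le_dist Q P i) h)
  · intro h
    obtain ⟨i, hi⟩ := D.exists_dist_eq hk Q P
    rw [hi]
    exact (key i).2 (h i)

/-- The two partitions have the same sum, so some entry of `Q` is at least that of `P`. -/
theorem OneSidedDistance.dist_nonneg {W : ℕ} (hP : IsPartition W P) (hQ : IsPartition W Q) :
    0 ≤ D.dist Q P := by
  obtain ⟨i, -, hi⟩ := Finset.exists_le_of_sum_le (s := Finset.univ) (f := P) (g := Q)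
    ⟨⟨0, hP.pos⟩, Finset.mem_univ _⟩ (by
      rw [show ∑ i, P i = 2 ^ W from hP, show ∑ i, Q i = 2 ^ W from hQ])
  refine le_trans ?_ (D.le_dist Q P i)
  have : (P i : ℝ) ≤ Q i := by exact_mod_cast hi
  exact div_nonneg (by linarith) (Nat.cast_nonneg _)

theorem OneSidedDistance.dist_le {W : ℕ} (hP : IsPartition W P) (hQ : IsPartition W Q)
    (hD : D.DefinedAt P) : D.dist Q P ≤ 2 ^ W := by
  obtain ⟨i, hi⟩ := D.exists_dist_eq hP.pos Q P
  have hw : (1 : ℝ) ≤ D.weight (P i) := by exact_mod_cast hD.weight_pos i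
  have h1 : (Q i : ℝ) ≤ 2 ^ W := by exact_mod_cast hQ.le i
  rw [hi, div_le_iff₀ (by linarith)]
  have : (0 : ℝ) ≤ P i := Nat.cast_nonneg _
  nlinarith [show (0 : ℝ) ≤ 2 ^ W by positivity]

/-- Two different fractions with denominators `g` and `g'` differ by at least `1 / (g * g')`, and
the weights are at most `2 ^ W`. This is the resolution of the binary search for bounded length. -/
theorem OneSidedDistance.dist_gap {W : ℕ} (hP : IsPartition W P) (hD : D.DefinedAt P)
    {Q' : Fin k → ℕ} (h : D.dist Q P < D.dist Q' P) :
    D.dist Q P + 1 / 2 ^ (2 * W) ≤ D.dist Q' P := by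
  obtain ⟨i, hi⟩ := D.exists_dist_eq hP.pos Q P
  obtain ⟨j, hj⟩ := D.exists_dist_eq hP.pos Q' P
  have hle : ∀ i, D.weight (P i) ≤ 2 ^ W := fun i => by
    cases D
    · exact Nat.one_le_two_pow
    · exact hP.le i
  have hwi := hD.weight_pos i
  have hwj := hD.weight_pos j
  rw [hi, hj] at h ⊢
  have hlei := hle i
  have hlej := hle j
  clear hle hi hj
  generalize D.weight (P i) = g at *
  generalize D.weight (P j) = g' at *
  have hg : (0 : ℝ) < g := by exact_mod_cast hwi
  have hg' : (0 : ℝ) < g' := by exact_mod_cast hwj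
  have hgg : (g : ℝ) * g' ≤ 2 ^ (2 * W) := by
    rw [two_mul, pow_add]
    exact_mod_cast Nat.mul_le_mul hlei hlej
  have h1 : (1 : ℝ) / 2 ^ (2 * W) ≤ 1 / (g * g') :=
    one_div_le_one_div_of_le (mul_pos hg hg') hgg
  refine (add_le_add_right h1 _).trans ?_
  rw [div_lt_div_iff₀ hg hg'] at h
  rw [div_add_div _ _ hg.ne' (mul_pos hg hg').ne', div_le_div_iff₀ (by positivity) hg']
  have h2 : ((Q i : ℤ) - P i) * g' + 1 ≤ ((Q' j : ℤ) - P j) * g := by exact_mod_cast h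
  have h3 : ((Q i : ℝ) - P i) * g' + 1 ≤ ((Q' j : ℝ) - P j) * g := by exact_mod_cast h2
  nlinarith [mul_le_mul_of_nonneg_left h3 (mul_pos hg hg').le]

end Distance

/-! ### Keys -/

/-- The number with the lowest `B` binary digits of `x` in reversed order. -/
def brev : ℕ → ℕ → ℕ
  | 0, _ => 0
  | B + 1, x => x % 2 * 2 ^ B + brev B (x / 2)

theorem brev_lt (B x : ℕ) : brev B x < 2 ^ B := by
  induction B generalizing x with
  | zero => simp [brev]
  | succ B ih =>
    have := ih (x / 2)
    rcases Nat.mod_two_eq_zero_or_one x with h | h <;> simp only [brev, h, pow_succ] <;> omega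

theorem brev_inj {B x y : ℕ} (hx : x < 2 ^ B) (hy : y < 2 ^ B) (h : brev B x = brev B y) :
    x = y := by
  induction B generalizing x y with
  | zero => simp at hx hy; omega
  | succ B ih =>
    have h1 := brev_lt B (x / 2)
    have h2 := brev_lt B (y / 2)
    rw [pow_succ] at hx hy
    have := ih (x := x / 2) (y := y / 2) (by omega) (by omega)
    rcases Nat.mod_two_eq_zero_or_one x with hx2 | hx2 <;>
    rcases Nat.mod_two_eq_zero_or_one y with hy2 | hy2 <;>
    simp only [brev, hx2, hy2] at h <;> omega

theorem RLe.of_brev {B x y : ℕ} (hx : x < 2 ^ B) (hy : y < 2 ^ B) (h : brev B x ≤ brev B y) :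
    RLe x y := by
  induction B generalizing x y with
  | zero =>
    obtain rfl : x = y := by simp at hx hy; omega
    exact .refl _
  | succ B ih =>
    have h1 := brev_lt B (x / 2)
    have h2 := brev_lt B (y / 2)
    rw [pow_succ] at hx hy
    rcases Nat.mod_two_eq_zero_or_one x with hx2 | hx2 <;>
    rcases Nat.mod_two_eq_zero_or_one y with hy2 | hy2 <;>
    simp only [brev, hx2, hy2] at h
    · exact .step (by omega) (by exact_mod_cast ih (by omega) (by omega) (by omega))
    · exact .lt (by omega) (by omega)
    · omega
    · exact .step (by omega) (by exact_mod_cast ih (by omega) (by omega) (by omega))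

theorem RLe.half {a b : ℤ} (h : RLe a b) (hab : a % 2 = b % 2) : RLe (a / 2) (b / 2) := by
  cases h with
  | refl => exact .refl _
  | lt h1 h2 => omega
  | step _ h => exact h

/-- Common lowest digits are the most significant ones of the order and do not affect the
comparison. -/
theorem RLe.div_pow {a b : ℤ} {l : ℕ} (h : RLe a b) (hab : ∀ j < l, a / 2 ^ j % 2 = b / 2 ^ j % 2) :
    RLe (a / 2 ^ l) (b / 2 ^ l) := by
  induction l with
  | zero => simpa using h
  | succ l ih =>
    have := (ih fun j hj => hab j (by omega)).half (hab l (by omega))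
    rwa [Int.ediv_ediv_of_nonneg (by positivity), Int.ediv_ediv_of_nonneg (by positivity),
      ← pow_succ] at this

/-- A mask that ends with the lowest digit where `x` and `y` differ. -/
def rmask (x y : ℕ) : ℕ := (x ^^^ y) ^^^ ((x ^^^ y) - 1)

theorem rmask_bit_ne {a b : Bool} (h : a ≠ b) (x y : ℕ) :
    rmask (Nat.bit a x) (Nat.bit b y) = Nat.bit true 0 := by
  have h1 : (a != b) = true := by cases a <;> cases b <;> simp_all
  have h2 : Nat.bit true (x ^^^ y) - 1 = Nat.bit false (x ^^^ y) := by simp [Nat.bit]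
  rw [rmask, Nat.xor_bit, h1, h2, Nat.xor_bit]
  simp

theorem rmask_bit_eq (a : Bool) {x y : ℕ} (h : x ≠ y) :
    rmask (Nat.bit a x) (Nat.bit a y) = Nat.bit true (rmask x y) := by
  have h0 : x ^^^ y ≠ 0 := by simpa [Nat.xor_eq_zero_iff] using h
  have h2 : Nat.bit false (x ^^^ y) - 1 = Nat.bit true ((x ^^^ y) - 1) := by
    simp only [Nat.bit, cond_true, cond_false]; omega
  rw [rmask, Nat.xor_bit, bne_self_eq_false, h2, Nat.xor_bit]
  rfl

theorem brev_bit (B : ℕ) (a : Bool) (x : ℕ) : brev (B + 1) (Nat.bit a x) = a.toNat * 2 ^ B + brev B x := by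
  rw [brev, Nat.bit_mod_two, Nat.bit_div_two]

/-- The mask keeps the digits up to the lowest one where `x` and `y` differ. Below it the masked
words agree, so the ordinary comparison is decided by that digit, and so is the reversed order. A
comparison of keys thus takes constant time, without computing the reversed words. -/
theorem and_rmask_lt_iff {B x y : ℕ} (hx : x < 2 ^ B) (hy : y < 2 ^ B) :
    x &&& rmask x y < y &&& rmask x y ↔ brev B x < brev B y := by
  induction B generalizing x y with
  | zero => simp at hx hy; simp [hx, hy]
  | succ B ih =>
    obtain ⟨a, x, rfl⟩ : ∃ a x', x = Nat.bit a x' := ⟨_, _, (Nat.bit_bodd_div2 x).symm⟩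
    obtain ⟨b, y, rfl⟩ : ∃ a x', y = Nat.bit a x' := ⟨_, _, (Nat.bit_bodd_div2 y).symm⟩
    have h1 := brev_lt B x
    have h2 := brev_lt B y
    rw [brev_bit, brev_bit]
    by_cases hab : a = b
    · subst hab
      by_cases hxy : x = y
      · subst hxy; simp
      · have := ih (x := x) (y := y) (by cases a <;> simp [Nat.bit, pow_succ] at hx <;> omega)
          (by cases a <;> simp [Nat.bit, pow_succ] at hy <;> omega)
        rw [rmask_bit_eq a hxy, Nat.land_bit, Nat.land_bit, Bool.and_true, Nat.add_lt_add_iff_left,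
          ← this]
        cases a <;> simp [Nat.bit]
    · rw [rmask_bit_ne hab, Nat.land_bit, Nat.land_bit]
      cases a <;> cases b <;> simp_all [Nat.bit] <;> omega

/-- Subtracting `1` flips the digits up to the lowest digit one, so the exclusive or is a mask of
these digits, of which `x` has only the last. -/
theorem exists_lowbit {x : ℕ} (hx : 0 < x) :
    ∃ j, x &&& (x ^^^ (x - 1)) = 2 ^ j ∧ 2 ^ j ∣ x ∧ x / 2 ^ j % 2 = 1 := by
  induction x using Nat.strong_induction_on with
  | _ x ih =>
    obtain ⟨a, y, rfl⟩ : ∃ a x', x = Nat.bit a x' := ⟨_, _, (Nat.bit_bodd_div2 x).symm⟩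
    cases a
    · have hy : 0 < y := by simp [Nat.bit] at hx; omega
      obtain ⟨j, h1, h2, h3⟩ := ih y (by simp [Nat.bit]; omega) hy
      have e : Nat.bit false y - 1 = Nat.bit true (y - 1) := by
        simp only [Nat.bit, cond_true, cond_false]; omega
      refine ⟨j + 1, ?_, ?_, ?_⟩
      · rw [e, Nat.xor_bit, Nat.land_bit, h1]
        simp [Nat.bit, pow_succ, mul_comm]
      · simp only [Nat.bit, cond_false, pow_succ]
        rw [mul_comm]
        exact Nat.mul_dvd_mul_left 2 h2
      · rw [pow_succ', ← Nat.div_div_eq_div_mul, ← Nat.div2_val (Nat.bit false y), Nat.div2_bit, h3]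
    · have e : Nat.bit true y - 1 = Nat.bit false y := by simp [Nat.bit]
      refine ⟨0, ?_, ?_, ?_⟩
      · rw [e, Nat.xor_bit, Nat.land_bit]
        simp [Nat.bit]
      · simp
      · simp [Nat.bit]

/-- The position of the lowest digit one. -/
def lowbit (x : ℕ) : ℕ := Nat.log2 (x &&& (x ^^^ (x - 1)))

theorem lowbit_spec {x : ℕ} (hx : 0 < x) : 2 ^ lowbit x ∣ x ∧ x / 2 ^ lowbit x % 2 = 1 := by
  obtain ⟨j, h1, h2, h3⟩ := exists_lowbit hx
  rw [lowbit, h1, Nat.log2_two_pow]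
  exact ⟨h2, h3⟩

end TCAM

namespace TCAM
open TCAM.Expr TCAM.Stmt

/-! ### Ranks in lists -/

/-- The words in the memory cells `a, …, a + n - 1`. -/
def seg (m : ℕ → ℕ) (a n : ℕ) : List ℕ := (List.range n).map fun j => m (a + j)

@[simp] theorem seg_zero (m : ℕ → ℕ) (a : ℕ) : seg m a 0 = [] := rfl

theorem seg_succ (m : ℕ → ℕ) (a n : ℕ) : seg m a (n + 1) = seg m a n ++ [m (a + n)] := by
  simp [seg, List.range_succ]

@[simp] theorem length_seg (m : ℕ → ℕ) (a n : ℕ) : (seg m a n).length = n := by simp [seg]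

theorem seg_congr {m m' : ℕ → ℕ} {a n : ℕ} (h : ∀ x, a ≤ x → x < a + n → m x = m' x) :
    seg m a n = seg m' a n := by
  apply List.map_congr_left
  intro j hj
  rw [List.mem_range] at hj
  exact h _ (by omega) (by omega)

theorem mem_seg {m : ℕ → ℕ} {a n x : ℕ} : x ∈ seg m a n ↔ ∃ j < n, m (a + j) = x := by
  simp [seg]

theorem seg_add (m : ℕ → ℕ) (a n p : ℕ) : seg m a (n + p) = seg m a n ++ seg m (a + n) p := by
  induction p with
  | zero => simp
  | succ p ih => rw [← add_assoc, seg_succ, ih, seg_succ, List.append_assoc, add_assoc]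

theorem seg_eq_of_append {m : ℕ → ℕ} {a : ℕ} {L : List ℕ} {x : ℕ} (h : seg m a L.length = L)
    (hx : m (a + L.length) = x) : seg m a (L ++ [x]).length = L ++ [x] := by
  rw [List.length_append, List.length_singleton, seg_succ, h, hx]

/-- The number of entries with key less than that of `v`. -/
def cntLt (B v : ℕ) (L : List ℕ) : ℕ := L.countP fun x => brev B x < brev B v

/-- The number of entries with key at most that of `v`. -/
def cntLe (B v : ℕ) (L : List ℕ) : ℕ := L.countP fun x => brev B x ≤ brev B v

/-- In the list `L` sorted by keys, `v` is at position `r` (counted from `0`). -/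
def IsRank (B : ℕ) (L : List ℕ) (r v : ℕ) : Prop := cntLt B v L ≤ r ∧ r < cntLe B v L

theorem cntLe_le_length (B v : ℕ) (L : List ℕ) : cntLe B v L ≤ L.length := List.countP_le_length

theorem cntLt_le_length (B v : ℕ) (L : List ℕ) : cntLt B v L ≤ L.length := List.countP_le_length

/-- The number of keys up to a threshold `t` first exceeds `r` at some `t`, and there it can only
jump because `t` is the key of an entry. -/
theorem exists_isRank (B : ℕ) {L : List ℕ} {r : ℕ} (h : r < L.length) :
    ∃ v ∈ L, IsRank B L r v := by
  have hex : ∃ t, r < L.countP fun x => brev B x ≤ t := ⟨2 ^ B, by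
    rwa [List.countP_eq_length.2 fun x _ => by simpa using (brev_lt B x).le]⟩
  have h1 := Nat.find_spec hex
  have h2 : (L.countP fun x => brev B x < Nat.find hex) ≤ r := by
    rcases hn : Nat.find hex with _ | t
    · simp
    · have := Nat.find_min hex (m := t) (by omega)
      rw [not_lt] at this
      simpa [Nat.lt_succ_iff] using this
  obtain ⟨v, hv, he⟩ : ∃ v ∈ L, brev B v = Nat.find hex := by
    by_contra hne
    push Not at hne
    refine absurd (lt_of_le_of_lt h2 h1) (not_lt.2 (List.countP_mono_left fun x hx hle => ?_))
    have := hne x hx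
    simp only [decide_eq_true_eq] at hle ⊢
    omega
  exact ⟨v, hv, by rw [← he] at h1 h2; exact ⟨h2, h1⟩⟩

/-! ### Counting -/

/-- A mask that separates the keys in registers `x` and `y`. -/
def maskE (x y : ℕ) : Expr := (reg x ^^^ reg y) ^^^ ((reg x ^^^ reg y) - lit 1)

@[simp] theorem eval_maskE (x y : ℕ) (s : St) : (maskE x y).eval s = rmask (s.r x) (s.r y) := rfl

@[simp] theorem ok_maskE (x y N : ℕ) (s : St) : (maskE x y).Ok N s ↔ True := by simp [maskE]

/-- Registers `23` and `24` get the numbers of entries in the memory cells from `r20` to `r21` with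
keys less than, and at most, that of `r22`. -/
def countS : Stmt := block [
  set 23 (lit 0), set 24 (lit 0), set 25 (reg 20),
  loop (reg 25) (reg 21) (block [
    set 26 (load (reg 25)),
    set 27 (maskE 26 22),
    ite (reg 26 &&& reg 27) (reg 22 &&& reg 27) (set 23 (reg 23 + lit 1)) skip,
    ite (reg 22 &&& reg 27) (reg 26 &&& reg 27) skip (set 24 (reg 24 + lit 1)),
    set 25 (reg 25 + lit 1)])]

variable {B : ℕ}

theorem run_countS (hN : WordBound (2 ^ B)) {s : St} {T n : ℕ} (hn : s.r 21 = s.r 20 + n)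
    (hT : 8 * n + 4 ≤ T) : Run (2 ^ B) countS s T fun s' => s'.m = s.m ∧
      s'.r 23 = cntLt B (s.r 22) (seg s.m (s.r 20) n) ∧
      s'.r 24 = cntLe B (s.r 22) (seg s.m (s.r 20) n) := by
  apply Run.of_bdd
  intro hb
  refine Run.set_seq hN rfl (by omega) (by simp) ?_
  refine Run.set_seq hN rfl (by omega) (by simp) ?_
  refine Run.set_seq hN rfl (by omega) (by simp) ?_
  refine Run.for_loop (fun j s' => s'.m = s.m ∧ j ≤ n ∧ s'.r 25 = s.r 20 + j ∧
      s'.r 23 = cntLt B (s.r 22) (seg s.m (s.r 20) j) ∧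
      s'.r 24 = cntLe B (s.r 22) (seg s.m (s.r 20) j)) n 7 ?_ (by omega) ?_ ?_ ?_
  · simp [cntLt, cntLe]
  · rintro j s' hs' hf ⟨h1, h2, h3, h4, h5⟩
    have h21 : s'.r 21 = s.r 21 := by simpa using hf 21 (by decide)
    simp [h3, h21, hn]
  · rintro j s' hs' hf hj ⟨h1, h2, h3, h4, h5⟩
    have h22 : s'.r 22 = s.r 22 := by simpa using hf 22 (by decide)
    have c1 := cntLt_le_length B (s.r 22) (seg s.m (s.r 20) j)
    have c2 := cntLe_le_length B (s.r 22) (seg s.m (s.r 20) j)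
    rw [length_seg] at c1 c2
    have b1 := hb.1 21
    have key := and_rmask_lt_iff (hb.2 (s.r 20 + j)) (hb.1 22)
    have key' := and_rmask_lt_iff (hb.1 22) (hb.2 (s.r 20 + j))
    rw [show rmask (s.r 22) (s.m (s.r 20 + j)) = rmask (s.m (s.r 20 + j)) (s.r 22) by
      rw [rmask, rmask, Nat.xor_comm (s.r 22)]] at key'
    refine Run.set_seq hN rfl (by omega) (by simp) ?_
    refine Run.set_seq hN rfl (by omega) (by simp) ?_
    refine Run.seq (T₁ := 2) (Q := fun s'' => s''.m = s.m ∧ s''.r 25 = s.r 20 + j ∧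
      s''.r 22 = s.r 22 ∧ s''.r 24 = s'.r 24 ∧ s''.r 26 = s.m (s.r 20 + j) ∧
      s''.r 27 = rmask (s.m (s.r 20 + j)) (s.r 22) ∧
      s''.r 23 = cntLt B (s.r 22) (seg s.m (s.r 20) (j + 1))) ?_ (by omega) ?_
    · refine Run.ite (by omega) (by simp) (by simp) (fun h => ?_) fun h => ?_
      · refine Run.set hN rfl (by omega) (by simp; omega) ?_
        simp [h1, h3, h22, key, h4] at h ⊢
        simp [cntLt, seg_succ, h]
      · refine Run.skip ?_
        simp [h1, h3, h22, key, h4] at h ⊢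
        simp [cntLt, seg_succ, h]
    · rintro s'' hs'' - ⟨e1, e2, e3, e4, e5, e6, e7⟩
      refine Run.seq (T₁ := 2) (Q := fun t => t.m = s.m ∧ t.r 25 = s.r 20 + j ∧
        t.r 23 = cntLt B (s.r 22) (seg s.m (s.r 20) (j + 1)) ∧
        t.r 24 = cntLe B (s.r 22) (seg s.m (s.r 20) (j + 1))) ?_ (by omega) ?_
      · refine Run.ite (by omega) (by simp) (by simp) (fun h => ?_) fun h => ?_
        · refine Run.skip ?_
          simp [e1, e2, e3, e5, e6, key', e7, e4, h5] at h ⊢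
          simp [cntLe, seg_succ, h]
        · refine Run.set hN rfl (by omega) (by simp; omega) ?_
          simp [e1, e2, e3, e5, e6, key', e7, e4, h5] at h ⊢
          simp [cntLe, seg_succ, h]
      · rintro t ht - ⟨f1, f2, f3, f4⟩
        refine Run.set hN rfl (by omega) (by simp; omega) ?_
        simp [f1, f2, f3, f4]
        omega
  · rintro s' hs' hf ⟨h1, h2, h3, h4, h5⟩
    exact ⟨h1, h4, h5⟩

end TCAM

namespace TCAM
open TCAM.Expr TCAM.Stmt

variable {B : ℕ}

/-! ### Quadratic selection, for short lists -/

/-- Register `29` gets the entry of rank `r28` in the memory cells from `r20` to `r21`. -/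
def bruteS : Stmt := block [
  set 30 (reg 20),
  loop (reg 30) (reg 21) (block [
    set 22 (load (reg 30)),
    countS,
    ite (reg 28) (reg 23) skip (ite (reg 28) (reg 24) (set 29 (reg 22)) skip),
    set 30 (reg 30 + lit 1)])]

theorem run_bruteS (hN : WordBound (2 ^ B)) {s : St} {T n : ℕ} (hn : s.r 21 = s.r 20 + n)
    (hr : s.r 28 < n) (hT : n * (8 * n + 10) + 2 ≤ T) : Run (2 ^ B) bruteS s T fun s' =>
      s'.m = s.m ∧ s'.r 29 ∈ seg s.m (s.r 20) n ∧
      IsRank B (seg s.m (s.r 20) n) (s.r 28) (s'.r 29) := by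
  apply Run.of_bdd
  intro hb
  have b1 := hb.1 21
  refine Run.set_seq hN rfl (by omega) (by simp) ?_
  -- Register `29` may contain an old value at first. It is claimed to be right only after an entry
  -- of the wanted rank has been passed; at the end there is one by `exists_isRank`.
  refine Run.for_loop (fun j s' => s'.m = s.m ∧ j ≤ n ∧ s'.r 30 = s.r 20 + j ∧
      ((∃ x ∈ seg s.m (s.r 20) j, IsRank B (seg s.m (s.r 20) n) (s.r 28) x) →
        s'.r 29 ∈ seg s.m (s.r 20) n ∧ IsRank B (seg s.m (s.r 20) n) (s.r 28) (s'.r 29)))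
      n (8 * n + 9) ?_ (by rw [show 8 * n + 9 + 1 = 8 * n + 10 by ring]; omega) ?_ ?_ ?_
  · simp
  · rintro j s' hs' hf ⟨h1, h2, h3, h4⟩
    have h21 : s'.r 21 = s.r 21 := by simpa using hf 21 (by decide)
    simp [h3, h21, hn]
  · rintro j s' hs' hf hj ⟨h1, h2, h3, h4⟩
    have h20 : s'.r 20 = s.r 20 := by simpa using hf 20 (by decide)
    have h21 : s'.r 21 = s.r 21 := by simpa using hf 21 (by decide)
    have h28 : s'.r 28 = s.r 28 := by simpa using hf 28 (by decide)
    refine Run.set_seq hN rfl (by omega) (by simp) ?_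
    refine Run.seq (run_countS hN (n := n) (T := 8 * n + 4) (by simp [h20, h21, hn]) le_rfl)
      (by omega) ?_
    rintro s'' hs'' hf'' ⟨e1, e2, e3⟩
    have e30 : s''.r 30 = s.r 20 + j := by simpa [h3] using hf'' 30 (by decide)
    have e22 : s''.r 22 = s.m (s.r 20 + j) := by simpa [h3, h1] using hf'' 22 (by decide)
    have e28 : s''.r 28 = s.r 28 := by simpa [h28] using hf'' 28 (by decide)
    have e29 : s''.r 29 = s'.r 29 := by simpa using hf'' 29 (by decide)
    simp [h3, h1, h20] at e1 e2 e3
    have hmem : s.m (s.r 20 + j) ∈ seg s.m (s.r 20) n := mem_seg.2 ⟨j, hj, rfl⟩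
    refine Run.seq (T₁ := 3) (Q := fun t => t.m = s.m ∧ t.r 30 = s.r 20 + j ∧
      ((∃ x ∈ seg s.m (s.r 20) (j + 1), IsRank B (seg s.m (s.r 20) n) (s.r 28) x) →
        t.r 29 ∈ seg s.m (s.r 20) n ∧ IsRank B (seg s.m (s.r 20) n) (s.r 28) (t.r 29)))
      ?_ (by omega) ?_
    · have hstep : ¬ IsRank B (seg s.m (s.r 20) n) (s.r 28) (s.m (s.r 20 + j)) →
          ((∃ x ∈ seg s.m (s.r 20) (j + 1), IsRank B (seg s.m (s.r 20) n) (s.r 28) x) →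
          s''.r 29 ∈ seg s.m (s.r 20) n ∧ IsRank B (seg s.m (s.r 20) n) (s.r 28) (s''.r 29)) := by
        rintro hnot ⟨x, hx, hxr⟩
        rw [seg_succ, List.mem_append, List.mem_singleton] at hx
        rw [e29]
        rcases hx with hx | rfl
        · exact h4 ⟨x, hx, hxr⟩
        · exact absurd hxr hnot
      refine Run.ite (by omega) (by simp) (by simp) (fun h => ?_) fun h => ?_
      · simp [e28, e2] at h
        exact Run.skip ⟨e1, e30, hstep fun hh => absurd hh.1 (by omega)⟩
      · simp [e28, e2] at h
        refine Run.ite (by omega) (by simp) (by simp) (fun h' => ?_) fun h' => ?_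
        · simp [e28, e3] at h'
          refine Run.set hN rfl (by omega) (by simp) ?_
          simp [e1, e30, e22]
          exact fun _ _ _ => ⟨hmem, h, h'⟩
        · simp [e28, e3] at h'
          exact Run.skip ⟨e1, e30, hstep fun hh => absurd hh.2 (by omega)⟩
    · rintro t ht - ⟨f1, f2, f3⟩
      refine Run.set hN rfl (by omega) (by simp; omega) ?_
      simp [f1, f2]
      refine ⟨by omega, by omega, fun x hx hxr => f3 ⟨x, hx, hxr⟩⟩
  · rintro s' hs' hf ⟨h1, h2, h3, h4⟩
    exact ⟨h1, h4 (exists_isRank B (by simpa using hr))⟩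

/-! ### Medians of groups -/

/-- `M` has the medians of groups of five entries of `L`. -/
def Medians (B : ℕ) (M L : List ℕ) : Prop :=
  ∀ t, 3 * M.countP (fun x => t ≤ brev B x) ≤ L.countP (fun x => t ≤ brev B x) ∧
    3 * M.countP (fun x => brev B x ≤ t) ≤ L.countP (fun x => brev B x ≤ t)

theorem countP_le_add (B v : ℕ) (L : List ℕ) :
    L.countP (fun x => brev B v ≤ brev B x) + cntLt B v L = L.length := by
  rw [cntLt, List.length_eq_countP_add_countP (fun x => decide (brev B v ≤ brev B x))]
  congr 1
  exact List.countP_congr fun x _ => by simp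

/-- If the median of a group of five reaches a threshold from either side, then so do at least three
entries of the group. -/
theorem Medians.append {M L g : List ℕ} {v : ℕ} (h : Medians B M L) (hg : g.length = 5)
    (hv : IsRank B g 2 v) : Medians B (M ++ [v]) (L ++ g) := by
  intro t
  obtain ⟨h1, h2⟩ := h t
  have h3 := countP_le_add B v g
  obtain ⟨h4, h5⟩ := hv
  rw [List.countP_append, List.countP_append, List.countP_append, List.countP_append]
  constructor
  · by_cases ht : t ≤ brev B v
    · have : g.countP (fun x => brev B v ≤ brev B x) ≤ g.countP (fun x => t ≤ brev B x) :=
        List.countP_mono_left fun x _ hx => by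
          simp only [decide_eq_true_eq] at hx ⊢; omega
      simp [ht]; omega
    · simp [ht]; omega
  · by_cases ht : brev B v ≤ t
    · have : cntLe B v g ≤ g.countP (fun x => brev B x ≤ t) :=
        List.countP_mono_left fun x _ hx => by
          simp only [decide_eq_true_eq] at hx ⊢; omega
      simp [ht]; omega
    · simp [ht]; omega

theorem Medians.append_right {M L : List ℕ} (h : Medians B M L) (L' : List ℕ) :
    Medians B M (L ++ L') := by
  intro t
  obtain ⟨h1, h2⟩ := h t
  rw [List.countP_append, List.countP_append]
  omega

/-- The median of the medians splits the list well. -/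
theorem Medians.split {M L : List ℕ} (h : Medians B M L) (hM : M.length = L.length / 5) {v : ℕ}
    (hv : IsRank B M (M.length / 2) v) :
    10 * cntLt B v L ≤ 7 * L.length + 20 ∧ 10 * (L.length - cntLe B v L) ≤ 7 * L.length + 20 := by
  -- About half of the `L.length / 5` medians are on each side of `v`, ties included, and each
  -- stands for three entries. So about three tenths of `L` are on each side; the summand `20`
  -- covers the rounding.
  obtain ⟨h1, h2⟩ := h (brev B v)
  obtain ⟨h3, h4⟩ := hv
  have h5 := countP_le_add B v L
  have h6 := countP_le_add B v M
  change 3 * cntLe B v M ≤ cntLe B v L at h2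
  omega

/-- The medians of the groups of five among `r11` entries from `r10` on are written to the memory
cells from `r16` on. -/
def mediansS : Stmt := block [
  set 31 (reg 10), set 32 (reg 16), set 33 (reg 10 + reg 11),
  loop (reg 31 + lit 4) (reg 33) (block [
    set 20 (reg 31), set 21 (reg 31 + lit 5), set 28 (lit 2),
    bruteS,
    store (reg 32) (reg 29), set 32 (reg 32 + lit 1), set 31 (reg 31 + lit 5)])]

theorem run_mediansS (hN : WordBound (2 ^ B)) {s : St} {T : ℕ}
    (h16 : s.r 10 + s.r 11 ≤ s.r 16) (hB : s.r 16 + s.r 11 + 10 < 2 ^ B)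
    (hT : 53 * s.r 11 + 10 ≤ T) : Run (2 ^ B) mediansS s T fun s' =>
      s'.r 32 = s.r 16 + s.r 11 / 5 ∧ (∀ x < s.r 16, s'.m x = s.m x) ∧
      Medians B (seg s'.m (s.r 16) (s.r 11 / 5)) (seg s.m (s.r 10) (s.r 11)) := by
  apply Run.of_bdd
  intro hb
  set n := s.r 11 with hn
  have hlt := hN.lit
  refine Run.set_seq hN rfl (by omega) (by simp) ?_
  refine Run.set_seq hN rfl (by omega) (by simp) ?_
  refine Run.set_seq hN rfl (by omega) (by simp; omega) ?_
  refine Run.for_loop (fun j s' => j ≤ n / 5 ∧ s'.r 31 = s.r 10 + 5 * j ∧ s'.r 32 = s.r 16 + j ∧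
      (∀ x < s.r 16, s'.m x = s.m x) ∧
      Medians B (seg s'.m (s.r 16) j) (seg s.m (s.r 10) (5 * j))) (n / 5) 260 ?_
      (by omega) ?_ ?_ ?_
  · simp [Medians]
  · rintro j s' hs' hf ⟨h1, h2, h3, h4, h5⟩
    have h33 : s'.r 33 = s.r 10 + s.r 11 := by simpa using hf 33 (by decide)
    simp [h2, h33]
    omega
  · rintro j s' hs' hf hj ⟨h1, h2, h3, h4, h5⟩
    refine Run.set_seq hN rfl (by omega) (by simp) ?_
    refine Run.set_seq hN rfl (by omega) (by simp; omega) ?_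
    refine Run.set_seq hN rfl (by omega) (by simp) ?_
    refine Run.seq (run_bruteS hN (n := 5) (T := 252) (by simp) (by simp) (by norm_num))
      (by omega) ?_
    rintro s'' hs'' hf'' ⟨e1, e2, e3⟩
    have e32 : s''.r 32 = s.r 16 + j := by simpa [h3] using hf'' 32 (by decide)
    have e31 : s''.r 31 = s.r 10 + 5 * j := by simpa [h2] using hf'' 31 (by decide)
    simp [h2] at e1 e2 e3
    refine Run.store_seq hN rfl (by omega) (by simp) (by simp) ?_
    refine Run.set_seq hN rfl (by omega) (by simp; omega) ?_
    refine Run.set hN rfl (by omega) (by simp; omega) ?_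
    simp [e31, e32, e1]
    refine ⟨by omega, by omega, by omega, ?_, ?_⟩
    · intro x hx
      rw [St.put_m, if_neg (by omega), e1]
      exact h4 x hx
    · have e4 : seg s'.m (s.r 10 + 5 * j) 5 = seg s.m (s.r 10 + 5 * j) 5 :=
        seg_congr fun x _ _ => h4 x (by omega)
      rw [e4] at e3
      have e5 : seg (s''.put (s.r 16 + j) (s''.r 29)).m (s.r 16) j = seg s'.m (s.r 16) j :=
        seg_congr fun x _ _ => by rw [St.put_m, if_neg (by omega), e1]
      rw [seg_succ, e5, St.put_m, if_pos rfl, show 5 * (j + 1) = 5 * j + 5 by ring, seg_add]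
      exact h5.append (by simp) e3
  · rintro s' hs' hf ⟨h1, h2, h3, h4, h5⟩
    refine ⟨h3, h4, ?_⟩
    have := h5.append_right (seg s.m (s.r 10 + 5 * (n / 5)) (n - 5 * (n / 5)))
    rwa [← seg_add, show 5 * (n / 5) + (n - 5 * (n / 5)) = n by omega] at this

/-! ### Filtering -/

/-- Among the `r11` entries from `r10` on, keep those where register `p` has a smaller key than
register `q`; one of these is `26` (the entry) and the other is `22`. -/
def filterS (p q : ℕ) : Stmt := block [
  set 34 (reg 10), set 35 (reg 10), set 33 (reg 10 + reg 11),
  loop (reg 34) (reg 33) (block [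
    set 26 (load (reg 34)), set 27 (maskE 26 22),
    ite (reg p &&& reg 27) (reg q &&& reg 27)
      (block [store (reg 35) (reg 26), set 35 (reg 35 + lit 1)]) skip,
    set 34 (reg 34 + lit 1)]),
  set 11 (reg 35 - reg 10)]

theorem run_filterS (hN : WordBound (2 ^ B)) {s : St} {T p q : ℕ} {f : ℕ → Bool}
    (hf : ∀ t : St, t.Bdd (2 ^ B) → t.r 22 = s.r 22 → t.r 27 = rmask (t.r 26) (t.r 22) →
      (t.r p &&& t.r 27 < t.r q &&& t.r 27 ↔ f (t.r 26) = true))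
    (hB : s.r 10 + s.r 11 + 1 < 2 ^ B) (hT : 7 * s.r 11 + 5 ≤ T) :
    Run (2 ^ B) (filterS p q) s T fun s' =>
      s'.r 11 = ((seg s.m (s.r 10) (s.r 11)).filter f).length ∧
      seg s'.m (s.r 10) (s'.r 11) = (seg s.m (s.r 10) (s.r 11)).filter f ∧
      ∀ x, x < s.r 10 → s'.m x = s.m x := by
  apply Run.of_bdd
  intro hb
  set n := s.r 11 with hn
  refine Run.set_seq hN rfl (by omega) (by simp) ?_
  refine Run.set_seq hN rfl (by omega) (by simp) ?_
  refine Run.set_seq hN rfl (by omega) (by simp; omega) ?_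
  refine Run.seq (T₁ := 7 * n + 1) (Q := fun s' =>
      s'.r 35 = s.r 10 + ((seg s.m (s.r 10) n).filter f).length ∧
      seg s'.m (s.r 10) ((seg s.m (s.r 10) n).filter f).length = (seg s.m (s.r 10) n).filter f ∧
      ∀ x, x < s.r 10 → s'.m x = s.m x) ?_ (by omega) ?_
  -- The kept entries overwrite the list itself. The writing position never overtakes the reading
  -- position, so the cells not yet read are unchanged.
  · refine Run.for_loop (fun j s' => j ≤ n ∧ s'.r 34 = s.r 10 + j ∧
      s'.r 35 = s.r 10 + ((seg s.m (s.r 10) j).filter f).length ∧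
      seg s'.m (s.r 10) ((seg s.m (s.r 10) j).filter f).length = (seg s.m (s.r 10) j).filter f ∧
      ∀ x, x < s.r 10 ∨ s.r 10 + j ≤ x → s'.m x = s.m x) n 6 ?_ (by omega) ?_ ?_ ?_
    · simp
    · rintro j s' hs' hf' ⟨h1, h2, h3, h4, h5⟩
      have h33 : s'.r 33 = s.r 10 + s.r 11 := by simpa using hf' 33 (by simp [Stmt.writes, Stmt.block])
      simp [h2, h33, hn]
    · rintro j s' hs' hf' hj ⟨h1, h2, h3, h4, h5⟩
      have h22 : s'.r 22 = s.r 22 := by simpa using hf' 22 (by simp [Stmt.writes, Stmt.block])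
      have hle : ((seg s.m (s.r 10) j).filter f).length ≤ j := by
        simpa using List.length_filter_le f (seg s.m (s.r 10) j)
      refine Run.set_seq hN rfl (by omega) (by simp) ?_
      refine Run.set_seq hN rfl (by omega) (by simp) ?_
      have hval : s'.m (s.r 10 + j) = s.m (s.r 10 + j) := h5 _ (.inr le_rfl)
      refine Run.seq (T₁ := 3) (Q := fun t => t.r 34 = s.r 10 + j ∧
        t.r 35 = s.r 10 + ((seg s.m (s.r 10) (j + 1)).filter f).length ∧
        seg t.m (s.r 10) ((seg s.m (s.r 10) (j + 1)).filter f).length =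
          (seg s.m (s.r 10) (j + 1)).filter f ∧
        ∀ x, x < s.r 10 ∨ s.r 10 + (j + 1) ≤ x → t.m x = s.m x) ?_ (by omega) ?_
      · apply Run.of_bdd
        intro hbt
        have key := hf _ hbt (by simp [h22]) (by simp)
        refine Run.ite (by omega) (by simp) (by simp) (fun h => ?_) fun h => ?_
        · replace h := key.1 h
          simp [h2, hval] at h
          refine Run.store_seq hN rfl (by omega) (by simp) (by simp) ?_
          refine Run.set hN rfl (by omega) (by simp; omega) ?_
          have e5 : seg ((s'.set 26 (s'.m (s.r 10 + j))).set 27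
              (rmask (s'.m (s.r 10 + j)) (s'.r 22)) |>.put (s'.r 35) (s.m (s.r 10 + j))).m (s.r 10)
              ((seg s.m (s.r 10) j).filter f).length = (seg s.m (s.r 10) j).filter f := by
            refine Eq.trans (seg_congr fun x _ hx => ?_) h4
            rw [St.put_m, if_neg (by omega)]; rfl
          simp only [seg_succ, List.filter_append, List.filter_cons, h, List.filter_nil, if_true]
          refine ⟨by simp [h2], by simp [h3]; omega, ?_, ?_⟩
          · simp only [eval_reg, eval_add, eval_lit, St.set_m, St.put_r, St.set_r, eval_load]
            simp only [h2, hval] at e5 ⊢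
            refine seg_eq_of_append ?_ ?_
            · simpa using e5
            · rw [St.put_m, if_pos]
              · simp
              · simp [h3]
          · intro x hx
            simp only [St.set_m, St.put_m, eval_reg, St.set_r]
            rw [if_neg (by simp [h3]; omega)]
            exact h5 x (by omega)
        · replace h := fun hh => h (key.2 hh)
          simp [h2, hval] at h
          refine Run.skip ?_
          simp only [seg_succ, List.filter_append, List.filter_cons, h, List.filter_nil]
          refine ⟨by simp [h2], by simp [h3], by simpa using h4, fun x hx => ?_⟩
          exact h5 x (by omega)
      · rintro t ht - ⟨f1, f2, f3, f4⟩
        refine Run.set hN rfl (by omega) (by simp; omega) ?_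
        refine ⟨by omega, by simp [f1]; omega, by simpa using f2, by simpa using f3,
          by simpa using f4⟩
    · rintro s' hs' hf' ⟨h1, h2, h3, h4, h5⟩
      exact ⟨h3, h4, fun x hx => h5 x (.inl hx)⟩
  · rintro t ht hf' ⟨f1, f2, f3⟩
    have h10 : t.r 10 = s.r 10 := by simpa using hf' 10 (by
      simp [Stmt.writes, Stmt.block])
    refine Run.set hN rfl (by omega) (by simp) ?_
    have : t.r 35 - t.r 10 = ((seg s.m (s.r 10) n).filter f).length := by omega
    simp [this, f2]
    exact f3

end TCAM

namespace TCAM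
open TCAM.Expr TCAM.Stmt

variable {B : ℕ}

/-! ### Selection in linear time -/

theorem IsRank.of_filter_lt {L : List ℕ} {r v z : ℕ}
    (hz : z ∈ L.filter fun x => decide (brev B x < brev B v))
    (h : IsRank B (L.filter fun x => decide (brev B x < brev B v)) r z) : IsRank B L r z := by
  have hzv : brev B z < brev B v := by simpa using (List.mem_filter.1 hz).2
  obtain ⟨h1, h2⟩ := h
  rw [cntLt, List.countP_filter] at h1
  rw [cntLe, List.countP_filter] at h2
  refine ⟨le_trans (List.countP_mono_left fun x _ hx => ?_) h1,
    lt_of_lt_of_le h2 (List.countP_mono_left fun x _ hx => ?_)⟩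
  · simp only [decide_eq_true_eq, Bool.and_eq_true] at hx ⊢; omega
  · simp only [decide_eq_true_eq, Bool.and_eq_true] at hx ⊢; omega

theorem cntLe_add_filter {L : List ℕ} {v : ℕ} (q : ℕ → Bool)
    (hq : ∀ x, brev B x ≤ brev B v → q x = true) :
    cntLe B v L + (L.filter fun x => decide (brev B v < brev B x)).countP q = L.countP q := by
  rw [List.countP_filter, cntLe]
  induction L with
  | nil => rfl
  | cons x L ih =>
    simp only [List.countP_cons]
    rw [← ih]
    by_cases h : brev B x ≤ brev B v
    · simp [h, hq x h, not_lt.2 h]; omega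
    · simp [h, not_le.1 h]; omega

/-- All the `cntLe B v L` entries that are dropped come before the remaining ones, so ranks shift by
this number. -/
theorem IsRank.of_filter_gt {L : List ℕ} {r v z : ℕ} (hr : cntLe B v L ≤ r)
    (hz : z ∈ L.filter fun x => decide (brev B v < brev B x))
    (h : IsRank B (L.filter fun x => decide (brev B v < brev B x)) (r - cntLe B v L) z) :
    IsRank B L r z := by
  have hzv : brev B v < brev B z := by simpa using (List.mem_filter.1 hz).2
  obtain ⟨h1, h2⟩ := h
  have e1 := cntLe_add_filter (B := B) (L := L) (v := v) (fun x => brev B x < brev B z)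
    (fun x hx => by simp only [decide_eq_true_eq]; omega)
  have e2 := cntLe_add_filter (B := B) (L := L) (v := v) (fun x => brev B x ≤ brev B z)
    (fun x hx => by simp only [decide_eq_true_eq]; omega)
  simp only [IsRank, cntLt] at h1 ⊢
  simp only [cntLe] at h1 h2 e1 e2 ⊢ hr
  omega

theorem length_filter_gt (L : List ℕ) (v : ℕ) :
    (L.filter fun x => decide (brev B v < brev B x)).length + cntLe B v L = L.length := by
  have := cntLe_add_filter (B := B) (L := L) (v := v) (fun _ => true) (fun _ _ => rfl)
  simp only [List.countP_true] at this
  omega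

theorem length_filter_lt (L : List ℕ) (v : ℕ) :
    (L.filter fun x => decide (brev B x < brev B v)).length = cntLt B v L := by
  rw [cntLt, List.countP_eq_length_filter]

theorem IsRank.exists_brev_eq {L : List ℕ} {r v : ℕ} (h : IsRank B L r v) :
    ∃ x ∈ L, brev B x = brev B v := by
  by_contra hne
  push Not at hne
  refine absurd (lt_of_le_of_lt h.1 h.2) (not_lt.2 (List.countP_mono_left fun x hx hle => ?_))
  have := hne x hx
  simp only [decide_eq_true_eq] at hle ⊢
  omega

/-- One step of the selection by medians of medians.  The current list has `r11` entries, from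
`r10` on, and the rank is `r12`; if `r14 = 1`, its entry of that rank is in `r29`. Suspended lists
are below, down to the address `r13`. -/
def selectBody : Stmt :=
  ite (lit 0) (reg 14)
    (ite (reg 13) (reg 10)
      (block [
        set 11 (load (reg 10 - lit 2)), set 12 (load (reg 10 - lit 1)),
        set 10 (load (reg 10 - lit 3)),
        set 20 (reg 10), set 21 (reg 10 + reg 11), set 22 (reg 29), countS,
        ite (reg 12) (reg 23) (block [filterS 26 22, set 14 (lit 0)])
          (ite (reg 12) (reg 24) skip
            (block [filterS 22 26, set 12 (reg 12 - reg 24), set 14 (lit 0)]))])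
      (set 15 (lit 1)))
    (ite (reg 11) (lit 50)
      (block [
        set 20 (reg 10), set 21 (reg 10 + reg 11), set 28 (reg 12), bruteS, set 14 (lit 1)])
      (block [
        set 16 (reg 10 + reg 11 + lit 3), mediansS,
        store (reg 10 + reg 11) (reg 10), store (reg 10 + reg 11 + lit 1) (reg 11),
        store (reg 10 + reg 11 + lit 2) (reg 12),
        set 10 (reg 16), set 11 (reg 32 - reg 16), set 12 (reg 11 >>> lit 1)]))

/-- The entry of rank `r` in a short list. -/
theorem run_select_short (hN : WordBound (2 ^ B)) {n : ℕ} {s : St} (h14 : s.r 14 = 0)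
    (h15 : s.r 15 = 0) (h11 : s.r 11 = n) (h12 : s.r 12 < n) (hsp : s.r 10 + n < 2 ^ B)
    (hn : n < 50) : Run (2 ^ B) selectBody s (500 * n) fun s' =>
      s'.r 14 = 1 ∧ s'.r 15 = 0 ∧ s'.r 10 = s.r 10 ∧ s'.r 29 ∈ seg s.m (s.r 10) n ∧
      IsRank B (seg s.m (s.r 10) n) (s.r 12) (s'.r 29) ∧ ∀ x < s.r 10, s'.m x = s.m x := by
  refine Run.ite (by omega) (by simp) (by simp) (fun h => by simp [h14] at h) fun _ => ?_
  refine Run.ite (by omega) (by simp) (by simp) (fun _ => ?_) fun h => by simp [h11, hn] at h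
  refine Run.set_seq hN rfl (by omega) (by simp) ?_
  refine Run.set_seq hN rfl (by omega) (by simp [h11]; omega) ?_
  refine Run.set_seq hN rfl (by omega) (by simp) ?_
  -- With `n ≤ 49` the quadratic method is linear in `n`.
  have hq : n * (8 * n + 10) ≤ n * 402 := Nat.mul_le_mul_left n (by omega)
  refine Run.seq (run_bruteS hN (n := n) (T := 402 * n + 2) (by simp [h11]) (by simp [h12])
    (by omega)) (by omega) ?_
  rintro s' hs' hf ⟨e1, e2, e3⟩
  have e10 : s'.r 10 = s.r 10 := by simpa using hf 10 (by decide)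
  have e15 : s'.r 15 = s.r 15 := by simpa using hf 15 (by decide)
  refine Run.set hN rfl (by omega) (by simp) ?_
  simp at e1 e2 e3
  simp [e10, e15, h15, e2, e3, e1]

/-- A longer list is suspended, with the medians of its groups as the next list. -/
theorem run_select_push (hN : WordBound (2 ^ B)) {n : ℕ} {s : St} (h14 : s.r 14 = 0)
    (h15 : s.r 15 = 0) (h11 : s.r 11 = n) (hsp : s.r 10 + 2 * n + 20 < 2 ^ B)
    (hn : ¬ n < 50) : Run (2 ^ B) selectBody s (60 * n) fun s' =>
      s'.r 14 = 0 ∧ s'.r 15 = 0 ∧ s'.r 10 = s.r 10 + n + 3 ∧ s'.r 11 = n / 5 ∧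
      s'.r 12 = n / 5 / 2 ∧ (∀ x < s.r 10 + n, s'.m x = s.m x) ∧ s'.m (s.r 10 + n) = s.r 10 ∧
      s'.m (s.r 10 + n + 1) = n ∧ s'.m (s.r 10 + n + 2) = s.r 12 ∧
      Medians B (seg s'.m (s.r 10 + n + 3) (n / 5)) (seg s.m (s.r 10) n) := by
  refine Run.ite (by omega) (by simp) (by simp) (fun h => by simp [h14] at h) fun _ => ?_
  refine Run.ite (by omega) (by simp) (by simp) (fun h => by simp [h11] at h; omega) fun _ => ?_
  refine Run.set_seq hN rfl (by omega) (by simp; omega) ?_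
  refine Run.seq (run_mediansS hN (T := 53 * n + 10) (by simp) (by simp [h11]; omega)
    (by simp [h11])) (by omega) ?_
  rintro s' hs' hf ⟨e1, e2, e3⟩
  have e10 : s'.r 10 = s.r 10 := by simpa using hf 10 (by decide)
  have e11 : s'.r 11 = n := by simpa [h11] using hf 11 (by decide)
  have e12 : s'.r 12 = s.r 12 := by simpa using hf 12 (by decide)
  have e14 : s'.r 14 = 0 := by simpa [h14] using hf 14 (by decide)
  have e15 : s'.r 15 = 0 := by simpa [h15] using hf 15 (by decide)
  have e16 : s'.r 16 = s.r 10 + n + 3 := by simpa [h11] using hf 16 (by decide)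
  simp [h11] at e1 e2 e3
  refine Run.store_seq hN rfl (by omega) (by simp; omega) (by simp) ?_
  refine Run.store_seq hN rfl (by omega) (by simp; omega) (by simp) ?_
  refine Run.store_seq hN rfl (by omega) (by simp; omega) (by simp) ?_
  refine Run.set_seq hN rfl (by omega) (by simp) ?_
  refine Run.set_seq hN rfl (by omega) (by simp) ?_
  refine Run.set hN rfl (by omega) (by simp) ?_
  simp only [eval_reg, eval_add, eval_lit, eval_sub, eval_shr, St.set_r, St.set_m, St.put_r,
    e10, e11, e12, e14, e15, e16, e1, St.put_m]
  norm_num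
  refine ⟨by simp [Nat.shiftRight_eq_div_pow], ?_, ?_⟩
  · intro x hx
    rw [if_neg (by omega), if_neg (by omega), if_neg (by omega)]
    exact e2 x (by omega)
  · convert e3 using 1
    refine seg_congr fun x hx1 hx2 => ?_
    rw [St.put_m, if_neg (by omega), St.put_m, if_neg (by omega), St.put_m, if_neg (by omega)]

/-- The last suspended list is resumed with a pivot: it has been settled or becomes shorter. -/
theorem run_select_pop (hN : WordBound (2 ^ B)) {n b r v : ℕ} {s₂ : St} {L : List ℕ}
    (b14 : s₂.r 14 = 1) (b15 : s₂.r 15 = 0) (b10 : s₂.r 10 = b + n + 3)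
    (b13 : s₂.r 13 ≤ b) (hv : s₂.r 29 = v) (hL2 : seg s₂.m b n = L) (m0 : s₂.m (b + n) = b)
    (m1 : s₂.m (b + n + 1) = n) (m2 : s₂.m (b + n + 2) = r) (hsp : b + 2 * n + 20 < 2 ^ B)
    (h12 : r < n) (g1 : 10 * cntLt B v L ≤ 7 * n + 20)
    (g2 : 10 * (n - cntLe B v L) ≤ 7 * n + 20) :
    Run (2 ^ B) selectBody s₂ (16 * n + 20) fun s' => s'.r 15 = 0 ∧ s'.r 10 = b ∧
      (∀ x < b, s'.m x = s₂.m x) ∧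
      ((s'.r 14 = 1 ∧ s'.r 29 = v ∧ IsRank B L r v) ∨
      (s'.r 14 = 0 ∧ s'.r 12 < s'.r 11 ∧ 10 * s'.r 11 ≤ 7 * n + 20 ∧
        ((∃ f, seg s'.m b (s'.r 11) = L.filter f) ∧
        ∀ z, z ∈ seg s'.m b (s'.r 11) →
          IsRank B (seg s'.m b (s'.r 11)) (s'.r 12) z → IsRank B L r z))) := by
  have hlen : L.length = n := by simp [← hL2]
  have sub1 : b + n + 3 - 1 = b + n + 2 := by omega
  have sub2 : b + n + 3 - 2 = b + n + 1 := by omega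
  have sub3 : b + n + 3 - 3 = b + n := by omega
  have cle := cntLe_le_length B v L
  have clt := cntLt_le_length B v L
  rw [hlen] at cle clt
  refine Run.ite (by omega) (by simp) (by simp) (fun _ => ?_) fun h => by simp [b14] at h
  refine Run.ite (by omega) (by simp) (by simp) (fun _ => ?_)
    fun h => by simp [b10] at h; omega
  refine Run.set_seq hN rfl (by omega) (by simp) ?_
  refine Run.set_seq hN rfl (by omega) (by simp) ?_
  refine Run.set_seq hN rfl (by omega) (by simp) ?_
  refine Run.set_seq hN rfl (by omega) (by simp) ?_
  refine Run.set_seq hN rfl (by omega) (by simp [b10, sub1, sub2, sub3, m0, m1, m2]; omega) ?_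
  refine Run.set_seq hN rfl (by omega) (by simp) ?_
  refine Run.seq (run_countS hN (n := n) (T := 8 * n + 4)
    (by simp [b10, sub1, sub2, sub3, m0, m1, m2]) le_rfl) (by omega) ?_
  rintro s₃ hs₃ hf₃ ⟨c1, c2, c3⟩
  have c10 : s₃.r 10 = b := by
    simpa [b10, sub1, sub2, sub3, m0, m1, m2] using hf₃ 10 (by decide)
  have c11 : s₃.r 11 = n := by
    simpa [b10, sub1, sub2, sub3, m0, m1, m2] using hf₃ 11 (by decide)
  have c12 : s₃.r 12 = r := by
    simpa [b10, sub1, sub2, sub3, m0, m1, m2] using hf₃ 12 (by decide)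
  have c14 : s₃.r 14 = 1 := by simpa [b14] using hf₃ 14 (by decide)
  have c15 : s₃.r 15 = 0 := by simpa [b15] using hf₃ 15 (by decide)
  have c22 : s₃.r 22 = v := by simpa [hv] using hf₃ 22 (by decide)
  have c29 : s₃.r 29 = v := by simpa [hv] using hf₃ 29 (by decide)
  simp [b10, sub1, sub2, sub3, m0, m1, m2, hL2, hv] at c1 c2 c3
  have hL3 : seg s₃.m (b) n = L := by rw [c1]; exact hL2
  refine Run.ite (by omega) (by simp) (by simp) (fun h => ?_) fun h => ?_
  · simp [c12, c2] at h
    refine Run.seq (run_filterS hN (T := 7 * n + 5)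
      (f := fun x => decide (brev B x < brev B v))
      (fun t ht h22 h27 => ?_) (by omega) (by omega)) (by omega) ?_
    · rw [h27, and_rmask_lt_iff (ht.1 26) (ht.1 22), h22, c22]; simp
    · rintro s₄ hs₄ hf₄ ⟨d1, d2, d3⟩
      have d10 : s₄.r 10 = b := by simpa [c10] using hf₄ 10 (by decide)
      have d12 : s₄.r 12 = r := by simpa [c12] using hf₄ 12 (by decide)
      have d15 : s₄.r 15 = 0 := by simpa [c15] using hf₄ 15 (by decide)
      rw [c10, c11, hL3] at d1 d2
      rw [length_filter_lt] at d1
      refine Run.set hN rfl (by omega) (by simp) ?_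
      simp only [eval_reg, eval_lit, St.set_r, St.set_m]
      norm_num
      refine ⟨d15, d10, fun x hx => ?_, by omega, by omega, ⟨_, d2⟩, fun z hz hrk => ?_⟩
      · rw [d3 x (by omega), c1]
      · rw [d2] at hz hrk
        rw [d12] at hrk
        exact hrk.of_filter_lt hz
  · simp [c12, c2] at h
    refine Run.ite (by omega) (by simp) (by simp) (fun h' => ?_) fun h' => ?_
    · simp [c12, c3] at h'
      refine Run.skip ⟨c15, c10, fun x hx => ?_, .inl ⟨c14, c29, h, h'⟩⟩
      rw [c1]
    · simp [c12, c3] at h'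
      refine Run.seq (run_filterS hN (T := 7 * n + 5)
        (f := fun x => decide (brev B v < brev B x))
        (fun t ht h22 h27 => ?_) (by omega) (by omega)) (by omega) ?_
      · rw [h27, show rmask (t.r 26) (t.r 22) = rmask (t.r 22) (t.r 26) by
          rw [rmask, rmask, Nat.xor_comm (t.r 22)], and_rmask_lt_iff (ht.1 22) (ht.1 26), h22,
          c22]
        simp
      · rintro s₄ hs₄ hf₄ ⟨d1, d2, d3⟩
        have d10 : s₄.r 10 = b := by simpa [c10] using hf₄ 10 (by decide)
        have d12 : s₄.r 12 = r := by simpa [c12] using hf₄ 12 (by decide)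
        have d15 : s₄.r 15 = 0 := by simpa [c15] using hf₄ 15 (by decide)
        have d24 : s₄.r 24 = cntLe B v L := by simpa [c3] using hf₄ 24 (by decide)
        rw [c10, c11, hL3] at d1 d2
        have hgt := length_filter_gt (B := B) L v
        rw [hlen] at hgt
        refine Run.set_seq hN rfl (by omega) (by simp) ?_
        refine Run.set hN rfl (by omega) (by simp) ?_
        simp only [eval_reg, eval_lit, eval_sub, St.set_r, St.set_m]
        norm_num
        refine ⟨d15, d10, fun x hx => ?_, by omega, by omega, ⟨_, d2⟩, fun z hz hrk => ?_⟩
        · rw [d3 x (by omega), c1]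
        · rw [d2] at hz hrk
          rw [d12, d24] at hrk
          exact hrk.of_filter_gt h' hz

/-- One call of the recursive selection, as a series of iterations that leaves alone what is below
its list. For `n ≥ 50`, the cost is that of suspension (`60 * n`), of a call for `n / 5` medians
(`400 * n`), of resumption (`16 * n + 20`), and of a call for at most `7 * n / 10 + 2` entries
(`1400 * n + 4000`); the total is below `2000 * n`. -/
theorem runIter_select (hN : WordBound (2 ^ B)) (n : ℕ) : ∀ s : St, s.r 14 = 0 → s.r 15 = 0 →
    s.r 11 = n → s.r 12 < n → s.r 13 ≤ s.r 10 → s.r 10 + 2 * n + 20 < 2 ^ B →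
    RunIter (2 ^ B) (reg 15) (lit 1) selectBody s (2000 * n) fun s' =>
      s'.r 14 = 1 ∧ s'.r 15 = 0 ∧ s'.r 10 = s.r 10 ∧ s'.r 29 ∈ seg s.m (s.r 10) n ∧
      IsRank B (seg s.m (s.r 10) n) (s.r 12) (s'.r 29) ∧ ∀ x < s.r 10, s'.m x = s.m x := by
  induction n using Nat.strong_induction_on with
  | _ n ih =>
  intro s h14 h15 h11 h12 h13 hsp
  apply RunIter.of_bdd
  intro hb
  have hlt := hN.lit
  by_cases hn : n < 50
  · refine RunIter.step (T₁ := 500 * n) (Q := fun s' =>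
      s'.r 14 = 1 ∧ s'.r 15 = 0 ∧ s'.r 10 = s.r 10 ∧ s'.r 29 ∈ seg s.m (s.r 10) n ∧
      IsRank B (seg s.m (s.r 10) n) (s.r 12) (s'.r 29) ∧ ∀ x < s.r 10, s'.m x = s.m x)
      (by simp) (by simp) (by simp [h15]) (run_select_short hN h14 h15 h11 h12 (by omega) hn)
      (by omega) fun s' _ _ h => RunIter.refl h
  · set L := seg s.m (s.r 10) n with hL
    have hlen : L.length = n := by simp [hL]
    refine RunIter.step (T₁ := 60 * n) (Q := fun s' =>
      s'.r 14 = 0 ∧ s'.r 15 = 0 ∧ s'.r 10 = s.r 10 + n + 3 ∧ s'.r 11 = n / 5 ∧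
      s'.r 12 = n / 5 / 2 ∧ (∀ x < s.r 10 + n, s'.m x = s.m x) ∧ s'.m (s.r 10 + n) = s.r 10 ∧
      s'.m (s.r 10 + n + 1) = n ∧ s'.m (s.r 10 + n + 2) = s.r 12 ∧
      Medians B (seg s'.m (s.r 10 + n + 3) (n / 5)) L)
      (by simp) (by simp) (by simp [h15]) (run_select_push hN h14 h15 h11 hsp hn) (by omega) ?_
    rintro s₁ hs₁ hf₁ ⟨a14, a15, a10, a11, a12, amem, am0, am1, am2, amed⟩
    have a13 : s₁.r 13 = s.r 13 := by simpa using hf₁ 13 (by decide)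
    -- The call for the medians, whose list begins behind the suspended list and the three cells
    -- that describe it.
    refine RunIter.trans (ih (n / 5) (by omega) s₁ a14 a15 a11 (by omega) (by omega) (by omega))
      (by omega) ?_
    rintro s₂ hs₂ hf₂ ⟨b14, b15, b10, bmemv, brk, bmem⟩
    have b13 : s₂.r 13 = s.r 13 := by simpa [a13] using hf₂ 13 (by decide)
    rw [a10] at bmemv brk bmem b10
    rw [a12] at brk
    set v := s₂.r 29 with hv
    obtain ⟨g1, g2⟩ := amed.split (v := v) (by simp [hlen]) (by simpa using brk)
    rw [hlen] at g1 g2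
    have hmem2 : ∀ x < s.r 10 + n, s₂.m x = s.m x := fun x hx => by
      rw [bmem x (by omega), amem x hx]
    have hL2 : seg s₂.m (s.r 10) n = L := seg_congr fun x _ hx => hmem2 x hx
    have m0 : s₂.m (s.r 10 + n) = s.r 10 := by rw [bmem _ (by omega), am0]
    have m1 : s₂.m (s.r 10 + n + 1) = n := by rw [bmem _ (by omega), am1]
    have m2 : s₂.m (s.r 10 + n + 2) = s.r 12 := by rw [bmem _ (by omega), am2]
    refine RunIter.step (by simp) (by simp) (by simp [b15]) (run_select_pop hN b14 b15 b10
      (by omega) rfl hL2 m0 m1 m2 (by omega) h12 g1 g2) (by omega) ?_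
    rintro s₃ hs₃ hf₃ ⟨c15, c10, cmem, hc⟩
    have c13 : s₃.r 13 = s.r 13 := by simpa [b13] using hf₃ 13 (by decide)
    rcases hc with ⟨c14, c29, crk⟩ | ⟨c14, c12, c11, ⟨f, cf⟩, crk⟩
    · refine RunIter.refl ⟨c14, c15, c10, ?_, by rwa [c29], fun x hx => by rw [cmem x hx, hmem2 x (by omega)]⟩
      rw [c29]
      obtain ⟨x, hx, hxv⟩ := crk.exists_brev_eq
      obtain ⟨j, -, hj⟩ := mem_seg.1 hx
      -- A rank only determines a key. Keys are injective on words, so the pivot itself is in the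
      -- list.
      rwa [← brev_inj (hj ▸ hb.2 _) (hs₂.1 29) hxv]
    · refine RunIter.conseq (ih (s₃.r 11) (by omega) s₃ c14 c15 rfl c12 (by omega) (by omega))
        (by omega) ?_
      rintro s₄ hs₄ hf₄ ⟨d14, d15, d10, dmemv, drk, dmem⟩
      rw [c10] at dmemv drk dmem d10
      refine ⟨d14, d15, d10, ?_, crk _ dmemv drk, fun x hx => by rw [dmem x hx, cmem x hx, hmem2 x (by omega)]⟩
      rw [cf] at dmemv
      exact (List.mem_filter.1 dmemv).1

/-- Register `29` gets the entry of rank `r12` among the `r11` entries from `r13` on. -/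
def selectS : Stmt := block [
  set 10 (reg 13), set 14 (lit 0), set 15 (lit 0), loop (reg 15) (lit 1) selectBody]

theorem run_selectS (hN : WordBound (2 ^ B)) {s : St} {T : ℕ} (hr : s.r 12 < s.r 11)
    (hB : s.r 13 + 2 * s.r 11 + 20 < 2 ^ B) (hT : 2000 * s.r 11 + 10 ≤ T) :
    Run (2 ^ B) selectS s T fun s' =>
      s'.r 29 ∈ seg s.m (s.r 13) (s.r 11) ∧
      IsRank B (seg s.m (s.r 13) (s.r 11)) (s.r 12) (s'.r 29) ∧
      ∀ x < s.r 13, s'.m x = s.m x := by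
  refine Run.set_seq hN rfl (by omega) (by simp) ?_
  refine Run.set_seq hN rfl (by omega) (by simp) ?_
  refine Run.set_seq hN rfl (by omega) (by simp) ?_
  refine RunIter.run_loop (T₁ := 2000 * s.r 11 + 4) ?_ (by omega)
  refine RunIter.trans (runIter_select hN (s.r 11) _ (by simp) (by simp) (by simp) (by simpa using hr)
    (by simp) (by simp; omega)) (by omega) ?_
  rintro s' hs' hf ⟨h14, h15, h10, hmem, hrk, hm⟩
  simp at h10 hmem hrk hm
  have h13 : s'.r 13 = s.r 13 := by simpa using hf 13 (by decide)
  -- With the result available and no suspended list left, one more iteration sets the register that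
  -- ends the loop.
  refine RunIter.step (T₁ := 3) (Q := fun t => t = s'.set 15 1) (by simp) (by simp) (by simp [h15])
    ?_ (by omega) ?_
  · refine Run.ite (by omega) (by simp) (by simp) (fun _ => ?_) fun h => by simp [h14] at h
    refine Run.ite (by omega) (by simp) (by simp) (fun h => by simp [h13, h10] at h) fun _ => ?_
    exact Run.set hN rfl (by omega) (by simp) rfl
  · rintro t ht - rfl
    exact RunIter.refl (by simpa using ⟨hmem, hrk, hm⟩)

end TCAM

namespace TCAM
open TCAM.Expr TCAM.Stmt

variable {B : ℕ}

/-! ### The entries with the smallest keys -/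

/-- Traverses a list and picks the entries with key less than `t`, and `q` entries with key `t`. -/
def downs {ι : Type*} (key : ι → ℕ) (t : ℕ) : ℕ → List ι → List ι
  | _, [] => []
  | q, i :: L => if key i < t ∨ key i = t ∧ 0 < q then
      i :: downs key t (if key i = t then q - 1 else q) L else downs key t q L

/-- The part of the quota that is left after the traversal. -/
def quota {ι : Type*} (key : ι → ℕ) (t q : ℕ) (L : List ι) : ℕ := q - L.countP fun i => key i = t

section downs
variable {ι : Type*} {key : ι → ℕ} {t : ℕ}

theorem downs_append (L L' : List ι) : ∀ q,
    downs key t q (L ++ L') = downs key t q L ++ downs key t (quota key t q L) L' := by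
  induction L with
  | nil => intro q; simp [downs, quota]
  | cons i L ih =>
    intro q
    rw [List.cons_append, downs, downs]
    split_ifs with h h'
    · rw [ih, List.cons_append]
      simp only [quota, List.countP_cons, h', decide_true, if_true]
      congr 3; omega
    · rw [ih, List.cons_append]
      simp [quota, List.countP_cons, h']
    · rw [ih]
      congr 2
      simp only [quota, List.countP_cons, decide_eq_true_eq]
      split_ifs <;> omega

theorem downs_snoc (q : ℕ) (L : List ι) (i : ι) : downs key t q (L ++ [i]) =
    downs key t q L ++ if key i < t ∨ key i = t ∧ 0 < quota key t q L then [i] else [] := by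
  rw [downs_append]; simp [downs]

theorem quota_snoc (q : ℕ) (L : List ι) (i : ι) : quota key t q (L ++ [i]) =
    if key i = t then quota key t q L - 1 else quota key t q L := by
  simp only [quota, List.countP_append, List.countP_singleton, decide_eq_true_eq]
  split_ifs <;> omega

theorem downs_sublist (L : List ι) : ∀ q, (downs key t q L).Sublist L := by
  induction L with
  | nil => intro q; exact .refl _
  | cons i L ih =>
    intro q
    rw [downs]
    split_ifs
    · exact (ih _).cons_cons _
    · exact (ih _).cons_cons _
    · exact (ih _).cons _

theorem length_downs (L : List ι) : ∀ q, (downs key t q L).length =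
    (L.countP fun i => key i < t) + min q (L.countP fun i => key i = t) := by
  induction L with
  | nil => intro q; simp [downs]
  | cons i L ih =>
    intro q
    rw [downs, List.countP_cons, List.countP_cons]
    simp only [decide_eq_true_eq]
    split_ifs <;> simp only [List.length_cons, ih] <;> omega

/-- The threshold separates: what is picked has key at most `t`, and whatever has key below `t` is
picked. -/
theorem downs_le {L : List ι} {q : ℕ} {i j : ι} (hi : i ∈ downs key t q L) (hj : j ∈ L)
    (hj' : j ∉ downs key t q L) : key i ≤ key j := by
  have h1 : key i ≤ t := by
    clear hj hj'
    induction L generalizing q with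
    | nil => simp [downs] at hi
    | cons x L ih =>
      rw [downs] at hi
      split_ifs at hi with h
      · rcases List.mem_cons.1 hi with rfl | hi
        · omega
        · exact ih hi
      · rcases List.mem_cons.1 hi with rfl | hi
        · omega
        · exact ih hi
      · exact ih hi
  have h2 : t ≤ key j := by
    clear hi
    by_contra hlt
    apply hj'
    clear hj'
    induction L generalizing q with
    | nil => simp at hj
    | cons x L ih =>
      rw [downs]
      rcases List.mem_cons.1 hj with rfl | hj
      · rw [if_pos (by omega)]; simp
      · have := fun q => ih (q := q) hj
        split_ifs <;> simp [this]
  omega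

end downs

/-- If `v` has rank `r`, then at most `r` keys are smaller than its key, and there are enough equal
ones to fill up to `r`. Hence a threshold and a quota describe exactly `r` smallest entries, also in
the presence of ties. -/
theorem length_downs_isRank {ι : Type*} {x : ι → ℕ} {r v : ℕ} {L : List ι}
    (h : IsRank B (L.map x) r v) :
    (downs (fun i => brev B (x i)) (brev B v) (r - cntLt B v (L.map x)) L).length = r := by
  obtain ⟨h1, h2⟩ := h
  rw [length_downs]
  have h3 : cntLe B v (L.map x) = cntLt B v (L.map x) +
      L.countP fun i => brev B (x i) = brev B v := by
    clear h1 h2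
    simp only [cntLe, cntLt, List.countP_map]
    induction L with
    | nil => rfl
    | cons i L ih =>
      simp only [List.countP_cons, ih, Function.comp_apply, decide_eq_true_eq]
      split_ifs <;> omega
  have h4 : (L.countP fun i => brev B (x i) < brev B v) = cntLt B v (L.map x) := by
    simp only [cntLt, List.countP_map]; rfl
  omega

/-- For the `r37 - r36` entries from `r36` on: registers `22` and `39` get the entry of rank `r38`
and the number of entries with its key among the `r38` first ones. -/
def splitS : Stmt := block [
  set 40 (reg 36), set 41 (reg 37),
  loop (reg 40) (reg 37) (block [
    store (reg 41) (load (reg 40)), set 40 (reg 40 + lit 1), set 41 (reg 41 + lit 1)]),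
  set 13 (reg 37), set 11 (reg 37 - reg 36), set 12 (reg 38), selectS,
  set 20 (reg 36), set 21 (reg 37), set 22 (reg 29), countS, set 39 (reg 38 - reg 23)]

theorem run_splitS (hN : WordBound (2 ^ B)) {s : St} {T n : ℕ} (hn : s.r 37 = s.r 36 + n)
    (hr : s.r 38 < n) (hB : s.r 37 + 2 * n + 20 < 2 ^ B) (hT : 2020 * n + 30 ≤ T) :
    Run (2 ^ B) splitS s T fun s' => IsRank B (seg s.m (s.r 36) n) (s.r 38) (s'.r 22) ∧
      s'.r 39 = s.r 38 - cntLt B (s'.r 22) (seg s.m (s.r 36) n) ∧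
      ∀ x < s.r 37, s'.m x = s.m x := by
  refine Run.set_seq hN rfl (by omega) (by simp) ?_
  refine Run.set_seq hN rfl (by omega) (by simp) ?_
  -- Selection destroys its list, so it gets a copy behind the original; counting then uses the
  -- original.
  refine Run.seq (T₁ := 4 * n + 1) (Q := fun s' => (∀ x < s.r 37, s'.m x = s.m x) ∧
    seg s'.m (s.r 37) n = seg s.m (s.r 36) n) ?_ (by omega) ?_
  · refine Run.for_loop (fun j s' => s'.r 40 = s.r 36 + j ∧ s'.r 41 = s.r 37 + j ∧ j ≤ n ∧
      (∀ x < s.r 37, s'.m x = s.m x) ∧ seg s'.m (s.r 37) j = seg s.m (s.r 36) j)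
      n 3 ?_ (by omega) ?_ ?_ ?_
    · simp
    · rintro j s' hs' hf ⟨h1, h2, h3, h4⟩
      have h37 : s'.r 37 = s.r 37 := by simpa using hf 37 (by decide)
      simp [h1, h37, hn]
    · rintro j s' hs' hf hj ⟨h1, h2, h3, h4, h5⟩
      refine Run.store_seq hN rfl (by omega) (by simp) (by simp) ?_
      refine Run.set_seq hN rfl (by omega) (by simp; omega) ?_
      refine Run.set hN rfl (by omega) (by simp; omega) ?_
      simp [h1, h2]
      refine ⟨by omega, by omega, by omega, fun x hx => ?_, ?_⟩
      · rw [St.put_m, if_neg (by omega), h4 x hx]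
      · rw [seg_succ, seg_succ, ← h5, St.put_m, if_pos rfl, h4 _ (by omega)]
        congr 1
        exact seg_congr fun x _ _ => by rw [St.put_m, if_neg (by omega)]
    · rintro s' hs' hf ⟨h1, h2, h3, h4, h5⟩
      exact ⟨h4, h5⟩
  rintro s₁ hs₁ hf₁ ⟨h1, h2⟩
  have h36 : s₁.r 36 = s.r 36 := by simpa using hf₁ 36 (by decide)
  have h37 : s₁.r 37 = s.r 37 := by simpa using hf₁ 37 (by decide)
  have h38 : s₁.r 38 = s.r 38 := by simpa using hf₁ 38 (by decide)
  refine Run.set_seq hN rfl (by omega) (by simp) ?_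
  refine Run.set_seq hN rfl (by omega) (by simp) ?_
  refine Run.set_seq hN rfl (by omega) (by simp) ?_
  have hsub : s.r 36 + n - s.r 36 = n := by omega
  refine Run.seq (run_selectS hN (T := 2000 * n + 10) (by simp [h36, h37, h38, hn]; omega)
    (by simp [h36, h37, hn]; omega) (by simp [h36, h37, hn])) (by omega) ?_
  rintro s₂ hs₂ hf₂ ⟨-, hrk, hm⟩
  simp only [eval_reg, eval_sub, St.set_r, St.set_m] at hrk hm
  norm_num at hrk hm
  simp only [h36, h37, h38, hn, hsub] at hrk hm
  rw [← hn, h2] at hrk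
  have k36 : s₂.r 36 = s.r 36 := by simpa [h36] using hf₂ 36 (by decide)
  have k37 : s₂.r 37 = s.r 37 := by simpa [h37] using hf₂ 37 (by decide)
  have k38 : s₂.r 38 = s.r 38 := by simpa [h38] using hf₂ 38 (by decide)
  refine Run.set_seq hN rfl (by omega) (by simp) ?_
  refine Run.set_seq hN rfl (by omega) (by simp) ?_
  refine Run.set_seq hN rfl (by omega) (by simp) ?_
  refine Run.seq (run_countS hN (n := n) (T := 8 * n + 4) (by simp [k36, k37, hn]) (by omega))
    (by omega) ?_
  rintro s₃ hs₃ hf₃ ⟨c1, c2, -⟩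
  simp [k36] at c1 c2
  have hmem : ∀ x < s.r 37, s₂.m x = s.m x := fun x hx => by
    rw [hm x (by omega), h1 x hx]
  have hseg : seg s₂.m (s.r 36) n = seg s.m (s.r 36) n :=
    seg_congr fun x _ _ => hmem x (by omega)
  rw [hseg] at c2
  have l22 : s₃.r 22 = s₂.r 29 := by simpa using hf₃ 22 (by decide)
  have l38 : s₃.r 38 = s.r 38 := by simpa [k38] using hf₃ 38 (by decide)
  refine Run.set hN rfl (by omega) (by simp) ?_
  simp [l22, l38, c2, c1, hrk]
  exact hmem

/-- Register `42` is set if the entry in `r26` is among the first ones; see `splitS`. -/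
def decideS : Stmt := block [
  set 27 (maskE 26 22), set 42 (lit 0),
  ite (reg 26 &&& reg 27) (reg 22 &&& reg 27) (set 42 (lit 1))
    (ite (reg 22 &&& reg 27) (reg 26 &&& reg 27) skip
      (ite (lit 0) (reg 39) (block [set 42 (lit 1), set 39 (reg 39 - lit 1)]) skip))]

theorem run_decideS (hN : WordBound (2 ^ B)) {s : St} {T : ℕ} (hT : 7 ≤ T) :
    Run (2 ^ B) decideS s T fun s' => s'.m = s.m ∧
      s'.r 42 = (if brev B (s.r 26) < brev B (s.r 22) ∨
        brev B (s.r 26) = brev B (s.r 22) ∧ 0 < s.r 39 then 1 else 0) ∧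
      s'.r 39 = if brev B (s.r 26) = brev B (s.r 22) then s.r 39 - 1 else s.r 39 := by
  apply Run.of_bdd
  intro hb
  have key := and_rmask_lt_iff (hb.1 26) (hb.1 22)
  have key' := and_rmask_lt_iff (hb.1 22) (hb.1 26)
  rw [show rmask (s.r 22) (s.r 26) = rmask (s.r 26) (s.r 22) by
    rw [rmask, rmask, Nat.xor_comm (s.r 22)]] at key'
  refine Run.set_seq hN rfl (by omega) (by simp) ?_
  refine Run.set_seq hN rfl (by omega) (by simp) ?_
  refine Run.ite (by omega) (by simp) (by simp) (fun h => ?_) fun h => ?_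
  · simp [key] at h
    refine Run.set hN rfl (by omega) (by simp) ?_
    simp [h, h.ne]
  · simp [key] at h
    refine Run.ite (by omega) (by simp) (by simp) (fun h' => ?_) fun h' => ?_
    · simp [key'] at h'
      refine Run.skip ?_
      simp [h'.ne', not_lt.2 h'.le]
    · simp [key'] at h'
      have e : brev B (s.r 26) = brev B (s.r 22) := le_antisymm h' h
      refine Run.ite (by omega) (by simp) (by simp) (fun h' => ?_) fun h' => ?_
      · simp at h'
        refine Run.set_seq hN rfl (by omega) (by simp) ?_
        refine Run.set hN rfl (by omega) (by simp) ?_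
        simp [e, h']
      · simp at h'
        refine Run.skip ?_
        simp [e, h']

end TCAM

namespace TCAM
open TCAM.Expr TCAM.Stmt

variable {B : ℕ}

/-! ### Optimal partitions below upper bounds -/

section RoundDown
variable {k : ℕ} {W l n : ℕ} {u Q : Fin k → ℕ} {E : Finset (Fin k)}

theorem isPartition_round_down (hl : l ≤ W) (hE : ∀ i ∈ E, u i / 2 ^ l % 2 = 1)
    (hEc : 2 ^ (W - l) + E.card = ∑ i, u i / 2 ^ l) :
    IsPartition W fun i => (u i / 2 ^ l - if i ∈ E then 1 else 0) * 2 ^ l := by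
  have h : ∑ i, (u i / 2 ^ l - if i ∈ E then 1 else 0) + E.card = ∑ i, u i / 2 ^ l := by
    rw [show E.card = ∑ i, if i ∈ E then 1 else 0 by simp, ← Finset.sum_add_distrib]
    refine Finset.sum_congr rfl fun i _ => ?_
    by_cases hi : i ∈ E
    · have := hE i hi
      simp only [hi, if_true]
      generalize u i / 2 ^ l = c at *
      omega
    · simp [hi]
  rw [IsPartition, ← Finset.sum_mul, show ∑ i, (u i / 2 ^ l - if i ∈ E then 1 else 0) = 2 ^ (W - l)
    by omega, ← pow_add]
  congr 1; omega

theorem round_down_le (i : Fin k) : (u i / 2 ^ l - if i ∈ E then 1 else 0) * 2 ^ l ≤ u i :=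
  (Nat.mul_le_mul_right _ (Nat.sub_le _ _)).trans (Nat.div_mul_le_self _ _)

/-- `Zeroes.round_down` in terms of partitions. The outside entry is a multiple of `2 ^ (l + 1)`, as
`l < W`; it is never odd and rounding does not change it. -/
theorem Zeroes.ext_round_down {B : ℕ} (hl : l < W) (hQ : ∀ i, Q i ≤ u i)
    (hz : Zeroes n (ext W Q)) (hlt : ∑ i, u i / 2 ^ (l + 1) < 2 ^ (W - (l + 1)))
    (hE : ∀ i ∈ E, u i / 2 ^ l % 2 = 1) (hEc : 2 ^ (W - l) + E.card = ∑ i, u i / 2 ^ l)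
    (hu : ∀ i, u i < 2 ^ B)
    (hmin : ∀ i ∈ E, ∀ j, u j / 2 ^ l % 2 = 1 → j ∉ E →
      brev B (u i / 2 ^ l) ≤ brev B (u j / 2 ^ l)) :
    Zeroes n (ext W fun i => (u i / 2 ^ l - if i ∈ E then 1 else 0) * 2 ^ l) := by
  have hpow : ∀ l ≤ W, (-2 ^ W : ℤ) / 2 ^ l = -2 ^ (W - l) := fun l hl => by
    rw [show (-2 ^ W : ℤ) = -2 ^ (W - l) * 2 ^ l by
      rw [neg_mul, ← pow_add]; congr 2; omega]
    exact Int.mul_ediv_cancel _ (by positivity)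
  have hsome : ∀ (l : ℕ) i, ext W u (some i) / 2 ^ l = ((u i / 2 ^ l : ℕ) : ℤ) := by simp
  have hodd : ∀ i, ext W u (some i) / 2 ^ l % 2 = 1 ↔ u i / 2 ^ l % 2 = 1 := fun i => by
    rw [hsome]; omega
  have hnone : ext W u none / 2 ^ l % 2 = 0 := by
    rw [ext_none, hpow l hl.le, show W - l = (W - l - 1) + 1 by omega, pow_succ]; omega
  have hcard : ∀ l, (∑ m, ext W u m / 2 ^ l) = ext W u none / 2 ^ l + (∑ i, u i / 2 ^ l : ℕ) :=
    fun l => by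
      rw [Fintype.sum_option]
      simp only [hsome]
      push_cast
      rfl
  have key := Zeroes.round_down (n := n) (l := l) (Q := ext W Q) (u := ext W u)
    (O := Finset.univ.filter fun m => ext W u m / 2 ^ l % 2 = 1) (E := E.map .some)
    (by
      intro m
      cases m with
      | none => exact le_rfl
      | some i => rw [ext_some, ext_some]; exact_mod_cast hQ i) hz
    (by
      rw [hcard, ext_none, hpow _ (by omega)]
      have : ((∑ i, u i / 2 ^ (l + 1) : ℕ) : ℤ) < 2 ^ (W - (l + 1)) := by exact_mod_cast hlt
      omega)
    (by simp)
    (by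
      intro m hm
      obtain ⟨i, hi, rfl⟩ := Finset.mem_map.1 hm
      simpa using (hodd i).2 (hE i hi))
    (by
      rw [hcard, ext_none, hpow _ (by omega), Finset.card_map, ← hEc]
      push_cast; ring)
    -- The value at `none` is irrelevant, since the outside entry is not odd at level `l`.
    (fun m => match m with | none => 0 | some i => brev B (u i / 2 ^ l))
    (by
      intro i hi j hj hij
      simp only [Finset.mem_filter, Finset.mem_univ, true_and] at hi hj
      cases i with
      | none => omega
      | some i =>
        cases j with
        | none => omega
        | some j =>
          rw [hsome] at hi ⊢
          rw [hsome] at hj ⊢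
          -- The keys belong to the quotients by `2 ^ l`, which are both odd; dropping the common
          -- lowest digit keeps the order.
          refine (RLe.of_brev ?_ ?_ hij).half (by omega)
          · exact lt_of_le_of_lt (Nat.div_le_self _ _) (hu i)
          · exact lt_of_le_of_lt (Nat.div_le_self _ _) (hu j))
    (by
      intro m hm j hj hjE
      obtain ⟨i, hi, rfl⟩ := Finset.mem_map.1 hm
      simp only [Finset.mem_filter, Finset.mem_univ, true_and] at hj
      cases j with
      | none => omega
      | some j => exact hmin i hi j ((hodd j).1 hj) fun h => hjE (Finset.mem_map_of_mem _ h))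
  convert key using 1
  funext m
  cases m with
  | none =>
    simp only [ext_none, hpow l hl.le, ind]
    simp
    rw [← pow_add]; congr 1; omega
  | some i =>
    rw [hsome, ext_some]
    simp only [ind, Finset.mem_map]
    by_cases hi : i ∈ E
    · have := hE i hi
      have h1 : 1 ≤ u i / 2 ^ l := by generalize u i / 2 ^ l = c at *; omega
      simp [hi]
      rw [Nat.cast_sub h1]
      push_cast; ring
    · simp [hi]; ring

theorem zeroes_single (W : ℕ) (j : Fin k) :
    Zeroes 1 (ext W fun i => if i = j then 2 ^ W else 0) := by
  refine .step (some j) none W ?_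
  have : (ext W fun i => if i = j then 2 ^ W else 0) + (2 : ℤ) ^ W • move (some j) none = 0 := by
    funext m
    cases m with
    | none => simp [move_apply]
    | some i => by_cases h : i = j <;> simp [move_apply, h]
  rw [this]
  exact .zero 0

theorem isPartition_single (W : ℕ) (j : Fin k) : IsPartition W fun i => if i = j then 2 ^ W else 0 := by
  simp [IsPartition]

/-- A single target with all the weight has the least complexity possible: one transaction suffices,
and none is never enough since the outside entry is not zero. -/
theorem Zeroes.ext_single (hz : Zeroes n (ext W Q)) (j : Fin k) :
    Zeroes n (ext W fun i => if i = j then 2 ^ W else 0) :=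
  (zeroes_single W j).mono (hz.one_le fun h => by simpa using congrFun h none)

end RoundDown

/-! ### Upper bounds and sums -/

/-- The weight of entry `r43`. -/
def weightE : OneSidedDistance → Expr
  | .absolute => lit 1
  | .relative => load (reg 43)

theorem eval_weightE (D : OneSidedDistance) (s : St) :
    (weightE D).eval s = D.weight (s.m (s.r 43)) := by cases D <;> rfl

theorem ok_weightE (D : OneSidedDistance) (s : St) (N : ℕ) : (weightE D).Ok N s := by
  cases D <;> simp [weightE]

/-- The upper bounds for distance less than `r2 / r3`, from address `r1 = k` on. -/
def upperS (D : OneSidedDistance) : Stmt := block [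
  set 43 (lit 0),
  loop (reg 43) (reg 1) (block [
    store (reg 1 + reg 43) (load (reg 43) + (reg 2 * weightE D - lit 1) / reg 3),
    set 43 (reg 43 + lit 1)])]

theorem run_upperS (hN : WordBound (2 ^ B)) (D : OneSidedDistance) {s : St} {T : ℕ}
    (hB : 2 * s.r 1 < 2 ^ B) (hm : ∀ j < s.r 1, s.m j + s.r 2 * D.weight (s.m j) < 2 ^ B)
    (hT : 3 * s.r 1 + 2 ≤ T) : Run (2 ^ B) (upperS D) s T fun s' =>
      (∀ j < s.r 1, s'.m j = s.m j) ∧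
      ∀ j < s.r 1, s'.m (s.r 1 + j) = D.upper (s.r 2) (s.r 3) (s.m j) := by
  refine Run.set_seq hN rfl (by omega) (by simp) ?_
  refine Run.for_loop (fun j s' => s'.r 43 = j ∧ j ≤ s.r 1 ∧
      (∀ x < s.r 1, s'.m x = s.m x) ∧
      ∀ x < j, s'.m (s.r 1 + x) = D.upper (s.r 2) (s.r 3) (s.m x)) (s.r 1) 2 ?_ (by omega) ?_ ?_ ?_
  · simp
  · rintro j s' hs' hf ⟨h1, h2, h3, h4⟩
    have e1 : s'.r 1 = s.r 1 := by simpa using hf 1 (by simp [Stmt.writes, Stmt.block])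
    simp [h1, e1]
  · rintro j s' hs' hf hj ⟨h1, h2, h3, h4⟩
    have e1 : s'.r 1 = s.r 1 := by simpa using hf 1 (by simp [Stmt.writes, Stmt.block])
    have e2 : s'.r 2 = s.r 2 := by simpa using hf 2 (by simp [Stmt.writes, Stmt.block])
    have e3 : s'.r 3 = s.r 3 := by simpa using hf 3 (by simp [Stmt.writes, Stmt.block])
    have hmj := hm j hj
    have hle : (s.r 2 * D.weight (s.m j) - 1) / s.r 3 ≤ s.r 2 * D.weight (s.m j) :=
      (Nat.div_le_self _ _).trans (Nat.sub_le _ _)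
    refine Run.store_seq hN (by cases D <;> rfl) (by omega) (by simp [h1, e1]; omega) (by
      simp [h1, e1, e2, e3, eval_weightE, ok_weightE, h3 j hj]; omega) ?_
    refine Run.set hN rfl (by omega) (by simp; omega) ?_
    simp [h1, e1, e2, e3, eval_weightE]
    refine ⟨by omega, fun x hx => ?_, fun x hx => ?_⟩
    · rw [St.put_m, if_neg (by omega), h3 x hx]
    · rw [St.put_m]
      split_ifs with hxj
      · obtain rfl : x = j := by omega
        rw [h3 x hj]; rfl
      · exact h4 x (by omega)
  · rintro s' hs' hf ⟨h1, h2, h3, h4⟩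
    exact ⟨h3, h4⟩

/-- Register `46` gets the sum of the upper bounds shifted by `r45`. -/
def sumS : Stmt := block [
  set 46 (lit 0), set 43 (lit 0),
  loop (reg 43) (reg 1) (block [
    set 46 (reg 46 + load (reg 1 + reg 43) >>> reg 45), set 43 (reg 43 + lit 1)])]

theorem run_sumS (hN : WordBound (2 ^ B)) {s : St} {T : ℕ} (hB : 2 * s.r 1 < 2 ^ B)
    (hm : ∑ j ∈ Finset.range (s.r 1), s.m (s.r 1 + j) < 2 ^ B) (hT : 3 * s.r 1 + 3 ≤ T) :
    Run (2 ^ B) sumS s T fun s' => s'.m = s.m ∧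
      s'.r 46 = ∑ j ∈ Finset.range (s.r 1), s.m (s.r 1 + j) / 2 ^ s.r 45 := by
  refine Run.set_seq hN rfl (by omega) (by simp) ?_
  refine Run.set_seq hN rfl (by omega) (by simp) ?_
  refine Run.for_loop (fun j s' => s'.m = s.m ∧ s'.r 43 = j ∧ j ≤ s.r 1 ∧
      s'.r 46 = ∑ j ∈ Finset.range j, s.m (s.r 1 + j) / 2 ^ s.r 45) (s.r 1) 2 ?_ (by omega) ?_ ?_ ?_
  · simp
  · rintro j s' hs' hf ⟨h1, h2, h3, h4⟩
    have e1 : s'.r 1 = s.r 1 := by simpa using hf 1 (by decide)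
    simp [h2, e1]
  · rintro j s' hs' hf hj ⟨h1, h2, h3, h4⟩
    have e1 : s'.r 1 = s.r 1 := by simpa using hf 1 (by decide)
    have e45 : s'.r 45 = s.r 45 := by simpa using hf 45 (by decide)
    have hle : ∑ i ∈ Finset.range (j + 1), s.m (s.r 1 + i) / 2 ^ s.r 45 < 2 ^ B :=
      lt_of_le_of_lt ((Finset.sum_le_sum fun i _ => Nat.div_le_self _ _).trans
        (Finset.sum_le_sum_of_subset (Finset.range_mono hj))) hm
    rw [Finset.sum_range_succ] at hle
    refine Run.set_seq hN rfl (by omega) (by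
      simp [h1, h2, h4, e1, e45, Nat.shiftRight_eq_div_pow]; omega) ?_
    refine Run.set hN rfl (by omega) (by simp; omega) ?_
    simp [h1, h2, h4, e1, e45, Nat.shiftRight_eq_div_pow, Finset.sum_range_succ]
    omega
  · rintro s' hs' hf ⟨h1, h2, h3, h4⟩
    exact ⟨h1, h4⟩

/-! ### The largest level -/

/-- Register `8` gets the largest level at which the upper bounds leave room. -/
def levelS : Stmt := block [
  set 8 (lit 0), set 44 (lit 1 <<< msb (reg 0)),
  loop (lit 0) (reg 44) (block [
    set 45 (reg 8 + reg 44),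
    ite (reg 0) (reg 45) skip
      (block [sumS, ite (reg 46) (lit 1 <<< (reg 0 - reg 45)) skip (set 8 (reg 45))]),
    set 44 (reg 44 >>> lit 1)])]

/-- Multiples of `2 ^ l'` are also multiples of `2 ^ l`, so room at a level implies room at all
lower ones. This justifies binary search for the level. -/
theorem sum_div_mono {k W : ℕ} {u : ℕ → ℕ} {l l' : ℕ} (hl : l ≤ l') (hW : l' ≤ W)
    (h : 2 ^ (W - l') ≤ ∑ j ∈ Finset.range k, u j / 2 ^ l') :
    2 ^ (W - l) ≤ ∑ j ∈ Finset.range k, u j / 2 ^ l := by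
  obtain ⟨d, rfl⟩ := Nat.exists_eq_add_of_le hl
  calc 2 ^ (W - l) = 2 ^ (W - (l + d)) * 2 ^ d := by rw [← pow_add]; congr 1; omega
    _ ≤ (∑ j ∈ Finset.range k, u j / 2 ^ (l + d)) * 2 ^ d := Nat.mul_le_mul_right _ h
    _ = ∑ j ∈ Finset.range k, u j / 2 ^ l / 2 ^ d * 2 ^ d := by
      rw [Finset.sum_mul]; simp only [pow_add, Nat.div_div_eq_div_mul]
    _ ≤ _ := Finset.sum_le_sum fun j _ => Nat.div_mul_le_self _ _

theorem run_levelS (hN : WordBound (2 ^ B)) {s : St} {T : ℕ} (hW : 1 ≤ s.r 0)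
    (hWB : s.r 0 < B) (hB : 2 * s.r 1 < 2 ^ B)
    (hm : ∑ j ∈ Finset.range (s.r 1), s.m (s.r 1 + j) < 2 ^ B)
    (h0 : 2 ^ s.r 0 ≤ ∑ j ∈ Finset.range (s.r 1), s.m (s.r 1 + j))
    (hT : (Nat.log2 (s.r 0) + 1) * (3 * s.r 1 + 9) + 4 ≤ T) :
    Run (2 ^ B) levelS s T fun s' => s'.m = s.m ∧ s'.r 8 ≤ s.r 0 ∧
      2 ^ (s.r 0 - s'.r 8) ≤ ∑ j ∈ Finset.range (s.r 1), s.m (s.r 1 + j) / 2 ^ s'.r 8 ∧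
      (s'.r 8 < s.r 0 →
        ∑ j ∈ Finset.range (s.r 1), s.m (s.r 1 + j) / 2 ^ (s'.r 8 + 1) <
          2 ^ (s.r 0 - (s'.r 8 + 1))) := by
  have hlog : 2 ^ Nat.log2 (s.r 0) ≤ s.r 0 := Nat.log2_self_le (by omega)
  have hlog' : s.r 0 < 2 ^ (Nat.log2 (s.r 0) + 1) := Nat.lt_log2_self
  have hB0 : s.r 0 < 2 ^ s.r 0 := Nat.lt_two_pow_self
  have hB1 : 2 ^ s.r 0 * 2 ≤ 2 ^ B := by
    rw [← pow_succ]; exact Nat.pow_le_pow_right (by norm_num) hWB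
  refine Run.set_seq hN rfl (by omega) (by simp) ?_
  refine Run.set_seq hN rfl (by omega) (by simp [Nat.shiftLeft_eq]; omega) ?_
  set R := Nat.log2 (s.r 0) + 1 with hR
  -- Binary search one digit at a time: there is room at level `r8`, and none from level `r8 + 2 ^
  -- (R - j)` on. The step `2 ^ (R - j) / 2` becomes `0` after `R` rounds, and this ends the loop.
  refine Run.for_loop (fun j s' => s'.m = s.m ∧ j ≤ R ∧ s'.r 44 = 2 ^ (R - j) / 2 ∧
      s'.r 8 ≤ s.r 0 ∧
      2 ^ (s.r 0 - s'.r 8) ≤ ∑ j ∈ Finset.range (s.r 1), s.m (s.r 1 + j) / 2 ^ s'.r 8 ∧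
      ∀ l', s'.r 8 + 2 ^ (R - j) ≤ l' → l' ≤ s.r 0 →
        ∑ j ∈ Finset.range (s.r 1), s.m (s.r 1 + j) / 2 ^ l' < 2 ^ (s.r 0 - l'))
      R (3 * s.r 1 + 8) ?_ (by rw [show 3 * s.r 1 + 8 + 1 = 3 * s.r 1 + 9 by ring]; omega) ?_ ?_ ?_
  · simp [hR, Nat.shiftLeft_eq, pow_succ, h0]
    intro l' h1 h2
    rw [hR, pow_succ] at hlog'
    omega
  · rintro j s' hs' hf ⟨h1, h2, h3, h4, h5, h6⟩
    refine ⟨by simp, by simp, ?_⟩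
    simp only [eval_lit, eval_reg, h3]
    rcases Nat.eq_zero_or_pos (R - j) with h | h
    · simp [h]; omega
    · obtain ⟨d, hd⟩ := Nat.exists_eq_add_of_le h
      rw [hd, add_comm 1 d, pow_succ, Nat.mul_div_cancel _ (by norm_num)]
      have : 0 < 2 ^ d := by positivity
      omega
  · rintro j s' hs' hf hj ⟨h1, h2, h3, h4, h5, h6⟩
    obtain ⟨d, hd⟩ := Nat.exists_eq_add_of_le (show 1 ≤ R - j by omega)
    have hd1 : R - (j + 1) = d := by omega
    rw [hd, add_comm 1 d, pow_succ, Nat.mul_div_cancel _ (by norm_num)] at h3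
    rw [hd, add_comm 1 d, pow_succ] at h6
    have e0 : s'.r 0 = s.r 0 := by simpa using hf 0 (by decide)
    have e1 : s'.r 1 = s.r 1 := by simpa using hf 1 (by decide)
    have hdle : 2 ^ d ≤ s.r 0 := le_trans (Nat.pow_le_pow_right (by norm_num) (by omega)) hlog
    refine Run.set_seq hN rfl (by omega) (by simp; omega) ?_
    refine Run.seq (T₁ := 3 * s.r 1 + 6) (Q := fun t => t.m = s.m ∧ t.r 44 = 2 ^ d ∧
      t.r 8 ≤ s.r 0 ∧
      2 ^ (s.r 0 - t.r 8) ≤ ∑ j ∈ Finset.range (s.r 1), s.m (s.r 1 + j) / 2 ^ t.r 8 ∧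
      ∀ l', t.r 8 + 2 ^ d ≤ l' → l' ≤ s.r 0 →
        ∑ j ∈ Finset.range (s.r 1), s.m (s.r 1 + j) / 2 ^ l' < 2 ^ (s.r 0 - l')) ?_ (by omega) ?_
    · refine Run.ite (by omega) (by simp) (by simp) (fun h => ?_) fun h => ?_
      · simp [e0, h3] at h
        exact Run.skip (by simpa [h1, h3, h4, h5] using fun l' _ _ => by omega)
      · simp [e0, h3] at h
        refine Run.seq (run_sumS hN (by simpa [e1] using hB) (by simpa [e1, h1] using hm)
          (T := 3 * s.r 1 + 3) (by simp [e1])) (by omega) ?_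
        rintro s₂ hs₂ hf₂ ⟨f1, f2⟩
        simp [h1, e1, h3] at f1 f2
        have g0 : s₂.r 0 = s.r 0 := by simpa [e0] using hf₂ 0 (by decide)
        have g8 : s₂.r 8 = s'.r 8 := by simpa using hf₂ 8 (by decide)
        have g44 : s₂.r 44 = 2 ^ d := by simpa [h3] using hf₂ 44 (by decide)
        have g45 : s₂.r 45 = s'.r 8 + 2 ^ d := by simpa [h3] using hf₂ 45 (by decide)
        have hpw : 2 ^ (s.r 0 - (s'.r 8 + 2 ^ d)) ≤ 2 ^ s.r 0 :=
          Nat.pow_le_pow_right (by norm_num) (by omega)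
        refine Run.ite (by omega) (by simp)
          (by simp [g0, g45, Nat.shiftLeft_eq]; omega) (fun h' => ?_) fun h' => ?_
        · simp [f2, g0, g45, Nat.shiftLeft_eq] at h'
          refine Run.skip ⟨f1, g44, by omega, by rwa [g8], fun l' hl1 hl2 => ?_⟩
          rw [g8] at hl1
          by_contra hc
          exact absurd (sum_div_mono hl1 hl2 (not_lt.1 hc)) (not_le.2 h')
        · simp [f2, g0, g45, Nat.shiftLeft_eq] at h'
          refine Run.set hN rfl (by omega) (by simp) ?_
          simp [f1, g44, g45]
          refine ⟨h, h', fun l' hl1 hl2 => h6 l' ?_ hl2⟩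
          omega
    · rintro t ht - ⟨f1, f2, f3, f4, f5⟩
      refine Run.set hN rfl (by omega) (by simp) ?_
      simp [hd1, f1, f2, Nat.shiftRight_eq_div_pow]
      exact ⟨by omega, f3, f4, f5⟩
  · rintro s' hs' hf ⟨h1, h2, h3, h4, h5, h6⟩
    exact ⟨h1, h4, h5, fun h => h6 _ (by simp) h⟩

end TCAM

namespace TCAM
open TCAM.Expr TCAM.Stmt

variable {B : ℕ}

/-! ### Construction of an optimal partition below upper bounds -/

/-- Writes `2 ^ W` to one entry whose upper bound admits it, and zero to the others. -/
def singleS : Stmt := block [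
  set 43 (lit 0), set 47 (lit 0),
  loop (reg 43) (reg 1) (block [
    set 48 (lit 0),
    ite (lit 0) (load (reg 1 + reg 43) >>> reg 0)
      (ite (lit 0) (reg 47) skip (block [set 48 (lit 1 <<< reg 0), set 47 (lit 1)])) skip,
    store (lit 2 * reg 1 + reg 43) (reg 48), set 43 (reg 43 + lit 1)])]

theorem run_singleS (hN : WordBound (2 ^ B)) {s : St} {T : ℕ} (hWB : s.r 0 < B)
    (hB : 3 * s.r 1 < 2 ^ B)
    (h0 : ∃ j < s.r 1, 2 ^ s.r 0 ≤ s.m (s.r 1 + j)) (hT : 8 * s.r 1 + 5 ≤ T) :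
    Run (2 ^ B) singleS s T fun s' => (∀ x < 2 * s.r 1, s'.m x = s.m x) ∧
      ∃ j < s.r 1, 2 ^ s.r 0 ≤ s.m (s.r 1 + j) ∧
        ∀ i < s.r 1, s'.m (2 * s.r 1 + i) = if i = j then 2 ^ s.r 0 else 0 := by
  have hp : 2 ^ s.r 0 < 2 ^ B := Nat.pow_lt_pow_right (by norm_num) hWB
  refine Run.set_seq hN rfl (by omega) (by simp) ?_
  refine Run.set_seq hN rfl (by omega) (by simp) ?_
  refine Run.for_loop (fun p s' => p ≤ s.r 1 ∧ s'.r 43 = p ∧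
      (∀ x < 2 * s.r 1, s'.m x = s.m x) ∧
      ((s'.r 47 = 0 ∧ (∀ j < p, ¬ 2 ^ s.r 0 ≤ s.m (s.r 1 + j)) ∧
        ∀ i < p, s'.m (2 * s.r 1 + i) = 0) ∨
      (s'.r 47 = 1 ∧ ∃ j < p, 2 ^ s.r 0 ≤ s.m (s.r 1 + j) ∧
        ∀ i < p, s'.m (2 * s.r 1 + i) = if i = j then 2 ^ s.r 0 else 0)))
    (s.r 1) 7 ?_ (by omega) ?_ ?_ ?_
  · simp
  · rintro p s' hs' hf ⟨h1, h2, h3, h4⟩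
    have e1 : s'.r 1 = s.r 1 := by simpa using hf 1 (by decide)
    simp [h2, e1]
  · rintro p s' hs' hf hp ⟨h1, h2, h3, h4⟩
    have e0 : s'.r 0 = s.r 0 := by simpa using hf 0 (by decide)
    have e1 : s'.r 1 = s.r 1 := by simpa using hf 1 (by decide)
    have hsh : 0 < s.m (s.r 1 + p) >>> s.r 0 ↔ 2 ^ s.r 0 ≤ s.m (s.r 1 + p) := by
      rw [Nat.shiftRight_eq_div_pow, Nat.div_pos_iff]
      have : 0 < 2 ^ s.r 0 := by positivity
      simp
    refine Run.set_seq hN rfl (by omega) (by simp) ?_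
    refine Run.seq (T₁ := 4) (Q := fun t => t.r 43 = p ∧ (∀ x < 2 * s.r 1, t.m x = s.m x) ∧
      ((t.r 47 = 0 ∧ t.r 48 = 0 ∧ (∀ j < p + 1, ¬ 2 ^ s.r 0 ≤ s.m (s.r 1 + j)) ∧
        ∀ i < p, t.m (2 * s.r 1 + i) = 0) ∨
      (t.r 47 = 1 ∧ t.r 48 = 2 ^ s.r 0 ∧ 2 ^ s.r 0 ≤ s.m (s.r 1 + p) ∧
        ∀ i < p, t.m (2 * s.r 1 + i) = 0) ∨
      (t.r 47 = 1 ∧ t.r 48 = 0 ∧ ∃ j < p, 2 ^ s.r 0 ≤ s.m (s.r 1 + j) ∧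
        ∀ i < p, t.m (2 * s.r 1 + i) = if i = j then 2 ^ s.r 0 else 0))) ?_ (by omega) ?_
    · refine Run.ite (by omega) (by simp) (by simp [h2, e1]; omega) (fun h => ?_) fun h => ?_
      · simp [h2, e1, e0, h3 (s.r 1 + p) (by omega)] at h
        rw [hsh] at h
        refine Run.ite (by omega) (by simp) (by simp) (fun h' => ?_) fun h' => ?_
        · simp at h'
          refine Run.skip ?_
          rcases h4 with h4 | h4
          · omega
          · simpa [h2, h4.1] using ⟨h3, .inr h4.2⟩
        · simp at h'
          refine Run.set_seq hN rfl (by omega) (by simp [e0, Nat.shiftLeft_eq]; omega) ?_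
          refine Run.set hN rfl (by omega) (by simp) ?_
          rcases h4 with h4 | h4
          · simp [h2, e0, Nat.shiftLeft_eq]
            exact ⟨h3, h, h4.2.2⟩
          · omega
      · simp [h2, e1, e0, h3 (s.r 1 + p) (by omega)] at h
        have h' : ¬ 2 ^ s.r 0 ≤ s.m (s.r 1 + p) := fun hh => by
          have := hsh.2 hh; omega
        refine Run.skip ?_
        rcases h4 with ⟨h4, h5, h6⟩ | h4
        · simp only [St.set_r, St.set_m]
          refine ⟨by simpa using h2, h3, .inl ⟨by simpa using h4, by simp, fun j hj => ?_, h6⟩⟩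
          rcases Nat.lt_succ_iff_lt_or_eq.1 hj with hj | rfl
          · exact h5 j hj
          · exact h'
        · simpa [h2, h4.1] using ⟨h3, .inr h4.2⟩
    · rintro t ht hft ⟨f1, f2, f3⟩
      have g1 : t.r 1 = s.r 1 := by simpa [e1] using hft 1 (by decide)
      refine Run.store_seq hN rfl (by omega) (by simp [f1, g1]; have := hN.lit; omega) (by simp) ?_
      refine Run.set hN rfl (by omega) (by simp; omega) ?_
      simp [f1, g1]
      refine ⟨by omega, fun x hx => ?_, ?_⟩
      · rw [St.put_m, if_neg (by omega), f2 x hx]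
      · rcases f3 with ⟨c1, c2, c3, c4⟩ | ⟨c1, c2, c3, c4⟩ | ⟨c1, c2, j, hj, c3, c4⟩
        · refine .inl ⟨c1, fun j hj => not_le.1 (c3 j (by omega)), fun i hi => ?_⟩
          rw [St.put_m]; split_ifs with hh
          · exact c2
          · exact c4 i (by omega)
        · refine .inr ⟨c1, p, by omega, c3, fun i hi => ?_⟩
          rw [St.put_m]; split_ifs with hh hh' hh'
          · exact c2
          · omega
          · omega
          · exact c4 i (by omega)
        · refine .inr ⟨c1, j, by omega, c3, fun i hi => ?_⟩
          rw [St.put_m]; split_ifs with hh hh' hh'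
          · omega
          · exact c2
          · rw [c4 i (by omega), if_pos hh']
          · rw [c4 i (by omega), if_neg hh']
  · rintro s' hs' hf ⟨h1, h2, h3, h4⟩
    refine ⟨h3, ?_⟩
    rcases h4 with ⟨h4, h5, h6⟩ | ⟨h4, h5⟩
    · obtain ⟨j, hj, h⟩ := h0
      exact absurd h (h5 j hj)
    · exact h5

/-- The first workspace address. -/
def workE : Expr := lit 4 * reg 1 + reg 0 + lit 1

/-- The odd ones among the first `n` bounds, shifted by `l`. -/
def oddList (u : ℕ → ℕ) (l n : ℕ) : List ℕ := (List.range n).filter fun i => u i / 2 ^ l % 2 = 1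

theorem oddList_succ (u : ℕ → ℕ) (l n : ℕ) : oddList u l (n + 1) =
    oddList u l n ++ if u n / 2 ^ l % 2 = 1 then [n] else [] := by
  rw [oddList, oddList, List.range_succ, List.filter_append, List.filter_cons]
  simp

theorem mem_oddList {u : ℕ → ℕ} {l n i : ℕ} : i ∈ oddList u l n ↔ i < n ∧ u i / 2 ^ l % 2 = 1 := by
  simp [oddList]

theorem length_oddList_le (u : ℕ → ℕ) (l n : ℕ) : (oddList u l n).length ≤ n :=
  (List.length_filter_le _ _).trans (by simp)

/-- The odd shifted bounds go to the workspace; register `46` gets the sum of all of them. -/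
def gatherS : Stmt := block [
  set 36 workE, set 37 (reg 36), set 46 (lit 0), set 43 (lit 0),
  loop (reg 43) (reg 1) (block [
    set 26 (load (reg 1 + reg 43) >>> reg 8), set 46 (reg 46 + reg 26),
    ite (lit 0) (reg 26 % lit 2)
      (block [store (reg 37) (reg 26), set 37 (reg 37 + lit 1)]) skip,
    set 43 (reg 43 + lit 1)])]

theorem run_gatherS (hN : WordBound (2 ^ B)) {s : St} {T : ℕ} {u : ℕ → ℕ}
    (hu : ∀ j, u j = s.m (s.r 1 + j))
    (hB : 5 * s.r 1 + s.r 0 + 1 < 2 ^ B)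
    (hm : ∑ j ∈ Finset.range (s.r 1), u j < 2 ^ B) (hT : 7 * s.r 1 + 5 ≤ T) :
    Run (2 ^ B) gatherS s T fun s' => s'.r 36 = 4 * s.r 1 + s.r 0 + 1 ∧
      s'.r 37 = s'.r 36 + (oddList u (s.r 8) (s.r 1)).length ∧
      s'.r 46 = ∑ j ∈ Finset.range (s.r 1), u j / 2 ^ s.r 8 ∧
      seg s'.m (s'.r 36) (oddList u (s.r 8) (s.r 1)).length =
        (oddList u (s.r 8) (s.r 1)).map (fun i => u i / 2 ^ s.r 8) ∧
      ∀ x < s'.r 36, s'.m x = s.m x := by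
  have hlit := hN.lit
  refine Run.set_seq hN rfl (by omega) (by simp [workE]; omega) ?_
  refine Run.set_seq hN rfl (by omega) (by simp) ?_
  refine Run.set_seq hN rfl (by omega) (by simp) ?_
  refine Run.set_seq hN rfl (by omega) (by simp) ?_
  set b := 4 * s.r 1 + s.r 0 + 1 with hb
  refine Run.for_loop (fun j s' => j ≤ s.r 1 ∧ s'.r 43 = j ∧ s'.r 36 = b ∧
      s'.r 37 = b + (oddList u (s.r 8) j).length ∧
      s'.r 46 = ∑ j ∈ Finset.range j, u j / 2 ^ s.r 8 ∧
      seg s'.m b (oddList u (s.r 8) j).length =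
        (oddList u (s.r 8) j).map (fun i => u i / 2 ^ s.r 8) ∧
      ∀ x < b, s'.m x = s.m x) (s.r 1) 6 ?_ (by omega) ?_ ?_ ?_
  · simp [workE, oddList, hb]
  · rintro j s' hs' hf ⟨h1, h2, h3, h4, h5, h6, h7⟩
    have e1 : s'.r 1 = s.r 1 := by simpa using hf 1 (by decide)
    simp [h2, e1]
  · rintro j s' hs' hf hj ⟨h1, h2, h3, h4, h5, h6, h7⟩
    have e1 : s'.r 1 = s.r 1 := by simpa using hf 1 (by decide)
    have e8 : s'.r 8 = s.r 8 := by simpa using hf 8 (by decide)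
    have hle : ∑ i ∈ Finset.range (j + 1), u i / 2 ^ s.r 8 < 2 ^ B :=
      lt_of_le_of_lt ((Finset.sum_le_sum fun i _ => Nat.div_le_self _ _).trans
        (Finset.sum_le_sum_of_subset (Finset.range_mono hj))) hm
    rw [Finset.sum_range_succ] at hle
    have hval : s'.m (s.r 1 + j) >>> s.r 8 = u j / 2 ^ s.r 8 := by
      rw [h7 _ (by omega), hu, Nat.shiftRight_eq_div_pow]
    have hlen := length_oddList_le u (s.r 8) j
    refine Run.set_seq hN rfl (by omega) (by simp [h2, e1]; omega) ?_
    refine Run.set_seq hN rfl (by omega) (by simp [h2, e1, e8, hval, h5]; omega) ?_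
    refine Run.seq (T₁ := 3) (Q := fun t => t.r 43 = j ∧ t.r 36 = b ∧
      t.r 37 = b + (oddList u (s.r 8) (j + 1)).length ∧
      t.r 46 = ∑ j ∈ Finset.range (j + 1), u j / 2 ^ s.r 8 ∧
      seg t.m b (oddList u (s.r 8) (j + 1)).length =
        (oddList u (s.r 8) (j + 1)).map (fun i => u i / 2 ^ s.r 8) ∧
      ∀ x < b, t.m x = s.m x) ?_ (by omega) ?_
    · refine Run.ite (by omega) (by simp) (by simp) (fun h => ?_) fun h => ?_
      · simp [h2, e1, e8, hval] at h
        have h' : u j / 2 ^ s.r 8 % 2 = 1 := by omega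
        refine Run.store_seq hN rfl (by omega) (by simp) (by simp) ?_
        refine Run.set hN rfl (by omega) (by simp [h4]; omega) ?_
        simp [h2, h3, h4, h5, e1, e8, hval, oddList_succ, h', Finset.sum_range_succ]
        refine ⟨by omega, ?_, fun x hx => ?_⟩
        · rw [seg_succ, ← h6]
          simp [St.put_m]
          exact seg_congr fun x _ hx => by rw [St.put_m, if_neg (by omega)]; rfl
        · rw [St.put_m, if_neg (by omega)]; exact h7 x hx
      · simp [h2, e1, e8, hval] at h
        refine Run.skip ?_
        have h' : ¬ u j / 2 ^ s.r 8 % 2 = 1 := by omega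
        simp [h2, h3, h4, h5, e1, e8, hval, oddList_succ, h', Finset.sum_range_succ]
        exact ⟨h6, h7⟩
    · rintro t ht - ⟨f1, f2, f3, f4, f5, f6⟩
      refine Run.set hN rfl (by omega) (by simp; omega) ?_
      simp [f1, f2, f3, f4]
      exact ⟨by omega, f5, f6⟩
  · rintro s' hs' hf ⟨h1, h2, h3, h4, h5, h6, h7⟩
    rw [h3]
    exact ⟨rfl, h4, h5, h6, h7⟩

/-- Writes the rounded bounds, where those selected by `splitS` are decreased. -/
def roundS : Stmt := block [
  set 43 (lit 0),
  loop (reg 43) (reg 1) (block [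
    set 26 (load (reg 1 + reg 43) >>> reg 8), set 42 (lit 0),
    ite (lit 0) (reg 26 % lit 2) decideS skip,
    store (lit 2 * reg 1 + reg 43) ((reg 26 - reg 42) <<< reg 8),
    set 43 (reg 43 + lit 1)])]

theorem run_roundS (hN : WordBound (2 ^ B)) {s : St} {T : ℕ} {u : ℕ → ℕ}
    (hu : ∀ j, u j = s.m (s.r 1 + j)) (hB : 3 * s.r 1 < 2 ^ B) (hT : 13 * s.r 1 + 2 ≤ T) :
    Run (2 ^ B) roundS s T fun s' => (∀ x < 2 * s.r 1, s'.m x = s.m x) ∧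
      ∀ i < s.r 1, s'.m (2 * s.r 1 + i) = (u i / 2 ^ s.r 8 - if i ∈
        downs (fun i => brev B (u i / 2 ^ s.r 8)) (brev B (s.r 22)) (s.r 39)
          (oddList u (s.r 8) (s.r 1)) then 1 else 0) * 2 ^ s.r 8 := by
  apply Run.of_bdd
  intro hbd
  have hlit := hN.lit
  refine Run.set_seq hN rfl (by omega) (by simp) ?_
  set key := fun i => brev B (u i / 2 ^ s.r 8) with hkey
  set t := brev B (s.r 22) with ht
  refine Run.for_loop (fun j s' => j ≤ s.r 1 ∧ s'.r 43 = j ∧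
      s'.r 39 = quota key t (s.r 39) (oddList u (s.r 8) j) ∧
      (∀ x < 2 * s.r 1, s'.m x = s.m x) ∧
      ∀ i < j, s'.m (2 * s.r 1 + i) = (u i / 2 ^ s.r 8 - if i ∈
        downs key t (s.r 39) (oddList u (s.r 8) j) then 1 else 0) * 2 ^ s.r 8)
    (s.r 1) 12 ?_ (by omega) ?_ ?_ ?_
  · simp [oddList, quota]
  · rintro j s' hs' hf ⟨h1, h2, h3, h4, h5⟩
    have e1 : s'.r 1 = s.r 1 := by simpa using hf 1 (by decide)
    simp [h2, e1]
  · rintro j s' hs' hf hj ⟨h1, h2, h3, h4, h5⟩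
    have e1 : s'.r 1 = s.r 1 := by simpa using hf 1 (by decide)
    have e8 : s'.r 8 = s.r 8 := by simpa using hf 8 (by decide)
    have e22 : s'.r 22 = s.r 22 := by simpa using hf 22 (by decide)
    have hval : s'.m (s.r 1 + j) >>> s.r 8 = u j / 2 ^ s.r 8 := by
      rw [h4 _ (by omega), hu, Nat.shiftRight_eq_div_pow]
    have huj : u j < 2 ^ B := by rw [hu]; exact hbd.2 _
    have hnot : j ∉ downs key t (s.r 39) (oddList u (s.r 8) j) := fun h => by
      have := (mem_oddList.1 ((downs_sublist _ _).subset h)).1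
      omega
    refine Run.set_seq hN rfl (by omega) (by simp [h2, e1]; omega) ?_
    refine Run.set_seq hN rfl (by omega) (by simp) ?_
    refine Run.seq (T₁ := 8) (Q := fun s' => s'.r 43 = j ∧ s'.r 1 = s.r 1 ∧ s'.r 8 = s.r 8 ∧
      s'.r 26 = u j / 2 ^ s.r 8 ∧
      s'.r 39 = quota key t (s.r 39) (oddList u (s.r 8) (j + 1)) ∧
      s'.r 42 = (if j ∈ downs key t (s.r 39) (oddList u (s.r 8) (j + 1)) then 1 else 0) ∧
      (∀ x < 2 * s.r 1, s'.m x = s.m x) ∧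
      ∀ i < j, s'.m (2 * s.r 1 + i) = (u i / 2 ^ s.r 8 - if i ∈
        downs key t (s.r 39) (oddList u (s.r 8) (j + 1)) then 1 else 0) * 2 ^ s.r 8)
      ?_ (by omega) ?_
    · refine Run.ite (by omega) (by simp) (by simp) (fun h => ?_) fun h => ?_
      · simp [h2, e1, e8, hval] at h
        have h' : u j / 2 ^ s.r 8 % 2 = 1 := by omega
        refine Run.conseq (run_decideS hN le_rfl) (by omega) ?_
        rintro s₂ hs₂ hf₂ ⟨d1, d2, d3⟩
        simp [h2, e1, e8, hval, e22, h3] at d1 d2 d3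
        have g1 : s₂.r 1 = s.r 1 := by simpa [e1] using hf₂ 1 (by decide)
        have g8 : s₂.r 8 = s.r 8 := by simpa [e8] using hf₂ 8 (by decide)
        have g26 : s₂.r 26 = u j / 2 ^ s.r 8 := by
          simpa [h2, e1, e8, hval] using hf₂ 26 (by decide)
        have g43 : s₂.r 43 = j := by simpa [h2] using hf₂ 43 (by decide)
        simp only [oddList_succ, h', if_true, downs_snoc, quota_snoc, List.mem_append, hnot,
          false_or]
        refine ⟨g43, g1, g8, g26, d3, ?_, fun x hx => by rw [d1, h4 x hx], fun i hi => ?_⟩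
        · rw [d2]
          by_cases hc : key j < t ∨ key j = t ∧ 0 < quota key t (s.r 39) (oddList u (s.r 8) j)
          · rw [if_pos hc, if_pos (by simp [hc])]
          · rw [if_neg hc, if_neg (by simp [hc])]
        · rw [d1, h5 i hi]
          have hiff : i ∉ if key j < t ∨ key j = t ∧ 0 < quota key t (s.r 39) (oddList u (s.r 8) j)
              then [j] else [] := by
            split_ifs <;> simp; omega
          simp [hiff]
      · simp [h2, e1, e8, hval] at h
        have h' : ¬ u j / 2 ^ s.r 8 % 2 = 1 := by omega
        refine Run.skip ?_
        simp [h2, e1, e8, hval, h3, oddList_succ, h', hnot]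
        exact ⟨h4, h5⟩
    · rintro s₂ hs₂ - ⟨f1, f2, f3, f4, f5, f6, f7, f8⟩
      have hsh : (s₂.r 26 - s₂.r 42) <<< s₂.r 8 ≤ u j := by
        rw [f4, f3, Nat.shiftLeft_eq]
        exact (Nat.mul_le_mul_right _ (Nat.sub_le _ _)).trans (Nat.div_mul_le_self _ _)
      refine Run.store_seq hN rfl (by omega) (by simp [f1, f2]; omega) (by simp; omega) ?_
      refine Run.set hN rfl (by omega) (by simp; omega) ?_
      simp [f1, f2, f5]
      refine ⟨by omega, fun x hx => ?_, fun i hi => ?_⟩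
      · rw [St.put_m, if_neg (by omega), f7 x hx]
      · rw [St.put_m]
        by_cases hi' : i = j
        · subst hi'
          rw [if_pos rfl, f4, f6, f3, Nat.shiftLeft_eq]
        · rw [if_neg (by omega)]
          exact f8 i (by omega)
  · rintro s' hs' hf ⟨h1, h2, h3, h4, h5⟩
    exact ⟨h4, h5⟩

end TCAM

namespace TCAM
open TCAM.Expr TCAM.Stmt

variable {B : ℕ}

/-! ### Assembly of the bounded-error algorithm -/

theorem sum_oddList (u : ℕ → ℕ) (l k : ℕ) : ∑ i ∈ Finset.range k, u i / 2 ^ l =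
    2 * ∑ i ∈ Finset.range k, u i / 2 ^ (l + 1) + (oddList u l k).length := by
  induction k with
  | zero => simp [oddList]
  | succ k ih =>
    rw [Finset.sum_range_succ, Finset.sum_range_succ, ih, oddList_succ, List.length_append,
      show u k / 2 ^ (l + 1) = u k / 2 ^ l / 2 by rw [pow_succ, Nat.div_div_eq_div_mul]]
    generalize u k / 2 ^ l = c
    split_ifs with h <;> simp <;> omega

/-- From the address `2 * k` on, writes a solution of the bounded-error problem for
`W = r0`, `k = r1`, the error `r2 / r3`, and the partition in memory. -/
def buildS (D : OneSidedDistance) : Stmt := block [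
  upperS D, levelS,
  ite (reg 8) (reg 0)
    (block [gatherS, set 38 (reg 46 - lit 1 <<< (reg 0 - reg 8)), splitS, roundS]) singleS]

/-- The selected entries as a finite set. -/
def finSet (k : ℕ) (L : List ℕ) : Finset (Fin k) := Finset.univ.filter fun i => (i : ℕ) ∈ L

theorem card_finSet {k : ℕ} {L : List ℕ} (hL : L.Nodup) (hk : ∀ i ∈ L, i < k) :
    (finSet k L).card = L.length := by
  rw [← List.toFinset_card_of_nodup hL]
  refine Finset.card_bij (fun i _ => (i : ℕ)) ?_ ?_ ?_
  · intro i hi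
    simpa [finSet] using hi
  · intro i _ j _ h
    exact Fin.ext h
  · intro i hi
    rw [List.mem_toFinset] at hi
    exact ⟨⟨i, hk i hi⟩, by simpa [finSet] using hi, rfl⟩

theorem run_roundDown (hN : WordBound (2 ^ B)) {k W : ℕ} {s : St} {T : ℕ} {u : ℕ → ℕ}
    (hu : ∀ j, u j = s.m (k + j)) (h0 : s.r 0 = W) (h1 : s.r 1 = k) (hW : s.r 8 < W)
    (hWB : W < B) (hB : 8 * k + W + 30 < 2 ^ B)
    (hm : ∑ j ∈ Finset.range k, u j < 2 ^ B)
    (hle : 2 ^ (W - s.r 8) ≤ ∑ j ∈ Finset.range k, u j / 2 ^ s.r 8)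
    (hlt : ∑ j ∈ Finset.range k, u j / 2 ^ (s.r 8 + 1) < 2 ^ (W - (s.r 8 + 1)))
    (hT : 2040 * k + 40 ≤ T) :
    Run (2 ^ B) (block [gatherS, set 38 (reg 46 - lit 1 <<< (reg 0 - reg 8)), splitS, roundS]) s T
      fun s' => (∀ x < 2 * k, s'.m x = s.m x) ∧ ∃ X : Fin k → ℕ, (∀ i : Fin k,
        s'.m (2 * k + i) = X i) ∧ IsPartition W X ∧ (∀ i : Fin k, X i ≤ u i) ∧
        ∀ (n : ℕ) (Q : Fin k → ℕ), (∀ i : Fin k, Q i ≤ u i) → Zeroes n (ext W Q) →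
          Zeroes n (ext W X) := by
  subst h0
  apply Run.of_bdd
  intro hbd
  have hp : 2 ^ (s.r 0 - s.r 8) < 2 ^ B := Nat.pow_lt_pow_right (by norm_num) (by omega)
  set l := s.r 8 with hl
  have hlen := length_oddList_le u l k
  have hsum := sum_oddList u l k
  set O := oddList u l k with hO
  -- Since there is no room at level `l + 1`, `hsum` shows that the excess over `2 ^ (W - l)` is
  -- less than the number of odd entries. So it is an admissible rank.
  have hpow : 2 ^ (s.r 0 - l) = 2 * 2 ^ (s.r 0 - (l + 1)) := by
    rw [← pow_succ']; congr 1; omega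
  refine Run.seq (run_gatherS hN (u := u) (T := 7 * k + 5) (by simpa [h1] using hu)
    (by omega) (by rwa [h1]) (by omega)) (by omega) ?_
  rintro s₁ hs₁ hf₁ ⟨a1, a2, a3, a4, a5⟩
  rw [h1] at a1 a2 a3 a4
  rw [← hl, ← hO] at a2 a4
  rw [← hl] at a3
  have b0 : s₁.r 0 = s.r 0 := by simpa using hf₁ 0 (by decide)
  have b1 : s₁.r 1 = k := by simpa [h1] using hf₁ 1 (by decide)
  have b8 : s₁.r 8 = l := by simpa using hf₁ 8 (by decide)
  refine Run.set_seq hN rfl (by omega) (by simp [b0, b8, Nat.shiftLeft_eq]; omega) ?_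
  refine Run.seq (run_splitS hN (n := O.length) (T := 2020 * k + 30) (by simpa using a2)
    (by simp [a3, b0, b8, Nat.shiftLeft_eq]; omega) (by simp; omega) (by omega)) (by omega) ?_
  rintro s₂ hs₂ hf₂ ⟨c1, c2, c3⟩
  simp [a3, b0, b8, Nat.shiftLeft_eq, a4] at c1 c2 c3
  set r := ∑ j ∈ Finset.range k, u j / 2 ^ l - 2 ^ (s.r 0 - l) with hr
  have d1 : s₂.r 1 = k := by simpa [b1] using hf₂ 1 (by decide)
  have d8 : s₂.r 8 = l := by simpa [b8] using hf₂ 8 (by decide)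
  refine Run.conseq (run_roundS hN (u := fun j => s₂.m (k + j)) (T := 13 * k + 2)
    (by simp [d1]) (by omega) (by omega)) (by omega) ?_
  rintro s₃ hs₃ hf₃ ⟨e1, e2⟩
  rw [d1] at e1 e2
  have hmem : ∀ x < s₁.r 37, s₂.m x = s₁.m x := c3
  have hu2 : ∀ j < k, s₂.m (k + j) = u j := fun j hj => by
    rw [hmem _ (by omega), a5 _ (by omega), hu]
  have hO2 : oddList (fun j => s₂.m (k + j)) l k = O := by
    rw [hO, oddList, oddList]
    refine List.filter_congr fun i hi => ?_
    rw [hu2 i (List.mem_range.1 hi)]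
  have hD : downs (fun i => brev B (s₂.m (k + i) / 2 ^ l)) (brev B (s₂.r 22)) (s₂.r 39) O =
      downs (fun i => brev B (u i / 2 ^ l)) (brev B (s₂.r 22)) (s₂.r 39) O := by
    have : ∀ L : List ℕ, (∀ i ∈ L, i < k) → ∀ q,
        downs (fun i => brev B (s₂.m (k + i) / 2 ^ l)) (brev B (s₂.r 22)) q L =
        downs (fun i => brev B (u i / 2 ^ l)) (brev B (s₂.r 22)) q L := by
      intro L
      induction L with
      | nil => intros; rfl
      | cons i L ih =>
        intro h q
        rw [downs, downs, ih (fun i hi => h i (List.mem_cons_of_mem _ hi)),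
          ih (fun i hi => h i (List.mem_cons_of_mem _ hi)), hu2 i (h i (List.mem_cons_self ..))]
    exact this O (fun i hi => (mem_oddList.1 hi).1) _
  rw [d8, hO2, hD] at e2
  set E := downs (fun i => brev B (u i / 2 ^ l)) (brev B (s₂.r 22)) (s₂.r 39) O with hE
  have hEO : E.Sublist O := downs_sublist _ _
  have hEcard : (finSet k E).card = r := by
    rw [card_finSet (hEO.nodup (List.Nodup.filter _ List.nodup_range))
      fun i hi => (mem_oddList.1 (hEO.subset hi)).1, hE, c2]
    exact length_downs_isRank c1
  have hodd : ∀ i ∈ finSet k E, u i / 2 ^ l % 2 = 1 := fun i hi =>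
    (mem_oddList.1 (hEO.subset (by simpa [finSet] using hi))).2
  have hEc : 2 ^ (s.r 0 - l) + (finSet k E).card = ∑ i : Fin k, u i / 2 ^ l := by
    rw [hEcard, Fin.sum_univ_eq_sum_range (fun i => u i / 2 ^ l)]
    omega
  refine ⟨fun x hx => ?_, _, fun i => ?_,
    isPartition_round_down (u := fun i : Fin k => u i) hW.le hodd hEc,
    fun i => round_down_le (u := fun i : Fin k => u i) i, fun n Q hQ hz =>
    hz.ext_round_down (B := B) hW hQ ?_ hodd hEc ?_ ?_⟩
  · rw [e1 x hx, hmem x (by omega), a5 x (by omega)]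
  · rw [e2 i i.2, hu2 i i.2]
    simp [finSet]
  · rw [Fin.sum_univ_eq_sum_range (fun i => u i / 2 ^ (l + 1))]
    exact hlt
  · intro i
    rw [hu]
    exact hbd.2 _
  · intro i hi j hj hjE
    exact downs_le (key := fun i => brev B (u i / 2 ^ l)) (i := (i : ℕ)) (j := (j : ℕ))
      (by simpa [finSet] using hi)
      (mem_oddList.2 ⟨j.2, hj⟩) (fun h => hjE (by simpa [finSet] using h))

theorem run_buildS (hN : WordBound (2 ^ B)) (D : OneSidedDistance) {k W : ℕ} {s : St} {T : ℕ}
    {P : Fin k → ℕ} (hP : IsPartition W P) (hD : D.DefinedAt P) (hW : 1 ≤ W) (h0 : s.r 0 = W)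
    (h1 : s.r 1 = k) (h2 : 0 < s.r 2) (h3 : 0 < s.r 3) (hPm : ∀ i : Fin k, s.m i = P i)
    (hWB : W < B) (hB : 8 * k + W + 30 < 2 ^ B)
    (hw : ∀ i, P i + s.r 2 * D.weight (P i) < 2 ^ B)
    (hsum : ∑ i, D.upper (s.r 2) (s.r 3) (P i) < 2 ^ B)
    (hT : (Nat.log2 W + 1) * (3 * k + 9) + 2050 * k + 60 ≤ T) :
    Run (2 ^ B) (buildS D) s T fun s' => (∀ i : Fin k, s'.m i = P i) ∧
      ∃ X : Fin k → ℕ, (∀ i : Fin k, s'.m (2 * k + i) = X i) ∧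
        IsBoundedErrorSolution D W ((s.r 2 : ℝ) / (s.r 3 : ℝ)) P X := by
  have hk := hP.pos
  refine Run.seq (run_upperS hN D (T := 3 * k + 2) (by omega) (fun j hj => ?_) (by omega))
    (by omega) ?_
  · have := hw ⟨j, by omega⟩
    rw [← hPm] at this
    exact this
  rintro s₁ hs₁ hf₁ ⟨a1, a2⟩
  rw [h1] at a1 a2
  have b0 : s₁.r 0 = W := by simpa [h0] using hf₁ 0 (by simp [upperS, Stmt.writes, Stmt.block])
  have b1 : s₁.r 1 = k := by simpa [h1] using hf₁ 1 (by simp [upperS, Stmt.writes, Stmt.block])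
  set u : ℕ → ℕ := fun j => s₁.m (k + j) with hu
  have hui : ∀ i : Fin k, u i = D.upper (s.r 2) (s.r 3) (P i) := fun i => by
    rw [hu, ← hPm]; exact a2 i i.2
  have hsum' : ∑ j ∈ Finset.range k, u j < 2 ^ B := by
    rw [← Fin.sum_univ_eq_sum_range]
    simpa only [hui] using hsum
  have hge : 2 ^ W ≤ ∑ j ∈ Finset.range k, u j := by
    rw [← Fin.sum_univ_eq_sum_range, ← (show ∑ i, P i = 2 ^ W from hP)]
    refine Finset.sum_le_sum fun i _ => ?_
    rw [hui]
    exact Nat.le_add_right _ _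
  have hdist : ∀ Q : Fin k → ℕ, D.dist Q P < (s.r 2 : ℝ) / (s.r 3 : ℝ) ↔ ∀ i : Fin k, Q i ≤ u i :=
    fun Q => by rw [D.dist_lt_iff hk hD h2 h3]; simp only [hui]
  -- It suffices that `X` respects the bounds and is as cheap as any other vector that does, for
  -- every number of transfers.
  have hfin : ∀ X : Fin k → ℕ, IsPartition W X → (∀ i : Fin k, X i ≤ u i) →
      (∀ (n : ℕ) (Q : Fin k → ℕ), (∀ i : Fin k, Q i ≤ u i) → Zeroes n (ext W Q) →
        Zeroes n (ext W X)) →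
      IsBoundedErrorSolution D W ((s.r 2 : ℝ) / (s.r 3 : ℝ)) P X := fun X hX hXu hopt =>
    ⟨⟨hX, (hdist X).2 hXu⟩, fun Q hQ hQd => (complexity_le_iff hX).2
      (hopt _ Q ((hdist Q).1 hQd) ((complexity_le_iff hQ).1 le_rfl))⟩
  refine Run.seq (run_levelS hN (T := (Nat.log2 W + 1) * (3 * k + 9) + 4) (by omega)
    (by omega) (by omega) (by rw [b1]; exact hsum') (by rw [b1, b0]; exact hge)
    (by rw [b0, b1])) (by omega) ?_
  rintro s₂ hs₂ hf₂ ⟨c1, c2, c3, c4⟩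
  rw [b0] at c2 c3 c4
  rw [b1] at c3 c4
  have d0 : s₂.r 0 = W := by simpa [b0] using hf₂ 0 (by decide)
  have d1 : s₂.r 1 = k := by simpa [b1] using hf₂ 1 (by decide)
  refine Run.ite (by omega) (by simp) (by simp) (fun h => ?_) fun h => ?_
  · simp [d0] at h
    refine Run.conseq (run_roundDown hN (k := k) (W := W) (u := u) (T := 2040 * k + 40)
      (by rw [c1]; exact fun _ => rfl) d0 d1 h hWB hB hsum' c3 (c4 h) le_rfl) (by omega) ?_
    rintro s' - - ⟨e1, X, e2, e3, e4, e5⟩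
    refine ⟨fun i => ?_, X, e2, hfin X e3 e4 e5⟩
    rw [e1 i (by omega), c1, a1 i i.2, hPm]
  · simp [d0] at h
    have h8 : s₂.r 8 = W := by omega
    -- At level `W`, room means that some bound is at least `2 ^ W`, so one target can take
    -- everything.
    rw [h8, Nat.sub_self, pow_zero] at c3
    refine Run.conseq (run_singleS hN (T := 8 * k + 5) (by omega) (by omega) ?_ (by omega))
      (by omega) ?_
    · by_contra hne
      push Not at hne
      rw [Finset.sum_eq_zero] at c3
      · omega
      · intro j hj
        have := hne j (by rw [d1]; exact Finset.mem_range.1 hj)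
        rw [d1, d0, c1] at this
        exact Nat.div_eq_of_lt this
    · rintro s' - - ⟨e1, j, hj, e2, e3⟩
      rw [d1] at e1 hj e2 e3
      rw [d0] at e2 e3
      rw [c1] at e1 e2
      refine ⟨fun i => ?_, fun i => if i = ⟨j, hj⟩ then 2 ^ W else 0, fun i => ?_,
        hfin _ (isPartition_single W _) (fun i => ?_) fun n Q _ hz => hz.ext_single _⟩
      · rw [e1 i (by omega), a1 i i.2, hPm]
      · rw [e3 i i.2]
        simp only [Fin.ext_iff]
      · split_ifs with hi
        · subst hi; exact e2
        · exact Nat.zero_le _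

end TCAM

namespace TCAM
open TCAM.Expr TCAM.Stmt

/-! ### One round of the bit matcher -/

section Round
variable {k W l B : ℕ} {v : Fin k → ℕ} {E : Finset (Fin k)}

/-- The entries that are odd at level `l`. -/
def oddSet (v : Fin k → ℕ) (l : ℕ) : Finset (Fin k) := Finset.univ.filter fun i => v i / 2 ^ l % 2 = 1

theorem mem_oddSet {i : Fin k} : i ∈ oddSet v l ↔ v i / 2 ^ l % 2 = 1 := by simp [oddSet]

/-- The entries in `E` are decreased by `2 ^ l`, and the other odd ones are increased. -/
def roundVec (v : Fin k → ℕ) (l : ℕ) (E : Finset (Fin k)) (i : Fin k) : ℕ :=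
  if i ∈ oddSet v l then if i ∈ E then v i - 2 ^ l else v i + 2 ^ l else v i

/-- The quotients by `2 ^ l` have the sum `2 ^ (W - l)`, which is even because `l < W`. -/
theorem card_oddSet_mod (hv : IsPartition W v) (hl : l < W) (hd : ∀ i, 2 ^ l ∣ v i) :
    (oddSet v l).card % 2 = 0 := by
  have h1 : ∑ i, v i / 2 ^ l = 2 ^ (W - l) := by
    have h := (show ∑ i, v i = 2 ^ W from hv)
    rw [show W = (W - l) + l by omega, pow_add] at h
    refine Nat.eq_of_mul_eq_mul_right (show 0 < 2 ^ l by positivity) ?_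
    rw [← h, Finset.sum_mul]
    exact Finset.sum_congr rfl fun i _ => Nat.div_mul_cancel (hd i)
  have h2 : (∑ i, v i / 2 ^ l) % 2 = (oddSet v l).card % 2 := by
    rw [oddSet, Finset.card_filter, Finset.sum_nat_mod,
      Finset.sum_nat_mod (f := fun i => if v i / 2 ^ l % 2 = 1 then 1 else 0)]
    congr 2
    funext i
    rcases Nat.mod_two_eq_zero_or_one (v i / 2 ^ l) with h | h <;> simp [h]
  rw [← h2, h1, show W - l = W - l - 1 + 1 by omega, pow_succ]
  omega

theorem two_pow_le_of_odd {i : Fin k} (h : i ∈ oddSet v l) : 2 ^ l ≤ v i := by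
  rw [mem_oddSet] at h
  by_contra hc
  rw [Nat.div_eq_of_lt (by omega)] at h
  omega

theorem cast_roundVec (hE : E ⊆ oddSet v l) (i : Fin k) : ((roundVec v l E i : ℕ) : ℤ) =
    v i + 2 ^ l * (ind (oddSet v l \ E) i - ind E i) := by
  rw [roundVec]
  by_cases h1 : i ∈ oddSet v l
  · by_cases h2 : i ∈ E
    · have := two_pow_le_of_odd h1
      simp [h1, h2, ind, Nat.cast_sub this]; ring
    · simp [h1, h2, ind]
  · have h2 : i ∉ E := fun h => h1 (hE h)
    simp [h1, h2, ind]

theorem isPartition_roundVec (hv : IsPartition W v) (hE : E ⊆ oddSet v l)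
    (hc : 2 * E.card = (oddSet v l).card) : IsPartition W (roundVec v l E) := by
  have h := (show ∑ i, v i = 2 ^ W from hv)
  rw [IsPartition]
  zify at h ⊢
  simp only [cast_roundVec hE, Finset.sum_add_distrib, ← Finset.mul_sum, Finset.sum_sub_distrib,
    sum_ind]
  rw [h, Finset.card_sdiff_of_subset hE, ← hc]
  simp [two_mul]

/-- `zeroes_iff_round` in terms of partitions; `E` is the half that goes down. The keys are those of
the entries themselves: the odd ones agree in their `l + 1` lowest digits, `l` zeros and a one, so
no shift is needed before comparing. -/
theorem zeroes_roundVec_iff (hl : l < W) (hd : ∀ i, 2 ^ l ∣ v i)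
    (hE : E ⊆ oddSet v l) (hc : 2 * E.card = (oddSet v l).card) (hb : ∀ i, v i < 2 ^ B)
    (hmin : ∀ i ∈ E, ∀ j ∈ oddSet v l, j ∉ E → brev B (v i) ≤ brev B (v j)) (n : ℕ) :
    Zeroes n (ext W v) ↔ E.card ≤ n ∧ Zeroes (n - E.card) (ext W (roundVec v l E)) := by
  have hW : (2 : ℤ) ^ W = 2 ^ (W - l - 1) * 2 * 2 ^ l := by
    rw [← pow_succ, ← pow_add]; congr 1; omega
  have hnone : (-2 ^ W : ℤ) / 2 ^ l % 2 = 0 := by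
    rw [hW, ← neg_mul, Int.mul_ediv_cancel _ (by positivity)]; omega
  have hsome : ∀ i, ((v i : ℤ) / 2 ^ l % 2 = 1 ↔ i ∈ oddSet v l) := fun i => by
    rw [mem_oddSet, show (v i : ℤ) / 2 ^ l = ((v i / 2 ^ l : ℕ) : ℤ) by simp]; omega
  have key := zeroes_iff_round (n := n) (l := l) (v := ext W v)
    (O := (oddSet v l).map .some) (U := (oddSet v l \ E).map .some)
    (by
      intro m
      cases m with
      | none => rw [ext_none, hW]; exact (dvd_mul_left _ _).neg_right
      | some i => rw [ext_some]; exact_mod_cast hd i)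
    (by
      intro m
      cases m with
      | none => simp [hnone]
      | some i => rw [ext_some, hsome]; simp)
    (Finset.map_subset_map.2 Finset.sdiff_subset)
    (by rw [Finset.card_map, Finset.card_map, Finset.card_sdiff_of_subset hE]; omega)
    (by
      intro i hi hiU j hj
      obtain ⟨i, hi', rfl⟩ := Finset.mem_map.1 hi
      obtain ⟨j, hj', rfl⟩ := Finset.mem_map.1 hj
      rw [Finset.mem_sdiff] at hj'
      have hiE : i ∈ E := by
        by_contra h
        exact hiU (Finset.mem_map_of_mem _ (Finset.mem_sdiff.2 ⟨hi', h⟩))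
      have hz : ∀ m, ∀ p < l, (v m : ℤ) / 2 ^ p % 2 = 0 := fun m p hp => by
        obtain ⟨c, hcm⟩ := hd m
        rw [hcm, show l = (l - p - 1) + 1 + p by omega, pow_add, pow_succ]
        push_cast
        rw [show (2 ^ (l - p - 1) * 2 * 2 ^ p * c : ℤ) = 2 * (2 ^ (l - p - 1) * c) * 2 ^ p by ring,
          Int.mul_ediv_cancel _ (by positivity)]
        omega
      refine ((RLe.of_brev (hb i) (hb j) (hmin i hiE j hj'.1 hj'.2)).div_pow (l := l) ?_).half ?_
      · intro p hp
        rw [hz i p hp, hz j p hp]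
      · rw [(hsome i).2 hi', (hsome j).2 hj'.1])
  have hcU : ((oddSet v l \ E).map Function.Embedding.some).card = E.card := by
    rw [Finset.card_map, Finset.card_sdiff_of_subset hE]; omega
  rw [key, hcU]
  have heq : (fun m => ext W v m + 2 ^ l * (ind ((oddSet v l \ E).map .some) m -
      ind ((oddSet v l).map .some \ (oddSet v l \ E).map .some) m)) = ext W (roundVec v l E) := by
    funext m
    cases m with
    | none => simp [ind]
    | some i =>
      rw [ext_some, ext_some, cast_roundVec hE]
      congr 2
      have := @hE i
      simp [ind]
      by_cases h1 : i ∈ E <;> by_cases h2 : i ∈ oddSet v l <;> simp [h1, h2]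
      exact h2 (this h1)
  rw [heq]

/-- The sum `2 ^ W` forces exactly one entry to be `2 ^ W` and the others to be zero. This is the
situation when all the lists have been processed. -/
theorem zeroes_iff_of_single {n : ℕ} (hv : IsPartition W v) (h : ∀ i, v i = 0 ∨ 2 ^ W ≤ v i) :
    Zeroes n (ext W v) ↔ 1 ≤ n := by
  refine ⟨fun hz => hz.one_le fun h => by simpa using congrFun h none, fun hn => ?_⟩
  have hsum := (show ∑ i, v i = 2 ^ W from hv)
  obtain ⟨j, hj⟩ : ∃ j, v j ≠ 0 := by
    by_contra hne
    push Not at hne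
    simp [hne] at hsum
    exact absurd hsum.symm (by positivity)
  have hj' : v j = 2 ^ W := le_antisymm (hv.le j) ((h j).resolve_left hj)
  have : v = fun i => if i = j then 2 ^ W else 0 := by
    funext i
    split_ifs with hi
    · rw [hi, hj']
    · rw [← Finset.add_sum_erase _ _ (Finset.mem_univ j), hj'] at hsum
      exact Finset.sum_eq_zero_iff.1 (by omega) i (Finset.mem_erase.2 ⟨hi, Finset.mem_univ i⟩)
  rw [this]
  exact (zeroes_single W j).mono hn

end Round

/-! ### Lists in memory -/

/-- The linked list with first pointer `p` and next pointers `nx`; a pointer to `i` is `i + 1`. -/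
def Chain (nx : ℕ → ℕ) : ℕ → List ℕ → Prop
  | p, [] => p = 0
  | p, i :: L => p = i + 1 ∧ Chain nx (nx i) L

theorem Chain.congr {nx nx' : ℕ → ℕ} {L : List ℕ} : ∀ {p : ℕ}, Chain nx p L →
    (∀ i ∈ L, nx' i = nx i) → Chain nx' p L := by
  induction L with
  | nil => exact fun h _ => h
  | cons i L ih =>
    intro p h hn
    exact ⟨h.1, by
      rw [hn i (List.mem_cons_self ..)]
      exact ih h.2 fun j hj => hn j (List.mem_cons_of_mem _ hj)⟩

theorem Chain.pos_iff {nx : ℕ → ℕ} {L : List ℕ} {p : ℕ} (h : Chain nx p L) : 0 < p ↔ L ≠ [] := by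
  cases L with
  | nil => have : p = 0 := h; simp [this]
  | cons i L => have := h.1; simp; omega

/-- The indices in `I` with values strictly between `0` and `2 ^ W` are in linked lists, by their
lowest bits; the bits of `mask` tell the lists that are not empty. The values, next pointers and
first pointers are from the addresses `2 * k`, `3 * k` and `4 * k` on. -/
structure Buckets (k W : ℕ) (m : ℕ → ℕ) (mask : ℕ) (I : Set ℕ) (f : ℕ → List ℕ) : Prop where
  mem : ∀ j i, i ∈ f j ↔
    i ∈ I ∧ i < k ∧ 0 < m (2 * k + i) ∧ m (2 * k + i) < 2 ^ W ∧ lowbit (m (2 * k + i)) = j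
  nodup : ∀ j, (f j).Nodup
  chain : ∀ j, f j ≠ [] → Chain (fun i => m (3 * k + i)) (m (4 * k + j)) (f j)
  mask : ∀ j, mask.testBit j = true ↔ f j ≠ []

theorem lowbit_lt {x W : ℕ} (h0 : 0 < x) (h : x < 2 ^ W) : lowbit x < W := by
  have h1 := Nat.le_of_dvd h0 (lowbit_spec h0).1
  exact (Nat.pow_lt_pow_iff_right (by norm_num)).1 (lt_of_le_of_lt h1 h)

theorem lowbit_eq {x j : ℕ} (h : 2 ^ j ∣ x) (h1 : x / 2 ^ j % 2 = 1) : lowbit x = j := by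
  have h0 : 0 < x := by
    rcases Nat.eq_zero_or_pos x with rfl | h0
    · simp at h1
    · exact h0
  obtain ⟨h2, h3⟩ := lowbit_spec h0
  have key : ∀ {a b : ℕ}, a < b → 2 ^ b ∣ x → x / 2 ^ a % 2 = 1 → False := by
    rintro a b hab ⟨c, hc⟩ h
    rw [hc, show b = a + (b - a - 1 + 1) by omega, pow_add, mul_assoc,
      Nat.mul_div_cancel_left _ (by positivity), pow_succ', mul_assoc] at h
    omega
  rcases lt_trichotomy (lowbit x) j with h4 | h4 | h4
  · exact (key h4 h h3).elim
  · exact h4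
  · exact (key h4 h2 h1).elim

namespace Buckets
variable {k W mask : ℕ} {m m' : ℕ → ℕ} {I : Set ℕ} {f : ℕ → List ℕ}

theorem level_lt (h : Buckets k W m mask I f) {j : ℕ} (hj : f j ≠ []) : j < W := by
  obtain ⟨i, hi⟩ := List.exists_mem_of_ne_nil _ hj
  obtain ⟨-, -, h1, h2, rfl⟩ := (h.mem j i).1 hi
  exact lowbit_lt h1 h2

theorem congr (h : Buckets k W m mask I f) (hv : ∀ i ∈ I, i < k → m' (2 * k + i) = m (2 * k + i))
    (hn : ∀ i ∈ I, i < k → m' (3 * k + i) = m (3 * k + i))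
    (hh : ∀ j < W, m' (4 * k + j) = m (4 * k + j)) : Buckets k W m' mask I f where
  mem j i := by
    rw [h.mem]
    by_cases h1 : i ∈ I
    · by_cases h2 : i < k
      · rw [hv i h1 h2]
      · simp [h2]
    · simp [h1]
  nodup := h.nodup
  chain j hj := by
    rw [hh j (h.level_lt hj)]
    refine (h.chain j hj).congr fun i hi => ?_
    have := (h.mem j i).1 hi
    exact hn i this.1 this.2.1
  mask := h.mask

/-- Removal of a list. -/
theorem erase (h : Buckets k W m mask I f) {l mask' : ℕ} {I' : Set ℕ}
    (hI : ∀ i, i ∈ I' ↔ i ∈ I ∧ i ∉ f l)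
    (hmask : ∀ j, mask'.testBit j = if j = l then false else mask.testBit j) :
    Buckets k W m mask' I' (Function.update f l []) where
  mem j i := by
    rw [hI]
    by_cases hj : j = l
    · subst hj
      simp only [Function.update_self, List.not_mem_nil, false_iff]
      rintro ⟨⟨h1, h2⟩, h3⟩
      exact h2 ((h.mem j i).2 ⟨h1, h3⟩)
    · rw [Function.update_of_ne hj, h.mem]
      constructor
      · rintro ⟨h1, h2, h3, h4, h5⟩
        refine ⟨⟨h1, fun hl => ?_⟩, h2, h3, h4, h5⟩
        exact hj (h5.symm.trans ((h.mem l i).1 hl).2.2.2.2)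
      · rintro ⟨⟨h1, -⟩, h2⟩
        exact ⟨h1, h2⟩
  nodup j := by
    by_cases hj : j = l
    · subst hj; simp
    · rw [Function.update_of_ne hj]; exact h.nodup j
  chain j hj := by
    by_cases hjl : j = l
    · subst hjl; simp at hj
    · rw [Function.update_of_ne hjl] at hj ⊢; exact h.chain j hj
  mask j := by
    rw [hmask]
    by_cases hjl : j = l
    · subst hjl; simp
    · rw [Function.update_of_ne hjl, if_neg hjl]; exact h.mask j

/-- Insertion of an index with a value that does not belong to any list. -/
theorem insert_trivial (h : Buckets k W m mask I f) {i : ℕ}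
    (hv : m (2 * k + i) = 0 ∨ 2 ^ W ≤ m (2 * k + i)) :
    Buckets k W m mask (insert i I) f where
  mem j x := by
    rw [h.mem, Set.mem_insert_iff]
    constructor
    · rintro ⟨h1, h2⟩
      exact ⟨.inr h1, h2⟩
    · rintro ⟨rfl | h1, h2, h3, h4, h5⟩
      · omega
      · exact ⟨h1, h2, h3, h4, h5⟩
  nodup := h.nodup
  chain := h.chain
  mask := h.mask

/-- Insertion of an index at the head of its list. -/
theorem insert_head (h : Buckets k W m mask I f) {i l mask' : ℕ} (hi : i < k) (hiI : i ∉ I)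
    (h0 : 0 < m (2 * k + i)) (hW : m (2 * k + i) < 2 ^ W) (hl : lowbit (m (2 * k + i)) = l)
    (hv : ∀ x < k, m' (2 * k + x) = m (2 * k + x))
    (hn : ∀ x < k, x ≠ i → m' (3 * k + x) = m (3 * k + x))
    (hh : ∀ j < W, j ≠ l → m' (4 * k + j) = m (4 * k + j))
    (hhead : m' (4 * k + l) = i + 1)
    (hnext : m' (3 * k + i) = if mask.testBit l then m (4 * k + l) else 0)
    (hmask : ∀ j, mask'.testBit j = if j = l then true else mask.testBit j) :
    Buckets k W m' mask' (insert i I) (Function.update f l (i :: f l)) where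
  mem j x := by
    rw [Set.mem_insert_iff]
    have hx : (x ∈ I ∧ x < k ∧ 0 < m' (2 * k + x) ∧ m' (2 * k + x) < 2 ^ W ∧
        lowbit (m' (2 * k + x)) = j) ↔ x ∈ f j := by
      rw [h.mem]
      by_cases hxk : x < k
      · rw [hv x hxk]
      · simp [hxk]
    rw [or_and_right, hx]
    have hx' : (x = i ∧ x < k ∧ 0 < m' (2 * k + x) ∧ m' (2 * k + x) < 2 ^ W ∧
        lowbit (m' (2 * k + x)) = j) ↔ x = i ∧ j = l := by
      constructor
      · rintro ⟨rfl, h1, -, -, h2⟩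
        rw [hv x h1, hl] at h2
        exact ⟨rfl, h2.symm⟩
      · rintro ⟨rfl, rfl⟩
        rw [hv x hi]
        exact ⟨rfl, hi, h0, hW, hl⟩
    rw [hx']
    by_cases hj : j = l
    · subst hj; simp
    · rw [Function.update_of_ne hj]; simp [hj]
  nodup j := by
    by_cases hj : j = l
    · subst hj
      rw [Function.update_self]
      exact List.nodup_cons.2 ⟨fun hif => hiI ((h.mem j i).1 hif).1, h.nodup j⟩
    · rw [Function.update_of_ne hj]; exact h.nodup j
  chain j hj := by
    have hc : ∀ {j p}, Chain (fun i => m (3 * k + i)) p (f j) →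
        Chain (fun i => m' (3 * k + i)) p (f j) := fun hch => hch.congr fun x hx => by
      have hx' := (h.mem _ x).1 hx
      exact hn x hx'.2.1 fun he => hiI (he ▸ hx'.1)
    by_cases hjl : j = l
    · subst hjl
      rw [Function.update_self]
      refine ⟨hhead, hc ?_⟩
      simp only [hnext]
      split_ifs with hb
      · exact h.chain j ((h.mask j).1 hb)
      · have : f j = [] := by
          by_contra hne
          exact hb ((h.mask j).2 hne)
        rw [this]; rfl
    · rw [Function.update_of_ne hjl] at hj ⊢
      rw [hh j (h.level_lt hj) hjl]
      exact hc (h.chain j hj)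
  mask j := by
    rw [hmask]
    by_cases hjl : j = l
    · subst hjl; simp
    · rw [Function.update_of_ne hjl, if_neg hjl]; exact h.mask j

end Buckets

end TCAM

namespace TCAM
open TCAM.Expr TCAM.Stmt

variable {B : ℕ}

/-! ### Operations on the lists of levels -/

theorem le_of_dvd_of_odd {x a b : ℕ} (h : 2 ^ b ∣ x) (h' : x / 2 ^ a % 2 = 1) : b ≤ a := by
  by_contra hab
  obtain ⟨c, hc⟩ := h
  rw [hc, show b = a + (b - a - 1 + 1) by omega, pow_add, mul_assoc,
    Nat.mul_div_cancel_left _ (by positivity), pow_succ', mul_assoc] at h'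
  omega

/-- The position of the lowest bit of register `x`. -/
def lowbitE (x : ℕ) : Expr := msb (reg x &&& (reg x ^^^ (reg x - lit 1)))

@[simp] theorem eval_lowbitE (x : ℕ) (s : St) : (lowbitE x).eval s = lowbit (s.r x) := rfl

@[simp] theorem ok_lowbitE (x N : ℕ) (s : St) : (lowbitE x).Ok N s ↔ True := by simp [lowbitE]

/-- Inserts the index `r51` with value `r26`; the mask is in `r49`. -/
def insertS : Stmt :=
  ite (lit 0) (reg 26) (ite (reg 26) (lit 1 <<< reg 0) (block [
    set 52 (lowbitE 26), set 53 (lit 1 <<< reg 52), set 54 (lit 0),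
    ite (lit 0) (reg 49 &&& reg 53) (set 54 (load (lit 4 * reg 1 + reg 52)))
      (set 49 (reg 49 ||| reg 53)),
    store (lit 3 * reg 1 + reg 51) (reg 54),
    store (lit 4 * reg 1 + reg 52) (reg 51 + lit 1)]) skip) skip

theorem run_insertS (hN : WordBound (2 ^ B)) {k W : ℕ} {s : St} {T : ℕ} {I : Set ℕ}
    {f : ℕ → List ℕ} (h0 : s.r 0 = W) (h1 : s.r 1 = k) (hb : Buckets k W s.m (s.r 49) I f)
    (hi : s.r 51 < k) (hiI : s.r 51 ∉ I) (h26 : s.r 26 = s.m (2 * k + s.r 51)) (hWB : W < B)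
    (hB : 5 * k + W + 10 < 2 ^ B) (hT : 10 ≤ T) :
    Run (2 ^ B) insertS s T fun s' =>
      (∃ f', Buckets k W s'.m (s'.r 49) (insert (s.r 51) I) f') ∧
      (∀ x < 3 * k, s'.m x = s.m x) ∧
      ∀ x < k, x ≠ s.r 51 → s'.m (3 * k + x) = s.m (3 * k + x) := by
  have hlit := hN.lit
  have hp : 2 ^ W < 2 ^ B := Nat.pow_lt_pow_right (by norm_num) hWB
  refine Run.ite (by omega) (by simp) (by simp) (fun hpos => ?_) fun h => ?_
  · simp at hpos
    refine Run.ite (by omega) (by simp) (by simp [h0, Nat.shiftLeft_eq]; omega) (fun h => ?_)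
      fun h => ?_
    · simp [h0, Nat.shiftLeft_eq] at h
      set l := lowbit (s.r 26) with hl
      have hlW : l < W := lowbit_lt hpos h
      have hpl : 2 ^ l < 2 ^ B := Nat.pow_lt_pow_right (by norm_num) (by omega)
      refine Run.set_seq hN rfl (by omega) (by simp) ?_
      refine Run.set_seq hN rfl (by omega) (by simp [Nat.shiftLeft_eq, ← hl]; omega) ?_
      refine Run.set_seq hN rfl (by omega) (by simp) ?_
      -- If the bit of the mask is clear, the cell of the first pointer may be a remnant of an
      -- earlier use and is not read. Thus the pointers need no initialization.
      refine Run.seq (T₁ := 2) (Q := fun t => t.m = s.m ∧ t.r 1 = k ∧ t.r 51 = s.r 51 ∧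
        t.r 52 = l ∧ t.r 54 = (if (s.r 49).testBit l then s.m (4 * k + l) else 0) ∧
        ∀ j, (t.r 49).testBit j = if j = l then true else (s.r 49).testBit j) ?_ (by omega) ?_
      · have hand : 0 < s.r 49 &&& 2 ^ l ↔ (s.r 49).testBit l = true := by
          rw [Nat.and_two_pow]
          have : 0 < 2 ^ l := by positivity
          cases (s.r 49).testBit l <;> simp
        refine Run.ite (by omega) (by simp) (by simp) (fun h' => ?_) fun h' => ?_
        · simp only [eval_lit, eval_reg, eval_and, St.set_r] at h'
          norm_num [Nat.shiftLeft_eq] at h'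
          rw [← hl, hand] at h'
          refine Run.set hN rfl (by omega) (by simp [h1, ← hl]; omega) ?_
          simp [h1, h', ← hl]
        · simp only [eval_lit, eval_reg, eval_and, St.set_r] at h'
          norm_num [Nat.shiftLeft_eq] at h'
          rw [← hl] at h'
          have h' : ¬ (s.r 49).testBit l = true := fun hh => by
            rw [← hand] at hh; omega
          refine Run.set hN rfl (by omega) (by simp) ?_
          simp [h1, h', ← hl, Nat.shiftLeft_eq, Nat.testBit_or, Nat.testBit_two_pow]
          intro j
          by_cases hj : j = l
          · simp [hj]
          · simp [hj, Ne.symm hj]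
      · rintro t ht - ⟨e1, e2, e3, e4, e5, e6⟩
        refine Run.store_seq hN rfl (by omega) (by simp [e2, e3]; omega) (by simp) ?_
        refine Run.store hN rfl (by omega) (by simp [e2, e4]; omega) (by simp [e3]; omega) ?_
        simp only [eval_reg, eval_add, eval_mul, eval_lit, St.put_r, e2, e3, e4, e5]
        refine ⟨⟨_, hb.insert_head hi hiI (h26 ▸ hpos) (h26 ▸ h) (by rw [← h26]) ?_ ?_ ?_ ?_ ?_ e6⟩,
          ?_, ?_⟩
        · intro x hx
          rw [St.put_m, if_neg (by omega), St.put_m, if_neg (by omega), e1]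
        · intro x hx hne
          rw [St.put_m, if_neg (by omega), St.put_m, if_neg (by omega), e1]
        · intro j hj hne
          rw [St.put_m, if_neg (by omega), St.put_m, if_neg (by omega), e1]
        · rw [St.put_m, if_pos rfl]
        · rw [St.put_m, if_neg (by omega), St.put_m, if_pos rfl]
        · intro x hx
          rw [St.put_m, if_neg (by omega), St.put_m, if_neg (by omega), e1]
        · intro x hx hne
          rw [St.put_m, if_neg (by omega), St.put_m, if_neg (by omega), e1]
    · simp [h0, Nat.shiftLeft_eq] at h
      exact Run.skip ⟨⟨f, hb.insert_trivial (.inr (h26 ▸ h))⟩, fun _ _ => rfl, fun _ _ _ => rfl⟩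
  · simp at h
    exact Run.skip ⟨⟨f, hb.insert_trivial (.inl (h26 ▸ h))⟩, fun _ _ => rfl, fun _ _ _ => rfl⟩

/-- The values of the list of level `r55` go to the workspace. -/
def gatherListS : Stmt := block [
  set 36 workE, set 37 (reg 36), set 56 (load (lit 4 * reg 1 + reg 55)),
  loop (lit 0) (reg 56) (block [
    store (reg 37) (load (lit 2 * reg 1 + (reg 56 - lit 1))), set 37 (reg 37 + lit 1),
    set 56 (load (lit 3 * reg 1 + (reg 56 - lit 1)))])]

theorem run_gatherListS (hN : WordBound (2 ^ B)) {k W : ℕ} {s : St} {T : ℕ} {L : List ℕ}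
    (h0 : s.r 0 = W) (h1 : s.r 1 = k) (h55 : s.r 55 < W)
    (hc : Chain (fun i => s.m (3 * k + i)) (s.m (4 * k + s.r 55)) L) (hL : ∀ i ∈ L, i < k)
    (hlen : L.length ≤ k) (hB : 5 * k + W + 10 < 2 ^ B) (hT : 4 * L.length + 4 ≤ T) :
    Run (2 ^ B) gatherListS s T fun s' => s'.r 36 = 4 * k + W + 1 ∧
      s'.r 37 = 4 * k + W + 1 + L.length ∧
      seg s'.m (4 * k + W + 1) L.length = L.map (fun i => s.m (2 * k + i)) ∧
      ∀ x < 4 * k + W + 1, s'.m x = s.m x := by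
  have hlit := hN.lit
  refine Run.set_seq hN rfl (by omega) (by simp [workE, h0, h1]; omega) ?_
  refine Run.set_seq hN rfl (by omega) (by simp) ?_
  refine Run.set_seq hN rfl (by omega) (by simp [h1]; omega) ?_
  set b := 4 * k + W + 1 with hb
  refine Run.for_loop (fun j s' => j ≤ L.length ∧ s'.r 36 = b ∧ s'.r 37 = b + j ∧
      Chain (fun i => s.m (3 * k + i)) (s'.r 56) (L.drop j) ∧
      seg s'.m b j = (L.take j).map (fun i => s.m (2 * k + i)) ∧
      ∀ x < b, s'.m x = s.m x) L.length 3 ?_ (by omega) ?_ ?_ ?_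
  · simp [workE, h0, h1, hb, hc]
  · rintro j s' hs' hf ⟨h2, h3, h4, h5, h6, h7⟩
    refine ⟨by simp, by simp, ?_⟩
    simp only [eval_lit, eval_reg, h5.pos_iff]
    simp
  · rintro j s' hs' hf hj ⟨h2, h3, h4, h5, h6, h7⟩
    have e1 : s'.r 1 = k := by simpa [h1] using hf 1 (by decide)
    rw [List.drop_eq_getElem_cons hj] at h5
    obtain ⟨h56, h5⟩ := h5
    have hi := hL _ (List.getElem_mem hj)
    set i := L[j] with hidef
    refine Run.store_seq hN rfl (by omega) (by simp) (by simp [e1, h56]; omega) ?_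
    refine Run.set_seq hN rfl (by omega) (by simp; omega) ?_
    refine Run.set hN rfl (by omega) (by simp [e1, h56]; omega) ?_
    simp [e1, h56, h3, h4]
    refine ⟨by omega, by omega, ?_, ?_, fun x hx => ?_⟩
    · rw [St.put_m, if_neg (by omega), h7 _ (by omega)]
      exact h5
    · rw [← hidef] at *
      rw [← List.map_take, seg_succ, St.put_m, if_pos rfl, h7 _ (by omega), List.take_succ_eq_append_getElem hj,
        List.map_append, ← h6]
      congr 1
      exact seg_congr fun x _ hx => by rw [St.put_m, if_neg (by omega)]
    · rw [St.put_m, if_neg (by omega), h7 x hx]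
  · rintro s' hs' hf ⟨h2, h3, h4, h5, h6, h7⟩
    exact ⟨h3, h4, by simpa using h6, h7⟩

/-- The list of level `r55` is distributed to the lists of higher levels: the values selected by
`splitS` are decreased by `2 ^ r55`, and the other ones are increased. -/
def distributeS : Stmt := block [
  set 56 (load (lit 4 * reg 1 + reg 55)), set 57 (lit 1 <<< reg 55),
  loop (lit 0) (reg 56) (block [
    set 51 (reg 56 - lit 1), set 56 (load (lit 3 * reg 1 + reg 51)),
    set 26 (load (lit 2 * reg 1 + reg 51)), decideS,
    ite (lit 0) (reg 42) (set 26 (reg 26 - reg 57)) (set 26 (reg 26 + reg 57)),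
    store (lit 2 * reg 1 + reg 51) (reg 26), insertS])]

theorem run_distributeS (hN : WordBound (2 ^ B)) {k W : ℕ} {s : St} {T : ℕ} {L : List ℕ}
    {f : ℕ → List ℕ} (h0 : s.r 0 = W) (h1 : s.r 1 = k) (h55 : s.r 55 < W) (hnd : L.Nodup)
    (hc : Chain (fun i => s.m (3 * k + i)) (s.m (4 * k + s.r 55)) L) (hL : ∀ i ∈ L, i < k)
    (hb : Buckets k W s.m (s.r 49) {i | i ∉ L} f)
    (hv : ∀ i ∈ L, s.m (2 * k + i) + 2 ^ s.r 55 < 2 ^ B) (hWB : W < B)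
    (hB : 5 * k + W + 10 < 2 ^ B) (hT : 25 * L.length + 3 ≤ T) :
    Run (2 ^ B) distributeS s T fun s' => (∃ f', Buckets k W s'.m (s'.r 49) Set.univ f') ∧
      (∀ x < 2 * k, s'.m x = s.m x) ∧ ∀ i < k, s'.m (2 * k + i) = if i ∈ L then
        if i ∈ downs (fun i => brev B (s.m (2 * k + i))) (brev B (s.r 22)) (s.r 39) L then
          s.m (2 * k + i) - 2 ^ s.r 55 else s.m (2 * k + i) + 2 ^ s.r 55
        else s.m (2 * k + i) := by
  have hlit := hN.lit
  have hpl : 2 ^ s.r 55 < 2 ^ B := Nat.pow_lt_pow_right (by norm_num) (by omega)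
  refine Run.set_seq hN rfl (by omega) (by simp [h1]; omega) ?_
  refine Run.set_seq hN rfl (by omega) (by simp [Nat.shiftLeft_eq]; omega) ?_
  set l := s.r 55 with hl
  set key := fun i => brev B (s.m (2 * k + i)) with hkey
  set t := brev B (s.r 22) with ht
  -- Insertion overwrites next pointers, but only of indices already taken from the list. So the
  -- chain is stated for the initial memory, together with the fact that the remaining pointers are
  -- unchanged.
  refine Run.for_loop (fun j s' => j ≤ L.length ∧
      Chain (fun i => s.m (3 * k + i)) (s'.r 56) (L.drop j) ∧
      (∀ i ∈ L.drop j, s'.m (3 * k + i) = s.m (3 * k + i)) ∧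
      s'.r 39 = quota key t (s.r 39) (L.take j) ∧
      (∃ f', Buckets k W s'.m (s'.r 49) {i | i ∉ L.drop j} f') ∧
      (∀ x < 2 * k, s'.m x = s.m x) ∧ ∀ i < k, s'.m (2 * k + i) = if i ∈ L.take j then
        if i ∈ downs key t (s.r 39) (L.take j) then
          s.m (2 * k + i) - 2 ^ l else s.m (2 * k + i) + 2 ^ l
        else s.m (2 * k + i)) L.length 24 ?_ (by omega) ?_ ?_ ?_
  · simp [h1, ← hl, hc, quota]
    exact ⟨f, hb⟩
  · rintro j s' hs' hf ⟨h2, h3, h4⟩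
    refine ⟨by simp, by simp, ?_⟩
    simp only [eval_lit, eval_reg, h3.pos_iff]
    simp
  · rintro j s' hs' hf hj ⟨h2, h3, h4, h5, ⟨f', h6⟩, h7, h8⟩
    have e0 : s'.r 0 = W := by simpa [h0] using hf 0 (by decide)
    have e1 : s'.r 1 = k := by simpa [h1] using hf 1 (by decide)
    have e22 : s'.r 22 = s.r 22 := by simpa using hf 22 (by decide)
    have e57 : s'.r 57 = 2 ^ l := by simpa [Nat.shiftLeft_eq] using hf 57 (by decide)
    have htake := List.take_succ_eq_append_getElem hj
    have hdrop := List.drop_eq_getElem_cons hj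
    have hiL := List.getElem_mem hj
    have hnd' : (L.take j ++ L.drop j).Nodup := by rwa [List.take_append_drop]
    set i := L[j] with hidef
    rw [hdrop] at h3 h4 h6 hnd'
    obtain ⟨h56, h3⟩ := h3
    have hi := hL _ hiL
    have hnot : i ∉ L.take j := fun h =>
      (List.nodup_append.1 hnd').2.2 i h i (List.mem_cons_self ..) rfl
    have hnot2 : i ∉ L.drop (j + 1) := ((List.nodup_cons.1 (List.nodup_append.1 hnd').2.1).1)
    have hvi := h8 i hi
    rw [if_neg hnot] at hvi
    have hvl := hv i hiL
    refine Run.set_seq hN rfl (by omega) (by simp) ?_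
    refine Run.set_seq hN rfl (by omega) (by simp [e1, h56]; omega) ?_
    refine Run.set_seq hN rfl (by omega) (by simp [e1, h56]; omega) ?_
    refine Run.seq (run_decideS hN (T := 7) le_rfl) (by omega) ?_
    rintro s₂ hs₂ hf₂ ⟨d1, d2, d3⟩
    simp [h56, e1, e22, hvi, h5] at d1 d2 d3
    have g0 : s₂.r 0 = W := by simpa [e0] using hf₂ 0 (by decide)
    have g1 : s₂.r 1 = k := by simpa [e1] using hf₂ 1 (by decide)
    have g26 : s₂.r 26 = s.m (2 * k + i) := by simpa [h56, e1, hvi] using hf₂ 26 (by decide)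
    have g49 : s₂.r 49 = s'.r 49 := by simpa using hf₂ 49 (by decide)
    have g51 : s₂.r 51 = i := by simpa [h56] using hf₂ 51 (by decide)
    have g56 : s₂.r 56 = s.m (3 * k + i) := by
      simpa [h56, e1, h4 i (List.mem_cons_self ..)] using hf₂ 56 (by decide)
    have g57 : s₂.r 57 = 2 ^ l := by simpa [e57] using hf₂ 57 (by decide)
    have hdn : i ∈ downs key t (s.r 39) (L.take (j + 1)) ↔
        key i < t ∨ key i = t ∧ 0 < quota key t (s.r 39) (L.take j) := by
      rw [htake, downs_snoc, List.mem_append]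
      have : i ∉ downs key t (s.r 39) (L.take j) := fun h => hnot ((downs_sublist _ _).subset h)
      simp only [this, false_or]
      split_ifs with h <;> simp [h]
    have hdn' : ∀ x, x ≠ i → (x ∈ downs key t (s.r 39) (L.take (j + 1)) ↔
        x ∈ downs key t (s.r 39) (L.take j)) := fun x hx => by
      rw [htake, downs_snoc, List.mem_append]
      split_ifs with h <;> simp [hx]
    refine Run.seq (T₁ := 2) (Q := fun s₃ => s₃.m = s'.m ∧ s₃.r 0 = W ∧ s₃.r 1 = k ∧
      s₃.r 49 = s'.r 49 ∧ s₃.r 51 = i ∧ s₃.r 56 = s.m (3 * k + i) ∧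
      s₃.r 39 = quota key t (s.r 39) (L.take (j + 1)) ∧
      s₃.r 26 = if i ∈ downs key t (s.r 39) (L.take (j + 1)) then s.m (2 * k + i) - 2 ^ l
        else s.m (2 * k + i) + 2 ^ l) ?_ (by omega) ?_
    · have hq : quota key t (s.r 39) (L.take (j + 1)) = s₂.r 39 := by
        rw [htake, quota_snoc, d3]
      refine Run.ite (by omega) (by simp) (by simp) (fun h => ?_) fun h => ?_
      · rw [eval_lit, eval_reg, d2] at h
        have h' : i ∈ downs key t (s.r 39) (L.take (j + 1)) := by
          rw [hdn]; by_contra hc; rw [if_neg hc] at h; omega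
        refine Run.set hN rfl (by omega) (by simp) ?_
        simp [d1, g0, g1, g49, g51, g56, hq, g26, g57, h']
      · rw [eval_lit, eval_reg, d2] at h
        have h' : i ∉ downs key t (s.r 39) (L.take (j + 1)) := by
          rw [hdn]; intro hc; exact h (by rw [if_pos hc]; exact Nat.one_pos)
        refine Run.set hN rfl (by omega) (by simp [g26, g57]; omega) ?_
        simp [d1, g0, g1, g49, g51, g56, hq, g26, g57, h']
    rintro s₃ hs₃ - ⟨a1, a2, a3, a4, a5, a6, a7, a8⟩
    refine Run.store_seq hN rfl (by omega) (by simp [a3, a5]; omega) (by simp) ?_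
    refine Run.conseq (run_insertS hN (k := k) (W := W) (I := {x | x ∉ i :: L.drop (j + 1)})
      (f := f') (T := 10) (by simpa using a2) (by simpa using a3) ?_ (by simpa [a5] using hi)
      (by simp [a5]) (by simp [a3, a5, St.put_m]) hWB hB le_rfl) (by omega) ?_
    · simp only [eval_reg, eval_add, eval_mul, eval_lit, St.put_r, a3, a4, a5]
      refine h6.congr ?_ ?_ ?_
      · intro x hx hxk
        have hxi : x ≠ i := fun h => hx (by simp [h])
        rw [St.put_m, if_neg (by omega), a1]
      · intro x hx hxk
        rw [St.put_m, if_neg (by omega), a1]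
      · intro x hx
        rw [St.put_m, if_neg (by omega), a1]
    · rintro s₄ hs₄ hf₄ ⟨b1, b2, b3⟩
      simp only [eval_reg, eval_add, eval_mul, eval_lit, St.put_r, a3, a5] at b1 b2 b3
      have q56 : s₄.r 56 = s.m (3 * k + i) := by simpa [a6] using hf₄ 56 (by decide)
      have q39 : s₄.r 39 = quota key t (s.r 39) (L.take (j + 1)) := by
        simpa [a7] using hf₄ 39 (by decide)
      refine ⟨by omega, by rw [q56]; exact h3, ?_, q39, ?_, ?_, ?_⟩
      · intro x hx
        have hxi : x ≠ i := fun h => hnot2 (h ▸ hx)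
        have hxk : x < k := hL x (List.mem_of_mem_drop hx)
        rw [b3 x hxk hxi, St.put_m, if_neg (by omega), a1]
        exact h4 x (List.mem_cons_of_mem _ hx)
      · obtain ⟨f'', hf''⟩ := b1
        refine ⟨f'', ?_⟩
        convert hf'' using 1
        ext x
        by_cases hx : x = i
        · simp [hx, hnot2]
        · simp [hx]
      · intro x hx
        rw [b2 x (by omega), St.put_m, if_neg (by omega), a1, h7 x hx]
      · intro x hx
        rw [b2 _ (by omega), St.put_m]
        by_cases hxi : x = i
        · subst hxi
          rw [if_pos rfl, if_pos (by rw [htake]; simp), a8]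
        · rw [if_neg (by omega), a1, h8 x hx]
          have hm : x ∈ L.take (j + 1) ↔ x ∈ L.take j := by rw [htake]; simp [hxi]
          simp only [hm, hdn' x hxi]
  · rintro s' hs' hf ⟨h2, h3, h4, h5, ⟨f', h6⟩, h7, h8⟩
    rw [List.take_length] at h8
    refine ⟨⟨f', ?_⟩, h7, h8⟩
    convert h6 using 1
    ext x
    simp

end TCAM

namespace TCAM
open TCAM.Expr TCAM.Stmt

variable {B : ℕ}

/-! ### Running the bit matcher on the lists -/

section Round
variable {k W l mask : ℕ} {v : Fin k → ℕ} {E : Finset (Fin k)} {m : ℕ → ℕ} {f : ℕ → List ℕ}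

/-- An odd multiple of `2 ^ l` becomes an even one when `2 ^ l` is added or subtracted. -/
theorem dvd_roundVec (hd : ∀ i, 2 ^ l ∣ v i) (i : Fin k) : 2 ^ (l + 1) ∣ roundVec v l E i := by
  obtain ⟨c, hc⟩ := hd i
  have hdiv : v i / 2 ^ l = c := by rw [hc, Nat.mul_div_cancel_left _ (by positivity)]
  have hodd : i ∈ oddSet v l ↔ c % 2 = 1 := by rw [mem_oddSet, hdiv]
  rw [roundVec, pow_succ]
  split_ifs with h1 h2 <;> rw [hodd] at h1
  · rw [hc, show 2 ^ l * c - 2 ^ l = 2 ^ l * (c - 1) by rw [Nat.mul_sub, mul_one]]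
    exact Nat.mul_dvd_mul_left _ (by omega)
  · rw [hc, ← Nat.mul_succ]
    exact Nat.mul_dvd_mul_left _ (by omega)
  · rw [hc]
    exact Nat.mul_dvd_mul_left _ (by omega)

/-- Serves the lower bound on the complexity when the count exceeds `n` and no selection is carried
out. -/
theorem exists_low_half (hc : (oddSet v l).card % 2 = 0) (B : ℕ) : ∃ E ⊆ oddSet v l,
    2 * E.card = (oddSet v l).card ∧
    ∀ i ∈ E, ∀ j ∈ oddSet v l, j ∉ E → brev B (v i) ≤ brev B (v j) := by
  obtain ⟨U, hU, hcard, htop⟩ := exists_top_subset (S := oddSet v l) (fun i => brev B (v i))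
    ((oddSet v l).card / 2) (by omega)
  refine ⟨oddSet v l \ U, Finset.sdiff_subset, ?_, fun i hi j hj hjE => ?_⟩
  · rw [Finset.card_sdiff_of_subset hU]; omega
  · rw [Finset.mem_sdiff] at hi
    refine htop i hi.1 hi.2 j ?_
    by_contra hc
    exact hjE (Finset.mem_sdiff.2 ⟨hj, hc⟩)

namespace Buckets

theorem testBit_lowbit (hm : mask ≠ 0) : mask.testBit (lowbit mask) = true := by
  rw [Nat.testBit_eq_decide_div_mod_eq]
  simpa using (lowbit_spec (Nat.pos_of_ne_zero hm)).2

theorem ne_nil (hb : Buckets k W m mask Set.univ f) (hm : mask ≠ 0) : f (lowbit mask) ≠ [] :=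
  (hb.mask _).1 (testBit_lowbit hm)

/-- The lowest bit of the mask is the lowest level of any list. Entries outside the lists are `0` or
`2 ^ W`, and the level is less than `W`. -/
theorem dvd_of_lowbit (hb : Buckets k W m mask Set.univ f) (hv : IsPartition W v)
    (hmv : ∀ i : Fin k, m (2 * k + i) = v i) (hm : mask ≠ 0) (i : Fin k) :
    2 ^ lowbit mask ∣ v i := by
  rcases Nat.eq_zero_or_pos (v i) with h0 | h0
  · rw [h0]; exact dvd_zero _
  rcases (hv.le i).eq_or_lt with h1 | h1
  · rw [h1]
    exact pow_dvd_pow _ (hb.level_lt (hb.ne_nil hm)).le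
  refine (pow_dvd_pow _ ?_).trans (lowbit_spec h0).1
  have hi : (i : ℕ) ∈ f (lowbit (v i)) :=
    (hb.mem _ _).2 ⟨trivial, i.2, by rwa [hmv], by rwa [hmv], by rw [hmv]⟩
  have := (hb.mask _).2 (List.ne_nil_of_mem hi)
  rw [Nat.testBit_eq_decide_div_mod_eq] at this
  exact le_of_dvd_of_odd (lowbit_spec (Nat.pos_of_ne_zero hm)).1 (by simpa using this)

/-- As all entries are multiples of `2 ^ l` for this level `l`, being odd at level `l` is the same
as having the lowest digit one there. An entry `2 ^ W` is not odd at a level below `W`. -/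
theorem mem_lowbit (hb : Buckets k W m mask Set.univ f) (hv : IsPartition W v)
    (hmv : ∀ i : Fin k, m (2 * k + i) = v i) (hm : mask ≠ 0) (i : Fin k) :
    (i : ℕ) ∈ f (lowbit mask) ↔ i ∈ oddSet v (lowbit mask) := by
  rw [hb.mem, hmv, mem_oddSet]
  constructor
  · rintro ⟨-, -, h1, -, h2⟩
    rw [← h2]
    exact (lowbit_spec h1).2
  · intro h
    have h1 := lowbit_eq (hb.dvd_of_lowbit hv hmv hm i) h
    have hW := hb.level_lt (hb.ne_nil hm)
    refine ⟨trivial, i.2, Nat.pos_of_ne_zero fun h0 => by simp [h0] at h, ?_, h1⟩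
    refine lt_of_le_of_ne (hv.le i) fun he => ?_
    rw [he] at h1
    have := lowbit_eq (x := 2 ^ W) (j := W) (dvd_refl _) (by simp)
    omega

theorem finSet_lowbit (hb : Buckets k W m mask Set.univ f) (hv : IsPartition W v)
    (hmv : ∀ i : Fin k, m (2 * k + i) = v i) (hm : mask ≠ 0) :
    finSet k (f (lowbit mask)) = oddSet v (lowbit mask) := by
  ext i
  rw [← hb.mem_lowbit hv hmv hm]
  simp [finSet]

theorem length_lowbit (hb : Buckets k W m mask Set.univ f) (hv : IsPartition W v)
    (hmv : ∀ i : Fin k, m (2 * k + i) = v i) (hm : mask ≠ 0) :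
    (f (lowbit mask)).length = (oddSet v (lowbit mask)).card := by
  rw [← hb.finSet_lowbit hv hmv hm, card_finSet (hb.nodup _) fun i hi => ((hb.mem _ i).1 hi).2.1]

end Buckets
end Round

/-- One round: the entries of the lowest level of the mask `r49` are moved to higher levels; half of
their number is added to `r50`. If this exceeds `r4`, the mask is cleared instead. -/
def matchRoundS : Stmt := block [
  set 55 (lowbitE 49), set 49 (reg 49 ^^^ (lit 1 <<< reg 55)), gatherListS,
  set 38 ((reg 37 - reg 36) >>> lit 1), set 50 (reg 50 + reg 38),
  ite (reg 4) (reg 50) (set 49 (lit 0)) (block [splitS, distributeS])]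

theorem run_matchRoundS (hN : WordBound (2 ^ B)) {k W n : ℕ} {s : St} {T : ℕ} {f : ℕ → List ℕ}
    {v : Fin k → ℕ} (h0 : s.r 0 = W) (h1 : s.r 1 = k) (h4 : s.r 4 = n)
    (hb : Buckets k W s.m (s.r 49) Set.univ f) (hmv : ∀ i : Fin k, s.m (2 * k + i) = v i)
    (hv : IsPartition W v) (hm : s.r 49 ≠ 0) (hWB : W + 1 < B) (hB : 8 * k + W + 30 < 2 ^ B)
    (hn : s.r 50 + k < 2 ^ B) (hT : 2049 * (f (lowbit (s.r 49))).length + 60 ≤ T) :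
    Run (2 ^ B) matchRoundS s T fun s' => (∀ x < 2 * k, s'.m x = s.m x) ∧
      s'.r 50 = s.r 50 + (f (lowbit (s.r 49))).length / 2 ∧
      ((n < s'.r 50 ∧ s'.r 49 = 0 ∧
        ∀ N, Zeroes N (ext W v) → (f (lowbit (s.r 49))).length / 2 + 1 ≤ N) ∨
      (s'.r 50 ≤ n ∧ ∃ (v' : Fin k → ℕ) (f' : ℕ → List ℕ), (∀ i : Fin k, s'.m (2 * k + i) = v' i) ∧
        IsPartition W v' ∧ Buckets k W s'.m (s'.r 49) Set.univ f' ∧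
        (∀ i, 2 ^ (lowbit (s.r 49) + 1) ∣ v' i) ∧
        ∀ N, Zeroes N (ext W v) ↔ (f (lowbit (s.r 49))).length / 2 ≤ N ∧
          Zeroes (N - (f (lowbit (s.r 49))).length / 2) (ext W v'))) := by
  apply Run.of_bdd
  intro hbd
  have hlit := hN.lit
  have hne := hb.ne_nil hm
  have hlW := hb.level_lt hne
  have hd := hb.dvd_of_lowbit hv hmv hm
  have hmemL := hb.mem_lowbit hv hmv hm
  have hlen := hb.length_lowbit hv hmv hm
  have heven := card_oddSet_mod hv hlW hd
  have htb := Buckets.testBit_lowbit hm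
  have hLk : ∀ i ∈ f (lowbit (s.r 49)), i < k := fun i hi => ((hb.mem _ i).1 hi).2.1
  have hnd := hb.nodup (lowbit (s.r 49))
  have hch := hb.chain _ hne
  set l := lowbit (s.r 49) with hl
  set L := f l with hL
  have hpos : 0 < L.length := List.length_pos_iff.2 hne
  have hlek : L.length ≤ k := by
    rw [hlen]; simpa using Finset.card_le_univ (oddSet v l)
  have hpl : 2 ^ l < 2 ^ W := Nat.pow_lt_pow_right (by norm_num) hlW
  have hpW : 2 ^ W + 2 ^ W < 2 ^ B := by
    rw [← two_mul, ← pow_succ']; exact Nat.pow_lt_pow_right (by norm_num) hWB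
  have hvB : ∀ i, v i < 2 ^ B := fun i => by rw [← hmv]; exact hbd.2 _
  refine Run.set_seq hN rfl (by omega) (by simp) ?_
  refine Run.set_seq hN rfl (by omega) (by simp [Nat.shiftLeft_eq, ← hl]; omega) ?_
  refine Run.seq (run_gatherListS hN (k := k) (W := W) (L := L) (T := 4 * L.length + 4)
    (by simpa using h0) (by simpa using h1) (by simpa using hlW) (by simpa using hch) hLk hlek
    (by omega) le_rfl) (by omega) ?_
  rintro s₁ hs₁ hf₁ ⟨a1, a2, a3, a4⟩
  simp only [St.set_m] at a3 a4
  have b0 : s₁.r 0 = W := by simpa [h0] using hf₁ 0 (by decide)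
  have b1 : s₁.r 1 = k := by simpa [h1] using hf₁ 1 (by decide)
  have b4 : s₁.r 4 = n := by simpa [h4] using hf₁ 4 (by decide)
  have b49 : s₁.r 49 = s.r 49 ^^^ 2 ^ l := by
    simpa [Nat.shiftLeft_eq, ← hl] using hf₁ 49 (by decide)
  have b50 : s₁.r 50 = s.r 50 := by simpa using hf₁ 50 (by decide)
  have b55 : s₁.r 55 = l := by simpa [← hl] using hf₁ 55 (by decide)
  have h38 : (s₁.r 37 - s₁.r 36) >>> 1 = L.length / 2 := by
    rw [a1, a2, Nat.shiftRight_eq_div_pow, Nat.add_sub_cancel_left, pow_one]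
  refine Run.set_seq hN rfl (by omega) (by simp) ?_
  refine Run.set_seq hN rfl (by omega) (by simp [h38, b50]; omega) ?_
  refine Run.ite (by omega) (by simp) (by simp) (fun h => ?_) fun h => ?_
  · simp [h38, b50, b4] at h
    refine Run.set hN rfl (by omega) (by simp) ?_
    simp only [eval_reg, eval_add, eval_lit, eval_shr, eval_sub, St.set_r, St.set_m]
    norm_num [h38, b50]
    refine ⟨fun x hx => a4 x (by omega), .inl ⟨h, fun N hz => ?_⟩⟩
    -- The round costs half the length of the list, and the partition left over still needs a
    -- transaction.
    obtain ⟨E, hE, hEc, hmin⟩ := exists_low_half heven B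
    obtain ⟨h2, h3⟩ := (zeroes_roundVec_iff hlW hd hE hEc hvB hmin N).1 hz
    have := h3.one_le fun h => by simpa using congrFun h none
    omega
  · simp [h38, b50, b4] at h
    refine Run.seq (run_splitS hN (n := L.length) (T := 2020 * L.length + 30) (by simp; omega)
      (by simp [h38]; omega) (by simp; omega) le_rfl) (by omega) ?_
    rintro s₂ hs₂ hf₂ ⟨c1, c2, c3⟩
    simp only [eval_reg, eval_add, eval_lit, eval_shr, eval_sub, St.set_r, St.set_m] at c1 c2 c3
    norm_num [h38, b50] at c1 c2 c3
    rw [a1, a3] at c1 c2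
    have d0 : s₂.r 0 = W := by simpa [b0] using hf₂ 0 (by decide)
    have d1 : s₂.r 1 = k := by simpa [b1] using hf₂ 1 (by decide)
    have d49 : s₂.r 49 = s.r 49 ^^^ 2 ^ l := by simpa [b49] using hf₂ 49 (by decide)
    have d50 : s₂.r 50 = s.r 50 + L.length / 2 := by simpa [b50, h38] using hf₂ 50 (by decide)
    have d55 : s₂.r 55 = l := by simpa [b55] using hf₂ 55 (by decide)
    have hmem : ∀ x < 4 * k + W + 1, s₂.m x = s.m x := fun x hx => by
      rw [c3 x (by omega), a4 x hx]
    refine Run.conseq (run_distributeS hN (k := k) (W := W) (L := L) (f := Function.update f l [])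
      (T := 25 * L.length + 3) d0 d1 (by omega) hnd ?_ hLk ?_ ?_ (by omega) (by omega) le_rfl)
      (by omega) ?_
    · rw [d55, hmem _ (by omega)]
      exact hch.congr fun i hi => hmem _ (by have := hLk i hi; omega)
    · refine (hb.erase (l := l) (mask' := s₂.r 49) (I' := {i | i ∉ L}) (by simp [hL]) ?_).congr
        ?_ ?_ ?_
      · intro j
        rw [d49, Nat.testBit_xor, Nat.testBit_two_pow]
        by_cases hj : j = l
        · subst hj; simp [htb]
        · simp [hj, Ne.symm hj]
      · exact fun i _ hi => hmem _ (by omega)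
      · exact fun i _ hi => hmem _ (by omega)
      · exact fun j hj => hmem _ (by omega)
    · intro i hi
      have hik := hLk i hi
      have h2 := hmv ⟨i, hik⟩
      simp only at h2
      have h3 := hv.le ⟨i, hik⟩
      rw [d55, hmem _ (by omega), h2]
      omega
    · rintro s₃ hs₃ hf₃ ⟨⟨f', e1⟩, e2, e3⟩
      have g50 : s₃.r 50 = s.r 50 + L.length / 2 := by simpa [d50] using hf₃ 50 (by decide)
      have hval : ∀ i < k, s₂.m (2 * k + i) = s.m (2 * k + i) := fun i hi => hmem _ (by omega)
      set key := fun i => brev B (s.m (2 * k + i)) with hkey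
      have hD : downs (fun i => brev B (s₂.m (2 * k + i))) (brev B (s₂.r 22)) (s₂.r 39) L =
          downs key (brev B (s₂.r 22)) (s₂.r 39) L := by
        have : ∀ L : List ℕ, (∀ i ∈ L, i < k) → ∀ q,
            downs (fun i => brev B (s₂.m (2 * k + i))) (brev B (s₂.r 22)) q L =
            downs key (brev B (s₂.r 22)) q L := by
          intro L
          induction L with
          | nil => intros; rfl
          | cons i L ih =>
            intro h q
            rw [downs, downs, ih (fun i hi => h i (List.mem_cons_of_mem _ hi)),
              ih (fun i hi => h i (List.mem_cons_of_mem _ hi)),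
              hval i (h i (List.mem_cons_self ..))]
        exact this L hLk _
      rw [hD, d55] at e3
      set E := downs key (brev B (s₂.r 22)) (s₂.r 39) L with hE
      have hEL : E.Sublist L := downs_sublist _ _
      have hEcard : (finSet k E).card = L.length / 2 := by
        rw [card_finSet (hEL.nodup hnd) fun i hi => hLk i (hEL.subset hi), hE, c2]
        exact length_downs_isRank c1
      have hEO : finSet k E ⊆ oddSet v l := fun i hi =>
        (hmemL i).1 (hEL.subset (by simpa [finSet] using hi))
      have hEc : 2 * (finSet k E).card = (oddSet v l).card := by omega
      refine ⟨fun x hx => by rw [e2 x hx, hmem x (by omega)], g50, .inr ⟨by omega,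
        roundVec v l (finSet k E), f', fun i => ?_, isPartition_roundVec hv hEO hEc, e1,
        dvd_roundVec hd, fun N => ?_⟩⟩
      · rw [e3 i i.2, hval i i.2, hmv, roundVec]
        simp [hmemL i, finSet]
      · rw [← hEcard]
        refine zeroes_roundVec_iff hlW hd hEO hEc hvB ?_ N
        intro i hi j hj hjE
        have := downs_le (key := key) (i := (i : ℕ)) (j := (j : ℕ))
          (by simpa [finSet] using hi) ((hmemL j).2 hj) (fun h => hjE (by simpa [finSet] using h))
        simpa [hkey, hmv] using this

/-- For the partition from the address `2 * k` on: register `50` gets a number that is at most `r4`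
if and only if the complexity is at most `r4`. -/
def matchS : Stmt := block [
  set 49 (lit 0), set 51 (lit 0),
  loop (reg 51) (reg 1) (block [
    set 26 (load (lit 2 * reg 1 + reg 51)), insertS, set 51 (reg 51 + lit 1)]),
  set 50 (lit 1),
  loop (lit 0) (reg 49) matchRoundS]

/-- The counter starts at `1`, for the transaction that is needed when all the lists are empty. It
exceeds `n` only if the complexity does. The running time is proportional to the total length `M` of
the lists, which is at most `k` per level and at most twice the number of transfers counted. -/
theorem run_matchS (hN : WordBound (2 ^ B)) {k W n : ℕ} {s : St} {T : ℕ}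
    {X : Fin k → ℕ} (h0 : s.r 0 = W) (h1 : s.r 1 = k) (h4 : s.r 4 = n) (hn1 : 1 ≤ n)
    (hmX : ∀ i : Fin k, s.m (2 * k + i) = X i) (hX : IsPartition W X) (hWB : W + 1 < B)
    (hB : 8 * k + W + 30 < 2 ^ B) (hn : n + k < 2 ^ B)
    (hT : 2101 * (min (W * k) (2 * n * Nat.log2 k) + k) + 13 * k + 20 ≤ T) :
    Run (2 ^ B) matchS s T fun s' => (∀ x < 2 * k, s'.m x = s.m x) ∧
      (s'.r 50 ≤ n ↔ Zeroes n (ext W X)) := by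
  have hlit := hN.lit
  refine Run.set_seq hN rfl (by omega) (by simp) ?_
  refine Run.set_seq hN rfl (by omega) (by simp) ?_
  refine Run.seq (T₁ := 13 * k + 1) (Q := fun t => (∀ x < 3 * k, t.m x = s.m x) ∧
      ∃ f, Buckets k W t.m (t.r 49) Set.univ f) ?_ (by omega) ?_
  · refine Run.for_loop (fun j t => j ≤ k ∧ t.r 51 = j ∧ (∀ x < 3 * k, t.m x = s.m x) ∧
      ∃ f, Buckets k W t.m (t.r 49) {i | i < j} f) k 12 ?_ (by omega) ?_ ?_ ?_
    · refine ⟨Nat.zero_le _, by simp, fun x _ => rfl, fun _ => [], ?_⟩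
      exact ⟨by simp, by simp, by simp, by simp⟩
    · rintro j t ht hf ⟨e1, e2, e3, e4⟩
      have g1 : t.r 1 = k := by simpa [h1] using hf 1 (by decide)
      simp [e2, g1]
    · rintro j t ht hf hj ⟨e1, e2, e3, f, e4⟩
      have g0 : t.r 0 = W := by simpa [h0] using hf 0 (by decide)
      have g1 : t.r 1 = k := by simpa [h1] using hf 1 (by decide)
      refine Run.set_seq hN rfl (by omega) (by simp [g1, e2]; omega) ?_
      refine Run.seq (run_insertS hN (k := k) (W := W) (I := {i | i < j}) (f := f) (T := 10)
        (by simpa using g0) (by simpa using g1) (by simpa using e4) (by simpa [e2] using hj)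
        (by simp [e2]) (by simp [g1, e2]) (by omega) (by omega) le_rfl) (by omega) ?_
      rintro t' ht' hf' ⟨⟨f', a1⟩, a2, a3⟩
      simp [e2] at a1 a2 a3
      have g51 : t'.r 51 = j := by simpa [e2] using hf' 51 (by decide)
      refine Run.set hN rfl (by omega) (by simp [g51]; omega) ?_
      refine ⟨hj, by simp [g51], fun x hx => by simp [a2 x hx, e3 x hx], f', ?_⟩
      rw [show {i | i < j + 1} = insert j {i | i < j} by
        ext i
        simp only [Set.mem_ofPred_eq, Set.mem_insert_iff]
        omega]
      simpa using a1
    · rintro t ht hf ⟨e1, e2, e3, f, e4⟩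
      refine ⟨e3, f, ?_⟩
      exact ⟨fun j i => by rw [e4.mem]; simp, e4.nodup, e4.chain, e4.mask⟩
  rintro s₁ hs₁ hf₁ ⟨a1, f, a2⟩
  have b0 : s₁.r 0 = W := by simpa [h0] using hf₁ 0 (by decide)
  have b1 : s₁.r 1 = k := by simpa [h1] using hf₁ 1 (by decide)
  have b4 : s₁.r 4 = n := by simpa [h4] using hf₁ 4 (by decide)
  refine Run.set_seq hN rfl (by omega) (by simp) ?_
  set R := min (W * k) (2 * n * Nat.log2 k) with hR
  -- Each list entry processed is charged `2101` units. `M` counts them, `c` is the number of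
  -- transfers so far, and all the levels done are below `lo`. The additional `k` in the budget pays
  -- for a last round in which the counter exceeds `n`.
  refine Run.loop (fun τ t => (∀ x < 2 * k, t.m x = s.m x) ∧
    ((t.r 49 = 0 ∧ n < t.r 50 ∧ ¬ Zeroes n (ext W X) ∧ 1 ≤ τ) ∨
    ∃ (v : Fin k → ℕ) (f : ℕ → List ℕ) (c M lo : ℕ), (∀ i : Fin k, t.m (2 * k + i) = v i) ∧
      IsPartition W v ∧ Buckets k W t.m (t.r 49) Set.univ f ∧ (∀ i, 2 ^ lo ∣ v i) ∧
      (∀ N, Zeroes N (ext W X) ↔ c ≤ N ∧ Zeroes (N - c) (ext W v)) ∧ t.r 50 = c + 1 ∧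
      c + 1 ≤ n ∧ M ≤ 2 * c * Nat.log2 k ∧ M ≤ lo * k ∧ lo ≤ W ∧
      2101 * (R + k) + 10 ≤ τ + 2101 * M)) ?_ ?_
  · refine ⟨fun x hx => by simpa using a1 x (by omega), .inr ⟨X, f, 0, 0, 0, fun i => ?_, hX,
      by simpa using a2, by simp, by simp, by simp, hn1, by simp, by simp, by simp, by omega⟩⟩
    rw [St.set_m, a1 _ (by omega), hmX]
  · rintro τ t ht hf ⟨e1, e2⟩
    have g0 : t.r 0 = W := by simpa [b0] using hf 0 (by decide)
    have g1 : t.r 1 = k := by simpa [b1] using hf 1 (by decide)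
    have g4 : t.r 4 = n := by simpa [b4] using hf 4 (by decide)
    rcases e2 with ⟨e2, e3, e4, e5⟩ | ⟨v, f, c, M, lo, e2, e3, e4, e5, e6, e7, e8, e9, e10, e11, e12⟩
    · refine ⟨by simp, by simp, fun h => by simp [e2] at h, fun _ => ⟨e5, e1, ?_⟩⟩
      exact iff_of_false (by omega) e4
    have hMR : M ≤ R := le_min (e10.trans (Nat.mul_le_mul_right _ e11))
      (e9.trans (Nat.mul_le_mul_right _ (by omega)))
    refine ⟨by simp, by simp, fun h => ?_, fun h => ⟨by omega, e1, ?_⟩⟩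
    · have hm : t.r 49 ≠ 0 := by
        simp only [eval_lit, eval_reg] at h; omega
      have hlen := e4.length_lowbit e3 e2 hm
      have hne := e4.ne_nil hm
      have hlW := e4.level_lt hne
      have heven := card_oddSet_mod e3 hlW (e4.dvd_of_lowbit e3 e2 hm)
      have hlek : (f (lowbit (t.r 49))).length ≤ k := by
        rw [hlen]; simpa using Finset.card_le_univ (oddSet v (lowbit (t.r 49)))
      have hpos := List.length_pos_iff.2 hne
      have hlo : lo ≤ lowbit (t.r 49) := by
        obtain ⟨i, hi⟩ := List.exists_mem_of_ne_nil _ hne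
        have hik := ((e4.mem _ i).1 hi).2.1
        exact le_of_dvd_of_odd (e5 ⟨i, hik⟩)
          (mem_oddSet.1 ((e4.mem_lowbit e3 e2 hm ⟨i, hik⟩).1 hi))
      -- The list is not empty and has even length, so it has at least two entries and the additive
      -- constant `60` is absorbed.
      have hrun := run_matchRoundS hN g0 g1 g4 e4 e2 e3 hm hWB hB (by omega)
        (T := 2100 * (f (lowbit (t.r 49))).length) (by omega)
      set l := lowbit (t.r 49) with hl
      set len := (f l).length with hlendef
      refine ⟨_, ?_, hrun.conseq le_rfl ?_⟩
      · omega
      · rintro t' ht' hf' ⟨q1, q2, q3⟩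
        refine ⟨fun x hx => by rw [q1 x hx, e1 x hx], ?_⟩
        rcases q3 with ⟨q3, q4, q5⟩ | ⟨q3, v', f', q4, q5, q6, q7, q8⟩
        · refine .inl ⟨q4, q3, fun hz => ?_, by omega⟩
          have h2 := (e6 n).1 hz
          have := q5 _ h2.2
          omega
        · have hlog : 1 ≤ Nat.log2 k := by
            rw [Nat.le_log2 (by omega)]; omega
          refine .inr ⟨v', f', c + len / 2, M + len, l + 1, q4, q5, q6, q7, fun N => ?_, by omega,
            by omega, ?_, ?_, hlW, by omega⟩
          · rw [e6, q8]
            constructor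
            · rintro ⟨h2, h3, h4⟩
              exact ⟨by omega, by rwa [Nat.sub_add_eq]⟩
            · rintro ⟨h2, h3⟩
              exact ⟨by omega, by omega, by rwa [Nat.sub_add_eq] at h3⟩
          · calc M + len ≤ 2 * c * Nat.log2 k + len * Nat.log2 k :=
                  Nat.add_le_add e9 (Nat.le_mul_of_pos_right _ hlog)
              _ = _ := by
                rw [← add_mul, mul_add]; congr 2; omega
          · calc M + len ≤ l * k + k :=
                  Nat.add_le_add (e10.trans (Nat.mul_le_mul_right _ hlo)) hlek
              _ = _ := by rw [Nat.succ_mul]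
    · simp only [eval_lit, eval_reg] at h
      have hm : t.r 49 = 0 := by omega
      have hz := e6 n
      rw [zeroes_iff_of_single e3] at hz
      · rw [hz, e7]; omega
      · intro i
        by_contra hc
        push Not at hc
        have hi : (i : ℕ) ∈ f (lowbit (v i)) :=
          (e4.mem _ _).2 ⟨trivial, i.2, by rw [e2]; omega, by rw [e2]; omega, by rw [e2]⟩
        have := (e4.mask _).2 (List.ne_nil_of_mem hi)
        simp [hm] at this

end TCAM

namespace TCAM
open TCAM.Expr TCAM.Stmt

variable {B : ℕ}

/-! ### The programs -/

/-- Copies the partition from the address `2 * k` to the beginning. -/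
def copyS : Stmt := block [
  set 43 (lit 0),
  loop (reg 43) (reg 1) (block [
    store (reg 43) (load (lit 2 * reg 1 + reg 43)), set 43 (reg 43 + lit 1)])]

theorem run_copyS (hN : WordBound (2 ^ B)) {s : St} {T k : ℕ} (h1 : s.r 1 = k)
    (hB : 3 * k < 2 ^ B) (hT : 3 * k + 2 ≤ T) :
    Run (2 ^ B) copyS s T fun s' => ∀ i < k, s'.m i = s.m (2 * k + i) := by
  have hlit := hN.lit
  refine Run.set_seq hN rfl (by omega) (by simp) ?_
  refine Run.for_loop (fun j s' => j ≤ k ∧ s'.r 43 = j ∧ (∀ i < j, s'.m i = s.m (2 * k + i)) ∧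
    ∀ x, k ≤ x → s'.m x = s.m x) k 2 ?_ (by omega) ?_ ?_ ?_
  · simp
  · rintro j t ht hf ⟨e1, e2, e3, e4⟩
    have g1 : t.r 1 = k := by simpa [h1] using hf 1 (by decide)
    simp [e2, g1]
  · rintro j t ht hf hj ⟨e1, e2, e3, e4⟩
    have g1 : t.r 1 = k := by simpa [h1] using hf 1 (by decide)
    refine Run.store_seq hN rfl (by omega) (by simp) (by simp [g1, e2]; omega) ?_
    refine Run.set hN rfl (by omega) (by simp [e2]; omega) ?_
    simp [g1, e2]
    refine ⟨by omega, fun i hi => ?_, fun x hx => ?_⟩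
    · rw [St.put_m]
      split_ifs with h
      · rw [h, e4 _ (by omega)]
      · exact e3 i (by omega)
    · rw [St.put_m, if_neg (by omega), e4 x hx]
  · rintro t ht hf ⟨e1, e2, e3, e4⟩
    exact e3

/-- Bounded-error problem for `W = r0`, `k = r1` and the error `r2 / r3`. -/
def errorS (D : OneSidedDistance) : Stmt := block [buildS D, copyS]

/-- Bounded-length problem for `W = r0`, `k = r1` and the bound `r2`. The error bound `r5 / r3` with
the denominator `2 ^ (2 * W)` is kept infeasible, and `(r5 + 2 * r6) / r3` is kept feasible. -/
def lengthS (D : OneSidedDistance) : Stmt := block [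
  set 4 (reg 2), set 3 (lit 1 <<< (lit 2 * reg 0)), set 5 (lit 0),
  set 6 (lit 1 <<< (lit 3 * reg 0)),
  loop (lit 0) (reg 6) (block [
    set 2 (reg 5 + reg 6), buildS D, matchS,
    ite (reg 4) (reg 50) (set 5 (reg 2)) skip,
    set 6 (reg 6 >>> lit 1)]),
  set 2 (reg 5 + lit 1), errorS D]

section WordBounds
variable {w W k a b : ℕ} {P : Fin k → ℕ} {D : OneSidedDistance}

theorem wordBound_twenty (hw : 2 ≤ w) : WordBound (2 ^ (20 * w)) :=
  ⟨⟨_, rfl⟩, lt_of_lt_of_le (by norm_num)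
    (Nat.pow_le_pow_right (by norm_num) (show 40 ≤ 20 * w by omega) : 2 ^ 40 ≤ 2 ^ (20 * w))⟩

theorem two_pow_mul_le (hw : 2 ≤ w) : 2 ^ w * 1000 ≤ 2 ^ (20 * w) := by
  calc 2 ^ w * 1000 ≤ 2 ^ w * 2 ^ 38 := Nat.mul_le_mul_left _ (by norm_num)
    _ = 2 ^ (w + 38) := by rw [pow_add]
    _ ≤ _ := Nat.pow_le_pow_right (by norm_num) (by omega)

theorem weight_le (hP : IsPartition W P) (hW : W < w) (i : Fin k) : D.weight (P i) ≤ 2 ^ w := by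
  cases D
  · exact Nat.one_le_two_pow
  · exact (hP.le i).trans (Nat.pow_le_pow_right (by norm_num) hW.le)

/-- The bound `2 ^ (6 * w)` on `a` covers the numerators of the binary search, which do not exceed
`2 ^ (3 * W + 1)`. A weight adds `w` bits, and the addition one more. -/
theorem add_mul_weight_le (hP : IsPartition W P) (hW : W < w) (ha : a ≤ 2 ^ (6 * w)) (i : Fin k) :
    P i + a * D.weight (P i) ≤ 2 ^ (8 * w) := by
  have h1 : a * D.weight (P i) ≤ 2 ^ (7 * w) := by
    rw [show 7 * w = 6 * w + w by ring, pow_add]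
    exact Nat.mul_le_mul ha (weight_le hP hW i)
  have h2 : P i ≤ 2 ^ (7 * w) :=
    (hP.le i).trans (Nat.pow_le_pow_right (by norm_num) (by omega))
  have h3 : 2 ^ (7 * w) * 2 ≤ 2 ^ (8 * w) := by
    rw [← pow_succ]; exact Nat.pow_le_pow_right (by norm_num) (by omega)
  omega

theorem add_mul_weight_lt (hP : IsPartition W P) (hW : W < w) (ha : a ≤ 2 ^ (6 * w)) (i : Fin k) :
    P i + a * D.weight (P i) < 2 ^ (20 * w) :=
  lt_of_le_of_lt (add_mul_weight_le hP hW ha i) (Nat.pow_lt_pow_right (by norm_num) (by omega))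

theorem sum_upper_lt (hP : IsPartition W P) (hW : W < w) (hk : k < 2 ^ w) (ha : a ≤ 2 ^ (6 * w)) :
    ∑ i, D.upper a b (P i) < 2 ^ (20 * w) := by
  have h1 : ∀ i, D.upper a b (P i) ≤ 2 ^ (8 * w) := fun i => by
    refine le_trans ?_ (add_mul_weight_le (D := D) hP hW ha i)
    exact Nat.add_le_add_left ((Nat.div_le_self _ _).trans (Nat.sub_le _ _)) _
  calc ∑ i, D.upper a b (P i) ≤ ∑ _i : Fin k, 2 ^ (8 * w) := Finset.sum_le_sum fun i _ => h1 i
    _ = k * 2 ^ (8 * w) := by simp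
    _ ≤ 2 ^ w * 2 ^ (8 * w) := Nat.mul_le_mul_right _ hk.le
    _ = 2 ^ (9 * w) := by rw [← pow_add]; congr 1; ring
    _ < _ := Nat.pow_lt_pow_right (by norm_num) (by omega)

end WordBounds

/-- Time for the construction. -/
def buildTime (W k : ℕ) : ℕ := (Nat.log2 W + 1) * (3 * k + 9) + 2050 * k + 60

/-- Time for the decision about the complexity. -/
def matchTime (W k n : ℕ) : ℕ := 2101 * (min (W * k) (2 * n * Nat.log2 k) + k) + 13 * k + 20

theorem Run.exists_outputsWithin {k : ℕ} {st : Stmt} {bits : ℕ} {args : List ℕ} {P : Fin k → ℕ}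
    {T : ℕ} {S : (Fin k → ℕ) → Prop} (hbits : 1000 < 2 ^ bits) (hw : st.wf 100 1000 = true)
    (hb : (initSt args P).Bdd (2 ^ bits))
    (h : Run (2 ^ bits) st (initSt args P) T fun s => ∃ out, S out ∧ ∀ i : Fin k, s.m i = out i)
    {τ : ℝ} (hτ : ((st.unit * T : ℕ) : ℝ) ≤ τ) :
    ∃ out, S out ∧ Program.OutputsWithin (st.comp 0) bits (initial args P) out τ := by
  obtain ⟨t, s', ht, he, hbd, out, hS, hm⟩ := h hb
  exact ⟨out, hS, Run.outputsWithin hbits hw hb (fun _ => ⟨t, s', ht, he, hbd, hm⟩) hτ⟩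

theorem run_errorS (D : OneSidedDistance) {w W k : ℕ} {P : Fin k → ℕ} {s : St}
    (hW : 1 ≤ W) (hWw : W < w) (hk : k < 2 ^ w) (h0 : s.r 0 = W) (h1 : s.r 1 = k)
    (h2 : 0 < s.r 2) (h2w : s.r 2 ≤ 2 ^ (6 * w)) (h3 : 0 < s.r 3)
    (hP : IsPartition W P) (hD : D.DefinedAt P) (hPm : ∀ i : Fin k, s.m i = P i) {T : ℕ}
    (hT : buildTime W k + 3 * k + 2 ≤ T) :
    Run (2 ^ (20 * w)) (errorS D) s T fun s' => ∃ P' : Fin k → ℕ,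
      IsBoundedErrorSolution D W ((s.r 2 : ℝ) / (s.r 3 : ℝ)) P P' ∧
      ∀ i : Fin k, s'.m i = P' i := by
  have hN := wordBound_twenty (show 2 ≤ w by omega)
  have h1000 := two_pow_mul_le (show 2 ≤ w by omega)
  have hwlt : w < 2 ^ w := Nat.lt_two_pow_self
  refine Run.seq (run_buildS hN D (T := buildTime W k) hP hD hW h0 h1 h2 h3 hPm (by omega)
    (by omega) (fun i => add_mul_weight_lt hP hWw h2w i) (sum_upper_lt hP hWw hk h2w) le_rfl)
    (by omega) ?_
  rintro t ht hf ⟨-, X, e1, e2⟩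
  have g1 : t.r 1 = k := by
    simpa [h1] using hf 1 (by cases D <;> decide)
  refine Run.conseq (run_copyS hN g1 (by omega) le_rfl) (by omega) fun t' _ _ h => ⟨X, e2, ?_⟩
  intro i
  rw [h i i.2, e1]

/-! ### Binary search for the smallest distance -/

/-- Some partition of complexity at most `n` is at distance less than `a / b`. -/
def Feasible {k : ℕ} (D : OneSidedDistance) (W n a b : ℕ) (P : Fin k → ℕ) : Prop :=
  ∃ Q, IsPartition W Q ∧ complexity W Q ≤ n ∧ D.dist Q P < (a : ℝ) / b

section Feasible
variable {k W n a b : ℕ} {P X : Fin k → ℕ} {D : OneSidedDistance}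

theorem IsBoundedErrorSolution.feasible_iff
    (h : IsBoundedErrorSolution D W ((a : ℝ) / b) P X) :
    Feasible D W n a b P ↔ complexity W X ≤ n :=
  ⟨fun ⟨Q, h1, h2, h3⟩ => (h.2 Q h1 h3).trans h2, fun hX => ⟨X, h.1.1, hX, h.1.2⟩⟩

/-- The lower end of the search: distances between partitions are not negative, and the inequality
is strict. -/
theorem not_feasible_zero (hP : IsPartition W P) : ¬ Feasible D W n 0 b P := by
  rintro ⟨Q, h1, -, h3⟩
  have := OneSidedDistance.dist_nonneg (D := D) hP h1
  simp at h3
  linarith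

/-- The upper end of the search: one target with all the weight has complexity `1`, and every
distance is at most `2 ^ W`, which is less than the bound `2 ^ (W + 1)`. -/
theorem feasible_top (hP : IsPartition W P) (hD : D.DefinedAt P) (hn : 1 ≤ n) :
    Feasible D W n (2 ^ (3 * W + 1)) (2 ^ (2 * W)) P := by
  have hQ := isPartition_single W (⟨0, hP.pos⟩ : Fin k)
  refine ⟨_, hQ, ((complexity_le_iff hQ).2 (zeroes_single W _)).trans hn,
    lt_of_le_of_lt (OneSidedDistance.dist_le hP hQ hD) ?_⟩
  push_cast
  rw [lt_div_iff₀ (by positivity), ← pow_add]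
  exact pow_lt_pow_right₀ (by norm_num) (by omega)

/-- A partition closer than `X` and of complexity at most `n` would be closer by at least `1 / 2 ^
(2 * W)`, hence at distance less than `a / 2 ^ (2 * W)`, which is infeasible. -/
theorem isBoundedLengthSolution_of_feasible (hP : IsPartition W P) (hD : D.DefinedAt P)
    (h0 : ¬ Feasible D W n a (2 ^ (2 * W)) P) (h1 : Feasible D W n (a + 1) (2 ^ (2 * W)) P)
    (hX : IsBoundedErrorSolution D W (((a + 1 : ℕ) : ℝ) / ((2 ^ (2 * W) : ℕ) : ℝ)) P X) :
    IsBoundedLengthSolution D W n P X := by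
  refine ⟨⟨hX.1.1, hX.feasible_iff.1 h1⟩, fun Q hQ hQn => ?_⟩
  by_contra hlt
  push Not at hlt
  refine h0 ⟨Q, hQ, hQn, ?_⟩
  have h2 := OneSidedDistance.dist_gap hP hD hlt
  have h3 := hX.1.2
  push_cast at h3 ⊢
  rw [add_div] at h3
  linarith

end Feasible

theorem run_lengthS (D : OneSidedDistance) {w W k n : ℕ} {P : Fin k → ℕ} {s : St}
    (hW : 1 ≤ W) (hWw : W < w) (hk : k < 2 ^ w) (h0 : s.r 0 = W) (h1 : s.r 1 = k)
    (h2 : s.r 2 = n) (hn : 1 ≤ n) (hnw : n < 2 ^ w)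
    (hP : IsPartition W P) (hD : D.DefinedAt P) (hPm : ∀ i : Fin k, s.m i = P i) {T : ℕ}
    (hT : (3 * W + 1) * (buildTime W k + matchTime W k n + 5) + buildTime W k + 3 * k + 8 ≤ T) :
    Run (2 ^ (20 * w)) (lengthS D) s T fun s' =>
      ∃ P' : Fin k → ℕ, IsBoundedLengthSolution D W n P P' ∧ ∀ i : Fin k, s'.m i = P' i := by
  have hN := wordBound_twenty (show 2 ≤ w by omega)
  have h1000 := two_pow_mul_le (show 2 ≤ w by omega)
  have hwlt : w < 2 ^ w := Nat.lt_two_pow_self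
  have hB : ∀ a ≤ 3 * w, 2 ^ a * 4 ≤ 2 ^ (6 * w) := fun a ha => by
    rw [show 4 = 2 ^ 2 by norm_num, ← pow_add]
    exact Nat.pow_le_pow_right (by norm_num) (by omega)
  have hB3 := hB (3 * W) (by omega)
  have hB2 := hB (2 * W) (by omega)
  have h620 : 2 ^ (6 * w) < 2 ^ (20 * w) := Nat.pow_lt_pow_right (by norm_num) (by omega)
  have hpos : 0 < 2 ^ (2 * W) := by positivity
  refine Run.set_seq hN rfl (by omega) (by simp) ?_
  refine Run.set_seq hN rfl (by omega) (by simp [h0, Nat.shiftLeft_eq]; omega) ?_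
  refine Run.set_seq hN rfl (by omega) (by simp) ?_
  refine Run.set_seq hN rfl (by omega) (by simp [h0, Nat.shiftLeft_eq]; omega) ?_
  set R := 3 * W + 1 with hR
  refine Run.seq (T₁ := R * (buildTime W k + matchTime W k n + 5) + 1) (Q := fun t =>
    t.r 0 = W ∧ t.r 1 = k ∧ t.r 3 = 2 ^ (2 * W) ∧ t.r 5 + 1 ≤ 2 ^ R ∧
    (∀ i : Fin k, t.m i = P i) ∧ ¬ Feasible D W n (t.r 5) (2 ^ (2 * W)) P ∧
    Feasible D W n (t.r 5 + 1) (2 ^ (2 * W)) P) ?_ (by omega) ?_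
  -- The interval between an infeasible and a feasible numerator has length `2 ^ (R - j)`. After `R`
  -- rounds the length is `1`, and the step `2 ^ (R - j) / 2` is `0`, which ends the loop.
  · refine Run.for_loop (fun j t => j ≤ R ∧ t.r 0 = W ∧ t.r 1 = k ∧ t.r 3 = 2 ^ (2 * W) ∧
      t.r 4 = n ∧ t.r 6 = 2 ^ (R - j) / 2 ∧ t.r 5 + 2 ^ (R - j) ≤ 2 ^ R ∧
      (∀ i : Fin k, t.m i = P i) ∧ ¬ Feasible D W n (t.r 5) (2 ^ (2 * W)) P ∧
      Feasible D W n (t.r 5 + 2 ^ (R - j)) (2 ^ (2 * W)) P) R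
      (buildTime W k + matchTime W k n + 4) ?_ le_rfl ?_ ?_ ?_
    · simp [h0, h1, h2, hPm, Nat.shiftLeft_eq, not_feasible_zero hP]
      exact ⟨by rw [hR, pow_succ]; omega, feasible_top hP hD hn⟩
    · rintro j t ht hf ⟨e1, e2, e3, e4, e5, e6, e7⟩
      refine ⟨by simp, by simp, ?_⟩
      simp only [eval_lit, eval_reg, e6]
      rcases Nat.eq_zero_or_pos (R - j) with h | h
      · simp [h]; omega
      · obtain ⟨d, hd⟩ := Nat.exists_eq_add_of_le h
        rw [hd, add_comm, pow_succ, Nat.mul_div_cancel _ (by norm_num)]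
        have : 0 < 2 ^ d := by positivity
        omega
    · rintro j t ht hf hj ⟨e1, e2, e3, e4, e5, e6, e7, e8, e9, e10⟩
      obtain ⟨d, hd⟩ := Nat.exists_eq_add_of_le (show 1 ≤ R - j by omega)
      have hd1 : R - (j + 1) = d := by omega
      rw [hd, add_comm 1 d, pow_succ] at e6 e7 e10
      rw [Nat.mul_div_cancel _ (by norm_num)] at e6
      have hdpos : 0 < 2 ^ d := by positivity
      have hRB : 2 ^ R ≤ 2 ^ (6 * w) := Nat.pow_le_pow_right (by norm_num) (by omega)
      refine Run.set_seq hN rfl (by omega) (by simp; omega) ?_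
      refine Run.seq (run_buildS hN D (k := k) (W := W) (P := P) (T := buildTime W k) hP hD hW
        (by simpa using e2) (by simpa using e3) (by simp; omega) (by simp; omega)
        (by simpa using e8) (by omega) (by omega)
        (fun i => add_mul_weight_lt hP hWw (by simp; omega) i)
        (sum_upper_lt hP hWw hk (by simp; omega)) le_rfl) (by omega) ?_
      rintro t₁ ht₁ hf₁ ⟨a1, X, a2, a3⟩
      have b0 : t₁.r 0 = W := by simpa [e2] using hf₁ 0 (by cases D <;> decide)
      have b1 : t₁.r 1 = k := by simpa [e3] using hf₁ 1 (by cases D <;> decide)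
      have b2 : t₁.r 2 = t.r 5 + 2 ^ d := by simpa [e6] using hf₁ 2 (by cases D <;> decide)
      have b3 : t₁.r 3 = 2 ^ (2 * W) := by simpa [e4] using hf₁ 3 (by cases D <;> decide)
      have b4 : t₁.r 4 = n := by simpa [e5] using hf₁ 4 (by cases D <;> decide)
      have b5 : t₁.r 5 = t.r 5 := by simpa using hf₁ 5 (by cases D <;> decide)
      have b6 : t₁.r 6 = 2 ^ d := by simpa [e6] using hf₁ 6 (by cases D <;> decide)
      simp only [eval_reg, eval_add, St.set_r] at a3
      norm_num at a3
      refine Run.seq (run_matchS hN (T := matchTime W k n) b0 b1 b4 hn a2 a3.1.1 (by omega)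
        (by omega) (by omega) le_rfl) (by omega) ?_
      rintro t₂ ht₂ hf₂ ⟨c1, c2⟩
      have d0 : t₂.r 0 = W := by simpa [b0] using hf₂ 0 (by decide)
      have d1 : t₂.r 1 = k := by simpa [b1] using hf₂ 1 (by decide)
      have d2 : t₂.r 2 = t.r 5 + 2 ^ d := by simpa [b2] using hf₂ 2 (by decide)
      have d3 : t₂.r 3 = 2 ^ (2 * W) := by simpa [b3] using hf₂ 3 (by decide)
      have d4 : t₂.r 4 = n := by simpa [b4] using hf₂ 4 (by decide)
      have d5 : t₂.r 5 = t.r 5 := by simpa [b5] using hf₂ 5 (by decide)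
      have d6 : t₂.r 6 = 2 ^ d := by simpa [b6] using hf₂ 6 (by decide)
      have hmem : ∀ i : Fin k, t₂.m i = P i := fun i => by
        rw [c1 i (by omega), a1]
      rw [← complexity_le_iff a3.1.1] at c2
      -- `X` has the least complexity for this error bound, so its complexity alone decides
      -- feasibility.
      have hfeas : Feasible D W n (t.r 5 + 2 ^ d) (2 ^ (2 * W)) P ↔ t₂.r 50 ≤ n := by
        rw [c2]
        refine IsBoundedErrorSolution.feasible_iff ?_
        rw [e6, e4] at a3
        exact_mod_cast a3
      refine Run.seq (T₁ := 2) (Q := fun u => u.r 0 = W ∧ u.r 1 = k ∧ u.r 3 = 2 ^ (2 * W) ∧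
        u.r 4 = n ∧ u.r 6 = 2 ^ d ∧ u.r 5 + 2 ^ d ≤ 2 ^ R ∧
        (∀ i : Fin k, u.m i = P i) ∧ ¬ Feasible D W n (u.r 5) (2 ^ (2 * W)) P ∧
        Feasible D W n (u.r 5 + 2 ^ d) (2 ^ (2 * W)) P) ?_ (by omega) ?_
      · refine Run.ite (by omega) (by simp) (by simp) (fun h => ?_) fun h => ?_
        · simp only [eval_reg, d4] at h
          refine Run.set hN rfl (by omega) (by simp) ?_
          refine ⟨by simp [d0], by simp [d1], by simp [d3], by simp [d4], by simp [d6],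
            by simp [d2]; omega, by simpa using hmem, ?_, ?_⟩
          · simp only [eval_reg, St.set_r, if_true, d2, hfeas]; omega
          · simp only [eval_reg, St.set_r, if_true, d2]
            rwa [add_assoc, ← mul_two]
        · simp only [eval_reg, d4] at h
          refine Run.skip ⟨d0, d1, d3, d4, d6, by omega, hmem, by rwa [d5], ?_⟩
          rw [d5, hfeas]; omega
      · rintro u hu - ⟨q0, q1, q3, q4, q6, q5, qm, qn, qf⟩
        refine Run.set hN rfl (by omega) (by simp) ?_
        simp [q0, q1, q3, q4, q6, hd1, Nat.shiftRight_eq_div_pow]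
        exact ⟨by omega, q5, qm, qn, qf⟩
    · rintro t ht hf ⟨e1, e2, e3, e4, e5, e6, e7, e8, e9, e10⟩
      simp at e7 e10
      exact ⟨e2, e3, e4, e7, e8, e9, e10⟩
  · rintro t ht hf ⟨e0, e1, e3, e5, em, en, ef⟩
    have hRB : 2 ^ R ≤ 2 ^ (6 * w) := Nat.pow_le_pow_right (by norm_num) (by omega)
    refine Run.set_seq hN rfl (by omega) (by simp; omega) ?_
    refine Run.conseq (run_errorS D (w := w) (W := W) (k := k) (P := P) hW hWw hk
      (by simpa using e0) (by simpa using e1) (by simp) (by simp; omega) (by simp; omega)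
      hP hD (by simpa using em) le_rfl) (by omega) ?_
    rintro t' - - ⟨P', h3, h4⟩
    refine ⟨P', isBoundedLengthSolution_of_feasible hP hD en ef ?_, h4⟩
    simpa [e3] using h3

end TCAM

namespace TCAM
open TCAM.Expr TCAM.Stmt

/-! ### Time bounds -/

theorem bdd_initSt {k W N : ℕ} {args : List ℕ} {P : Fin k → ℕ} (hP : IsPartition W P)
    (hN : 2 ^ W < N) (h : ∀ x ∈ args, x < N) : (initSt args P).Bdd N := by
  refine ⟨fun x => ?_, fun x => ?_⟩
  · show args.getD x 0 < N
    rw [List.getD_eq_getElem?_getD]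
    rcases hx : args[x]? with _ | y
    · exact lt_of_le_of_lt (Nat.zero_le _) hN
    · exact h y (List.mem_of_getElem? hx)
  · show (if h : x < k then P ⟨x, h⟩ else 0) < N
    split_ifs with hx
    · exact lt_of_le_of_lt (hP.le _) hN
    · exact lt_of_le_of_lt (Nat.zero_le _) hN

theorem log2_le_logb (n : ℕ) : (Nat.log2 n : ℝ) ≤ Real.logb 2 n := by
  rw [Nat.log2_eq_log_two]
  exact_mod_cast Real.natLog_le_logb n 2

theorem one_le_logb_succ {W : ℕ} (hW : 1 ≤ W) : 1 ≤ Real.logb 2 ((W : ℝ) + 1) := by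
  rw [Real.le_logb_iff_rpow_le (by norm_num) (by positivity), Real.rpow_one]
  have : (1 : ℝ) ≤ W := by exact_mod_cast hW
  linarith

theorem buildTime_le {W k : ℕ} (hW : 1 ≤ W) (hk : 1 ≤ k) :
    (buildTime W k : ℝ) ≤ 2134 * (k * Real.logb 2 ((W : ℝ) + 1)) := by
  have hL := one_le_logb_succ hW
  have hk' : (1 : ℝ) ≤ k := by exact_mod_cast hk
  have h1 : (Nat.log2 W : ℝ) ≤ Real.logb 2 ((W : ℝ) + 1) :=
    (log2_le_logb W).trans (Real.logb_le_logb_of_le (by norm_num) (by exact_mod_cast hW)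
      (by linarith))
  unfold buildTime
  push_cast
  set L := Real.logb 2 ((W : ℝ) + 1)
  have h2 : (k : ℝ) ≤ k * L := le_mul_of_one_le_right (by linarith) hL
  have h3 : ((Nat.log2 W : ℝ) + 1) * (3 * k + 9) ≤ 2 * L * (12 * k) :=
    mul_le_mul (by linarith) (by linarith) (by positivity) (by linarith)
  linarith

/-- The factor `2` of `n` in `matchTime` comes from two list entries per transfer; it is pulled out
of the minimum. -/
theorem matchTime_le {W k n : ℕ} (hW : 1 ≤ W) (hk : 1 ≤ k) :
    (matchTime W k n : ℝ) ≤ 2134 * (k * Real.logb 2 ((W : ℝ) + 1)) +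
      4202 * min ((W : ℝ) * k) (k + n * Real.logb 2 k) := by
  have hL := one_le_logb_succ hW
  have hk' : (1 : ℝ) ≤ k := by exact_mod_cast hk
  unfold matchTime
  push_cast
  set L := Real.logb 2 ((W : ℝ) + 1)
  have h2 : (k : ℝ) ≤ k * L := le_mul_of_one_le_right (by linarith) hL
  have h3 : min ((W : ℝ) * k) (2 * n * (Nat.log2 k : ℝ)) ≤
      2 * min ((W : ℝ) * k) (k + n * Real.logb 2 k) := by
    rw [mul_min_of_nonneg _ _ (by norm_num)]
    refine min_le_min ?_ ?_
    · have : (0 : ℝ) ≤ (W : ℝ) * k := by positivity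
      linarith
    · have := mul_le_mul_of_nonneg_left (log2_le_logb k) (Nat.cast_nonneg (α := ℝ) n)
      linarith
  linarith

theorem boundedErrorSolvable (D : OneSidedDistance) :
    BoundedErrorSolvableIn D fun W k => (k : ℝ) * Real.logb 2 ((W : ℝ) + 1) := by
  refine ⟨(errorS D).comp 0, 20, (errorS D).unit * 2200, ?_⟩
  intro w W k a b P hW hWw hk ha hb ha0 hb0 hP hD
  have hN := wordBound_twenty (show 2 ≤ w by omega)
  have h1000 := two_pow_mul_le (show 2 ≤ w by omega)
  have hwlt : w < 2 ^ w := Nat.lt_two_pow_self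
  have hpw : 2 ^ W ≤ 2 ^ w := Nat.pow_le_pow_right (by norm_num) hWw.le
  have h6 : 2 ^ w ≤ 2 ^ (6 * w) := Nat.pow_le_pow_right (by norm_num) (by omega)
  refine Run.exists_outputsWithin (T := buildTime W k + 3 * k + 2) hN.lit ?_
    (bdd_initSt hP (by omega) ?_)
    (run_errorS D (s := initSt [W, k, a, b] P) hW hWw hk rfl rfl ha0 (ha.le.trans h6) hb0 hP hD
      (fun i => ?_) le_rfl) ?_
  · cases D <;> decide
  · simp only [List.mem_cons, List.not_mem_nil, or_false]
    rintro x (rfl | rfl | rfl | rfl) <;> omega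
  · simp [initSt, initial]
  · have hk1 : (1 : ℝ) ≤ k := by exact_mod_cast hP.pos
    have hL := one_le_logb_succ hW
    have h1 := buildTime_le hW hP.pos
    have h2 : (k : ℝ) ≤ k * Real.logb 2 ((W : ℝ) + 1) :=
      le_mul_of_one_le_right (by linarith) hL
    push_cast
    rw [mul_assoc]
    exact mul_le_mul_of_nonneg_left (by linarith) (Nat.cast_nonneg _)

theorem boundedLengthSolvable (D : OneSidedDistance) :
    BoundedLengthSolvableIn D fun W k n => (W : ℝ) * ((k : ℝ) * Real.logb 2 ((W : ℝ) + 1) +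
      min ((W : ℝ) * (k : ℝ)) ((k : ℝ) + (n : ℝ) * Real.logb 2 (k : ℝ))) := by
  refine ⟨(lengthS D).comp 0, 20, (lengthS D).unit * 20000, ?_⟩
  intro w W k n P hW hWw hk hn hn1 hP hD
  have hN := wordBound_twenty (show 2 ≤ w by omega)
  have h1000 := two_pow_mul_le (show 2 ≤ w by omega)
  have hwlt : w < 2 ^ w := Nat.lt_two_pow_self
  have hpw : 2 ^ W ≤ 2 ^ w := Nat.pow_le_pow_right (by norm_num) hWw.le
  refine Run.exists_outputsWithin hN.lit ?_ (bdd_initSt hP (by omega) ?_)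
    (run_lengthS D (s := initSt [W, k, n] P) hW hWw hk rfl rfl rfl hn1 hn hP hD
      (fun i => ?_) le_rfl) ?_
  · cases D <;> decide
  · simp only [List.mem_cons, List.not_mem_nil, or_false]
    rintro x (rfl | rfl | rfl) <;> omega
  · simp [initSt, initial]
  · have hk1 : (1 : ℝ) ≤ k := by exact_mod_cast hP.pos
    have hW1 : (1 : ℝ) ≤ W := by exact_mod_cast hW
    have hL := one_le_logb_succ hW
    have h1 := buildTime_le hW hP.pos
    have h2 : (k : ℝ) ≤ k * Real.logb 2 ((W : ℝ) + 1) :=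
      le_mul_of_one_le_right (by linarith) hL
    have h3 := matchTime_le (n := n) hW hP.pos
    have h4 : 0 ≤ min ((W : ℝ) * k) (k + n * Real.logb 2 k) :=
      le_min (by positivity) (add_nonneg (by linarith)
        (mul_nonneg (Nat.cast_nonneg _) (Real.logb_nonneg (by norm_num) hk1)))
    push_cast
    rw [mul_assoc]
    refine mul_le_mul_of_nonneg_left ?_ (Nat.cast_nonneg _)
    set A := (k : ℝ) * Real.logb 2 ((W : ℝ) + 1)
    set M := min ((W : ℝ) * k) (k + n * Real.logb 2 k)
    -- The number of rounds is at most `4 * W`, and `4273 = 2 * 2134 + 5` collects building,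
    -- matching and the overhead of a round.
    have h5 : (3 * (W : ℝ) + 1) * (buildTime W k + matchTime W k n + 5) ≤
        4 * W * (4273 * A + 4202 * M) :=
      mul_le_mul (by linarith) (by linarith) (by positivity) (by positivity)
    have h6 : A ≤ W * A := le_mul_of_one_le_left (by linarith) hW1
    have h7 : 0 ≤ (W : ℝ) * M := by positivity
    have h8 : 4 * (W : ℝ) * (4273 * A + 4202 * M) = 17092 * (W * A) + 16808 * (W * M) := by ring
    have h9 : (initSt [W, k, n] P).r 2 = n := rfl
    rw [h9, mul_add]
    linarith

end TCAM

/-- For both one-sided distances; `W ≥ 1` throughout, and `lg (W + 1)` stands for `lg W` so that the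
bounds also make sense for `W = 1` (for `W ≥ 2` they agree up to a factor of two). -/
theorem mainTheorem8 (D : TCAM.OneSidedDistance) :
    TCAM.BoundedErrorSolvableIn D
      (fun W k => (k : ℝ) * Real.logb 2 ((W : ℝ) + 1)) ∧
    TCAM.BoundedLengthSolvableIn D
      (fun W k n => (W : ℝ) * ((k : ℝ) * Real.logb 2 ((W : ℝ) + 1) +
        min ((W : ℝ) * (k : ℝ)) ((k : ℝ) + (n : ℝ) * Real.logb 2 (k : ℝ)))) :=
  ⟨TCAM.boundedErrorSolvable D, TCAM.boundedLengthSolvable D⟩
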